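/- Let $(Y,m)$ be a probability space with a metric $d_Y$ of diameter at most $1$, and let $F:Y\to Y$ be nonsingular. Let $\alpha$ be an at most countable measurable partition of $Y$ such that $F$ restricts to a measure-theoretic bijection from $a$ onto $Y$ for each $a\in\alpha$. Let $\zeta=\frac{dm}{dm\circ F}>0$ and suppose that there are constants $\lambda>1$, $K>0$, $\eta\in(0,1]$ such that, for all $x,y$ in the same partition element, $$d_Y(Fx,Fy)\ge\lambda\, d_Y(x,y),\qquad |\log\zeta(x)-\log\zeta(y)|\le K\,d_Y(Fx,Fy)^\eta .$$ (The measure $m$ need not be $F$-invariant.) Let $\tau:Y\to\{1,2,\dots\}$ be integrable and constant on partition elements, and put $\bar\tau=\int_Y\tau\,dm$. Define the tower $\Delta=\{(y,\ell)\in Y\times\mathbb Z:0\le\ell\le\tau(y)-1\}$, with map $f(y,\ell)=(y,\ell+1)$ if $\ell\le\tau(y)-2$ and $f(y,\tau(y)-1)=(Fy,0)$, with probability measure $m_\Delta$ given by $m_\Delta(A\times\{\ell\})=\bar\tau^{-1}m(A)$ for measurable $A\subset\{\tau\ge\ell+1\}$, and with metric $d_\Delta((y,\ell),(y',\ell'))=d_Y(y,y')$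 if $\ell=\ell'$ and $1$ otherwise. For $\phi:\Delta\to\mathbb R$ let $$\|\phi\|_\eta=\sup_{x\ne y}\frac{|\phi(x)-\phi(y)|}{d_\Delta(x,y)^\eta}+\sup|\phi| .$$ Let $L:L^1(\Delta)\to L^1(\Delta)$ be the transfer operator of $f$ with respect to $m_\Delta$, that is, $\int_\Delta L\phi\,\psi\,dm_\Delta=\int_\Delta\phi\,\psi\circ f\,dm_\Delta$ for $\phi\in L^1$, $\psi\in L^\infty$. Suppose that the tower is nonmixing: $d=\gcd\{j\ge1:m(\tau=j)>0\}\ge2$. Let $\delta>0$ and let $I$ be a finite set of positive integers such that $\gcd I=d$ and $m(\tau=i)\ge\delta$ for every $i\in I$ (such $\delta$ and $I$ always exist). Let $\phi:\Delta\to\mathbb R$ be a (measurable) observable with $\|\phi\|_\eta<\infty$ and $\int_\Delta\phi\,dm_\Delta=0$. 1. Suppose that $m(\tau\ge n)\le C_\tau n^{-\beta}$ for some $C_\tau>0$, $\beta>1$ and all $n\ge1$. Then there is a constant $C>0$, depending only and continuously on $\lambda,K,\eta,\max I,\delta,\beta,C_\tau$, such that for all $n\ge1$ $$\int_\Delta\Bigl|\sum_{k=0}^{d-1}L^{nd+k}\phi\Bigr|\,dm_\Delta\le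 C\,\|\phi\|_\eta\,n^{-(\beta-1)} .$$ 2. Suppose that $m(\tau\ge n)\le C_\tau e^{-An^\gamma}$ for some $C_\tau>0$, $A>0$, $0<\gamma\le1$ and all $n\ge1$. Then there are constants $B>0$ and $C>0$, depending only and continuously on $\lambda,K,\eta,\max I,\delta,A,\gamma,C_\tau$, such that for all $n\ge0$ $$\int_\Delta\Bigl|\sum_{k=0}^{d-1}L^{nd+k}\phi\Bigr|\,dm_\Delta\le C\,\|\phi\|_\eta\,e^{-Bn^\gamma} .$$ -/

import Mathlib

open MeasureTheory Set
open scoped ENNReal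

universe u

noncomputable section

/-- `F` restricts to a measure-theoretic bijection from `a` onto the whole space: it is injective
on `a`, maps measurable subsets of `a` to (null-)measurable sets, and its image `F(a)` has full
measure. -/
structure IsMeasureBijOnto {Y : Type u} [MeasurableSpace Y] (m : Measure Y) (F : Y → Y)
    (a : Set Y) : Prop where
  injOn : InjOn F a
  image_nullMeasurable : ∀ E ⊆ a, MeasurableSet E → NullMeasurableSet (F '' E) m
  image_full : m (F '' a)ᶜ = 0

/-- A (full branch) uniformly expanding map `F : Y → Y` on a probability space `(Y, m)` with a
metric of diameter at most one, with partition `α` (up to null sets), inverse Jacobian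
`ζ = dm / d(m ∘ F)`, and constants `lam > 1`, `K > 0`, `η ∈ (0, 1]`.
The measure `m` is not assumed to be `F`-invariant. -/
structure UniformlyExpandingMap {Y : Type u} [MeasurableSpace Y] [MetricSpace Y]
    (m : Measure Y) (lam K η : ℝ) where
  one_lt_lam : 1 < lam
  K_pos : 0 < K
  η_pos : 0 < η
  η_le_one : η ≤ 1
  dist_le_one : ∀ x y : Y, dist x y ≤ 1
  /-- the map -/
  F : Y → Y
  nonsingular : Measure.QuasiMeasurePreserving F m m
  /-- the partition -/
  α : Set (Set Y)
  α_countable : α.Countable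
  α_measurable : ∀ a ∈ α, MeasurableSet a
  α_disjoint : α.PairwiseDisjoint id
  α_cover : m (⋃₀ α)ᶜ = 0
  bij : ∀ a ∈ α, IsMeasureBijOnto m F a
  /-- the inverse Jacobian -/
  ζ : Y → ℝ
  ζ_measurable : Measurable ζ
  ζ_pos : ∀ x, 0 < ζ x
  /-- On each partition element `d(m ∘ F) / dm = 1 / ζ`, where `(m ∘ F)(E) = m (F(E))`. -/
  ζ_jacobian : ∀ a ∈ α, ∀ E ⊆ a, MeasurableSet E →
    m (F '' E) = ∫⁻ x in E, ENNReal.ofReal (ζ x)⁻¹ ∂m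
  expansion : ∀ a ∈ α, ∀ x ∈ a, ∀ y ∈ a, lam * dist x y ≤ dist (F x) (F y)
  distortion : ∀ a ∈ α, ∀ x ∈ a, ∀ y ∈ a,
    |Real.log (ζ x) - Real.log (ζ y)| ≤ K * dist (F x) (F y) ^ η

/-- The data of a Young tower: a uniformly expanding base map together with an integrable
return time `τ : Y → {1, 2, ...}` that is constant on partition elements. -/
structure YoungTower {Y : Type u} [MeasurableSpace Y] [MetricSpace Y]
    (m : Measure Y) (lam K η : ℝ) extends UniformlyExpandingMap m lam K η where
  /-- the return time -/
  τ : Y → ℕ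
  τ_pos : ∀ y, 1 ≤ τ y
  τ_measurable : Measurable τ
  τ_const : ∀ a ∈ α, ∀ x ∈ a, ∀ y ∈ a, τ x = τ y
  τ_integrable : Integrable (fun y => (τ y : ℝ)) m

/-- `d` is the greatest common divisor of the set `S` of natural numbers. -/
def IsGcdOfSet (S : Set ℕ) (d : ℕ) : Prop :=
  (∀ j ∈ S, d ∣ j) ∧ ∀ e : ℕ, (∀ j ∈ S, e ∣ j) → e ∣ d

/-- The transfer operator of `f : X → X` with respect to `μ`: `transferOp μ f φ` is the density
with respect to `μ` of the push-forward under `f` of the signed measure `φ dμ`. -/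
def transferOp {X : Type u} [MeasurableSpace X] (μ : Measure X) (f : X → X) (φ : X → ℝ) : X → ℝ :=
  SignedMeasure.rnDeriv ((μ.withDensityᵥ φ).map f) μ

theorem integrable_transferOp {X : Type u} [MeasurableSpace X] (μ : Measure X) (f : X → X)
    (φ : X → ℝ) : Integrable (transferOp μ f φ) μ :=
  SignedMeasure.integrable_rnDeriv _ _

/-- The defining duality of the transfer operator: `∫ (L φ) 1_s dμ = ∫ φ (1_s ∘ f) dμ`. -/
theorem setIntegral_transferOp {X : Type u} [MeasurableSpace X] {μ : Measure X} [SigmaFinite μ]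
    {f : X → X} (hf : Measure.QuasiMeasurePreserving f μ μ) {φ : X → ℝ} (hφ : Integrable φ μ)
    {s : Set X} (hs : MeasurableSet s) :
    ∫ x in s, transferOp μ f φ x ∂μ = ∫ x in f ⁻¹' s, φ x ∂μ := by
  have hac : VectorMeasure.AbsolutelyContinuous ((μ.withDensityᵥ φ).map f)
      μ.toENNRealVectorMeasure := by
    refine VectorMeasure.AbsolutelyContinuous.mk fun t ht h0 => ?_
    rw [Measure.toENNRealVectorMeasure_apply_measurable ht] at h0
    rw [VectorMeasure.map_apply _ hf.measurable ht,
      withDensityᵥ_apply hφ (hf.measurable ht)]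
    exact setIntegral_measure_zero _ (hf.preimage_null h0)
  have h := SignedMeasure.withDensityᵥ_rnDeriv_eq _ μ hac
  have h2 := congrArg (fun v : SignedMeasure X => v s) h
  rw [withDensityᵥ_apply (SignedMeasure.integrable_rnDeriv _ _) hs,
    VectorMeasure.map_apply _ hf.measurable hs, withDensityᵥ_apply hφ (hf.measurable hs)] at h2
  exact h2

namespace YoungTower

variable {Y : Type u} [MeasurableSpace Y] [MetricSpace Y] {m : Measure Y} {lam K η : ℝ}

/-- The tower `Δ = {(y, ℓ) : 0 ≤ ℓ ≤ τ(y) - 1}`. -/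
abbrev Space (T : YoungTower m lam K η) : Type u := {p : Y × ℕ // p.2 < T.τ p.1}

/-- The tower map: `f(y, ℓ) = (y, ℓ + 1)` if `ℓ ≤ τ(y) - 2`, and `f(y, τ(y) - 1) = (F y, 0)`. -/
def map (T : YoungTower m lam K η) (x : T.Space) : T.Space :=
  if h : x.1.2 + 1 < T.τ x.1.1 then ⟨(x.1.1, x.1.2 + 1), h⟩ else ⟨(T.F x.1.1, 0), T.τ_pos _⟩

theorem measurable_map (T : YoungTower m lam K η) : Measurable T.map := by
  have hs : MeasurableSet {x : T.Space | x.1.2 + 1 < T.τ x.1.1} := by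
    have h1 : Measurable fun x : T.Space => x.1.2 + 1 := by fun_prop
    have h2 : Measurable fun x : T.Space => T.τ x.1.1 := T.τ_measurable.comp (by fun_prop)
    exact measurableSet_lt h1 h2
  have hF : Measurable T.F := T.nonsingular.measurable
  refine Measurable.subtype_mk (f := fun x : T.Space => (T.map x).1) (h := fun x => (T.map x).2) ?_
  have : (fun x : T.Space => (T.map x).1) =
      {x : T.Space | x.1.2 + 1 < T.τ x.1.1}.piecewise
        (fun x => (x.1.1, x.1.2 + 1)) (fun x => (T.F x.1.1, 0)) := by
    classical
    funext x
    by_cases h : x.1.2 + 1 < T.τ x.1.1 <;> simp [map, h, Set.piecewise]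
  rw [this]
  refine Measurable.piecewise hs (by fun_prop) ?_
  exact (hF.comp (by fun_prop)).prodMk measurable_const

/-- The mean return time. -/
def meanReturn (T : YoungTower m lam K η) : ℝ := ∫ y, (T.τ y : ℝ) ∂m

/-- The probability measure on the tower with `m_Δ (A × {ℓ}) = m(A) / meanReturn`. -/
def measure (T : YoungTower m lam K η) : Measure T.Space :=
  (ENNReal.ofReal T.meanReturn)⁻¹ • (m.prod Measure.count).comap Subtype.val

/-- The metric on the tower. -/
def towerDist (T : YoungTower m lam K η) (x y : T.Space) : ℝ :=
  if x.1.2 = y.1.2 then dist x.1.1 y.1.1 else 1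

/-- The Hölder seminorm `|φ|_η = sup_{x ≠ y} |φ(x) - φ(y)| / d_Δ(x, y)^η`. -/
def holderSeminorm (T : YoungTower m lam K η) (φ : T.Space → ℝ) : ℝ≥0∞ :=
  ⨆ (x : T.Space) (y : T.Space) (_ : x ≠ y), ENNReal.ofReal (|φ x - φ y| / T.towerDist x y ^ η)

/-- The Hölder norm `‖φ‖_η = |φ|_η + |φ|_∞`, possibly infinite. -/
def holderNorm (T : YoungTower m lam K η) (φ : T.Space → ℝ) : ℝ≥0∞ :=
  T.holderSeminorm φ + ⨆ x : T.Space, ENNReal.ofReal |φ x|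

/-- The transfer operator `L` of the tower map with respect to `m_Δ`. -/
def transfer (T : YoungTower m lam K η) (φ : T.Space → ℝ) : T.Space → ℝ :=
  transferOp T.measure T.map φ

/-- The tower is nonmixing with period `d = gcd {j ≥ 1 : m(τ = j) > 0} ≥ 2`, and `I` is a finite
set of positive integers with greatest common divisor `d` and `m(τ = i) ≥ δ > 0` for `i ∈ I`. -/
structure IsNonmixing (T : YoungTower m lam K η) (d : ℕ) (I : Finset ℕ) (δ : ℝ) : Prop where
  two_le : 2 ≤ d
  isGcd : IsGcdOfSet {j : ℕ | 1 ≤ j ∧ 0 < m {y | T.τ y = j}} d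
  I_pos : ∀ i ∈ I, 1 ≤ i
  I_gcd : I.gcd id = d
  δ_pos : 0 < δ
  I_measure : ∀ i ∈ I, δ ≤ m.real {y | T.τ y = i}

/-- The quantity `∫ |∑_{k=0}^{d-1} L^{nd+k} φ| dm_Δ`. -/
def cycleDecay (T : YoungTower m lam K η) (d : ℕ) (φ : T.Space → ℝ) (n : ℕ) : ℝ :=
  ∫ x, |∑ k ∈ Finset.range d, (T.transfer^[n * d + k] φ) x| ∂T.measure

end YoungTower

end

/-! The proof couples measures by induction on time. Call a measure on the base regular when the
logarithm of its density is Hölder. Full branches, expansion and bounded distortion send the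
regularity constant `R` to `K + lam ^ (-η) * R`. So if `R < R'` and `K + lam ^ (-η) * R' ≤ R`, an
`R`-regular measure can give up a small multiple of `m`, become merely `R'`-regular, and be
`R`-regular again at its next visit to the base (`RegularOn.sub`, `regularOn_exit`).

An orbit started on the base meets the base only at multiples of `d`, and at all large multiples it
has a definite mass there (`exists_le_slice_zero_orbit`). Two such orbits, seen at times congruent
modulo `d`, can therefore both give up the same multiple of `m`, which cancels. The remainders are
cut up by the time of their next visit to the base, and any two pieces that carry mass are again
regular measures on the base, seen at congruent but earlier times. In `isCoupled` this becomes a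
renewal inequality for the distance `H`: the waiting time is the maximum of two independent entrance
times, and its tail is controlled by the tail sums of `m (τ > n)`. Passing to tail sums is what
turns `n ^ (-β)` into `n ^ (-(β - 1))`.

A measure on the whole tower occupies all residue classes. A window of `d` consecutive times meets
each class once, so after summation over a window the pieces can be matched class by class
(`sum_range_le_sum_range_of_modEq`, `sum_measure_iterate_le`). With `M` at least the norm of `φ`,
this is applied to the measures of densities `φ + 2 * M` and `2 * M`, and duality gives
`cycleDecay_le`.

The renewal inequality is solved in `exists_isRenewalRate_polyRate` and
`exists_isRenewalRate_expRate`. Every constant is found uniformly on boxes of parameters. Since the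
admissible constants form a convex set, locally constant choices can be glued to continuous ones. -/

/-! ### Measures with log-Hölder densities -/

/-- `μ` has a density `p` with respect to `m` such that `log p` is Hölder with exponent `η` and
constant `R` on each element of `P`, up to a null set. -/
def RegularOn {Y : Type u} [MeasurableSpace Y] [MetricSpace Y] (m : Measure Y) (η R : ℝ)
    (P : Set (Set Y)) (μ : Measure Y) : Prop :=
  ∃ p : Y → ℝ≥0∞, Measurable p ∧ (∃ S : Set Y, MeasurableSet S ∧ m Sᶜ = 0 ∧
    ∀ a ∈ P, ∀ x ∈ S ∩ a, ∀ y ∈ S ∩ a,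
      p x ≤ ENNReal.ofReal (Real.exp (R * dist x y ^ η)) * p y) ∧ μ = m.withDensity p

namespace RegularOn

variable {Y : Type u} [MeasurableSpace Y] [MetricSpace Y] {m : Measure Y} {η R R' : ℝ}
  {P : Set (Set Y)} {μ : Measure Y}

theorem mono (h : RegularOn m η R P μ) (hR : R ≤ R') : RegularOn m η R' P μ := by
  obtain ⟨p, hp, ⟨S, hS, hS0, h⟩, rfl⟩ := h
  refine ⟨p, hp, ⟨S, hS, hS0, fun a ha x hx y hy => (h a ha x hx y hy).trans ?_⟩, rfl⟩
  gcongr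

theorem of_univ (h : RegularOn m η R {univ} μ) : RegularOn m η R P μ := by
  obtain ⟨p, hp, ⟨S, hS, hS0, h⟩, rfl⟩ := h
  exact ⟨p, hp, ⟨S, hS, hS0, fun a _ x hx y hy =>
    h univ rfl x ⟨hx.1, trivial⟩ y ⟨hy.1, trivial⟩⟩, rfl⟩

theorem zero : RegularOn m η R P 0 :=
  ⟨0, measurable_zero, ⟨univ, .univ, by simp, by simp⟩, by simp⟩

theorem absolutelyContinuous (h : RegularOn m η R P μ) : μ ≪ m := by
  obtain ⟨p, -, -, rfl⟩ := h
  exact withDensity_absolutelyContinuous _ _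

theorem sum {ι : Type*} [Countable ι] {μ : ι → Measure Y} (h : ∀ i, RegularOn m η R P (μ i)) :
    RegularOn m η R P (Measure.sum μ) := by
  choose p hp hS hμ using h
  choose S hS0 h using hS
  refine ⟨∑' i, p i, .tsum' hp, ⟨⋂ i, S i, .iInter hS0, ?_, ?_⟩, ?_⟩
  · rw [compl_iInter, measure_iUnion_null_iff]
    exact fun i => (h i).1
  · intro a ha x hx y hy
    have hx' := mem_iInter.1 hx.1
    have hy' := mem_iInter.1 hy.1
    rw [tsum_apply (Pi.summable.2 fun _ => ENNReal.summable),
      tsum_apply (Pi.summable.2 fun _ => ENNReal.summable), ← ENNReal.tsum_mul_left]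
    exact ENNReal.tsum_le_tsum fun i => (h i).2 a ha x ⟨hx' i, hx.2⟩ y ⟨hy' i, hy.2⟩
  · rw [withDensity_tsum hp]
    congr 1
    exact funext hμ

theorem smul (c : ℝ≥0∞) (h : RegularOn m η R P μ) : RegularOn m η R P (c • μ) := by
  obtain ⟨p, hp, ⟨S, hS, hS0, h⟩, rfl⟩ := h
  refine ⟨c • p, hp.const_smul c, ⟨S, hS, hS0, fun a ha x hx y hy => ?_⟩,
    (withDensity_smul c hp).symm⟩
  simp only [Pi.smul_apply, smul_eq_mul, mul_left_comm _ c]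
  gcongr
  exact h a ha x hx y hy

theorem restrict {E : Set Y} (hE : MeasurableSet E) (hP : ∀ a ∈ P, a ⊆ E ∨ Disjoint a E)
    (h : RegularOn m η R P μ) : RegularOn m η R P (μ.restrict E) := by
  obtain ⟨p, hp, ⟨S, hS, hS0, h⟩, rfl⟩ := h
  refine ⟨E.indicator p, hp.indicator hE, ⟨S, hS, hS0, fun a ha x hx y hy => ?_⟩,
    by rw [restrict_withDensity hE, withDensity_indicator hE]⟩
  rcases hP a ha with h' | h'
  · rw [indicator_of_mem (h' hx.2), indicator_of_mem (h' hy.2)]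
    exact h a ha x hx y hy
  · rw [indicator_of_notMem (disjoint_left.1 h' hx.2)]
    exact zero_le

theorem density_le {Y : Type u} [MetricSpace Y] {η R : ℝ} (hm : ∀ x y : Y, dist x y ≤ 1)
    (hη : 0 < η) (hR : 0 ≤ R) (x y : Y) :
    ENNReal.ofReal (Real.exp (R * dist x y ^ η)) ≤ ENNReal.ofReal (Real.exp R) := by
  have : dist x y ^ η ≤ 1 := Real.rpow_le_one dist_nonneg (hm x y) hη.le
  gcongr
  nlinarith

/-- A Harnack inequality: the diameter is at most one, so the density varies by a factor of at most
`exp R`, and the ratios `μ / m` on any two sets are comparable. -/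
theorem mul_le [IsProbabilityMeasure m] (hm : ∀ x y : Y, dist x y ≤ 1) (hη : 0 < η) (hR : 0 ≤ R)
    (h : RegularOn m η R {univ} μ) {A B : Set Y} (hA : MeasurableSet A) (hB : MeasurableSet B) :
    μ A * m B ≤ ENNReal.ofReal (Real.exp R) * (m A * μ B) := by
  obtain ⟨p, hp, ⟨S, hS, hS0, h⟩, rfl⟩ := h
  have key : ∀ x ∈ S, ∀ y ∈ S, p x ≤ ENNReal.ofReal (Real.exp R) * p y := fun x hx y hy =>
    (h univ rfl x ⟨hx, trivial⟩ y ⟨hy, trivial⟩).trans (mul_le_mul_left (density_le hm hη hR x y) _)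
  have hS' : ∀ᵐ x ∂m, x ∈ S := hS0
  have h1 : ∀ x ∈ S, p x * m B ≤ ENNReal.ofReal (Real.exp R) * ∫⁻ y in B, p y ∂m := by
    intro x hx
    rw [← setLIntegral_const, ← lintegral_const_mul _ hp]
    exact lintegral_mono_ae (ae_restrict_of_ae (hS'.mono fun y hy => key x hx y hy))
  rw [withDensity_apply _ hA, withDensity_apply _ hB, ← lintegral_mul_const _ hp]
  calc ∫⁻ x in A, p x * m B ∂m
      ≤ ∫⁻ x in A, ENNReal.ofReal (Real.exp R) * ∫⁻ y in B, p y ∂m ∂m :=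
        lintegral_mono_ae (ae_restrict_of_ae (hS'.mono h1))
    _ = _ := by rw [setLIntegral_const]; ring

theorem le_smul [IsProbabilityMeasure m] (hm : ∀ x y : Y, dist x y ≤ 1) (hη : 0 < η) (hR : 0 ≤ R)
    (h : RegularOn m η R {univ} μ) : μ ≤ (ENNReal.ofReal (Real.exp R) * μ univ) • m := by
  refine Measure.le_iff.2 fun A hA => ?_
  have := h.mul_le hm hη hR hA .univ
  simp only [measure_univ, mul_one] at this
  simpa [mul_comm, mul_left_comm] using this

theorem mul_le_apply [IsProbabilityMeasure m] (hm : ∀ x y : Y, dist x y ≤ 1) (hη : 0 < η)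
    (hR : 0 ≤ R) (h : RegularOn m η R {univ} μ) {A : Set Y} (hA : MeasurableSet A) :
    μ univ * m A ≤ ENNReal.ofReal (Real.exp R) * μ A := by
  simpa using h.mul_le hm hη hR .univ hA

/-- The elementary inequality behind subtracting a constant from a regular density. -/
theorem exp_sub_le {R R' D : ℝ} (hR : 0 ≤ R) (hRR : R < R') (hD0 : 0 ≤ D) (hD1 : D ≤ 1) :
    (R' - R) / (Real.exp R' - 1) * (Real.exp (R' * D) - 1) ≤
      Real.exp (R' * D) - Real.exp (R * D) := by
  have hpos : 0 < Real.exp R' - 1 := by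
    have := Real.add_one_le_exp R'; linarith
  have h1 : Real.exp (R' * D) - 1 ≤ D * (Real.exp R' - 1) := by
    have := convexOn_exp.2 (mem_univ R') (mem_univ 0) hD0 (by linarith : 0 ≤ 1 - D) (by ring)
    simp only [smul_eq_mul, mul_zero, add_zero, Real.exp_zero, mul_one] at this
    rw [mul_comm R' D]; linarith
  have h2 : (R' - R) * D ≤ Real.exp (R' * D) - Real.exp (R * D) := by
    have e : Real.exp (R' * D) = Real.exp (R * D) * Real.exp ((R' - R) * D) := by
      rw [← Real.exp_add]; ring_nf
    have h3 := Real.add_one_le_exp ((R' - R) * D)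
    have h4 : 1 ≤ Real.exp (R * D) := Real.one_le_exp (by positivity)
    have h5 : 0 ≤ (R' - R) * D := mul_nonneg (by linarith) hD0
    rw [e]; nlinarith
  calc _ ≤ (R' - R) / (Real.exp R' - 1) * (D * (Real.exp R' - 1)) := by
        apply mul_le_mul_of_nonneg_left h1
        exact div_nonneg (by linarith) hpos.le
    _ = (R' - R) * D := by field_simp
    _ ≤ _ := h2

/-- The density is at least `exp (-R)` times the total mass. Write `D` for `dist x y ^ η`.
Subtracting `ξ` costs `ξ * (exp (R' * D) - 1)` in the comparison of two values, and the bound on `ξ`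
lets the gap `exp (R' * D) - exp (R * D)` absorb this cost for all `D` in `[0, 1]`. -/
theorem sub [IsProbabilityMeasure m] (hm : ∀ x y : Y, dist x y ≤ 1) (hη : 0 < η)
    (hR : 0 ≤ R) (hRR : R < R') [IsFiniteMeasure μ] (h : RegularOn m η R {univ} μ) {ξ : ℝ}
    (hξ0 : 0 ≤ ξ)
    (hξ : ξ ≤ (R' - R) / (Real.exp R' - 1) * (Real.exp (-R) * μ.real univ)) :
    ∃ ν : Measure Y, RegularOn m η R' {univ} ν ∧ μ = ENNReal.ofReal ξ • m + ν := by
  obtain ⟨p, hp, ⟨S, hS, hS0, h⟩, rfl⟩ := h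
  set μ := m.withDensity p with hμ
  have hfin : ∀ᵐ x ∂m, p x < ∞ := by
    refine ae_lt_top hp ?_
    have := measure_ne_top μ univ
    rwa [hμ, withDensity_apply _ .univ, Measure.restrict_univ] at this
  obtain ⟨S', hS'm, hS'0, hS'⟩ : ∃ S' : Set Y, MeasurableSet S' ∧ m S'ᶜ = 0 ∧
      ∀ x ∈ S', x ∈ S ∧ p x < ∞ :=
    ⟨S ∩ {x | p x < ∞}, hS.inter (measurableSet_lt hp measurable_const),
      by rw [compl_inter]; exact measure_union_null hS0 hfin, fun x hx => hx⟩
  have hlow : ∀ y ∈ S', Real.exp (-R) * μ.real univ ≤ (p y).toReal := by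
    intro y hy
    have h1 : μ univ ≤ ENNReal.ofReal (Real.exp R) * p y := by
      rw [hμ, withDensity_apply _ .univ, Measure.restrict_univ]
      calc ∫⁻ x, p x ∂m ≤ ∫⁻ x, ENNReal.ofReal (Real.exp R) * p y ∂m := by
            refine lintegral_mono_ae ?_
            have hS1 : ∀ᵐ x ∂m, x ∈ S := hS0
            filter_upwards [hS1] with x hx
            exact (h univ rfl x ⟨hx, trivial⟩ y ⟨(hS' y hy).1, trivial⟩).trans
              (mul_le_mul_left (density_le hm hη hR x y) _)
        _ = _ := by simp
    have h2 := ENNReal.toReal_mono (ENNReal.mul_ne_top ENNReal.ofReal_ne_top (hS' y hy).2.ne) h1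
    rw [ENNReal.toReal_mul, ENNReal.toReal_ofReal (Real.exp_pos _).le] at h2
    rw [Real.exp_neg, inv_mul_le_iff₀ (Real.exp_pos _)]
    exact h2
  have hRpos : 0 < Real.exp R' - 1 := by
    have := Real.add_one_le_exp R'; linarith
  set κ := (R' - R) / (Real.exp R' - 1) with hκ
  have hκ0 : 0 ≤ κ := div_nonneg (by linarith) hRpos.le
  have hκ1 : κ ≤ 1 := by
    rw [hκ, div_le_one hRpos]
    have := Real.add_one_le_exp R'; linarith
  have hξp : ∀ y ∈ S', ξ ≤ κ * (p y).toReal := fun y hy =>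
    hξ.trans (mul_le_mul_of_nonneg_left (hlow y hy) hκ0)
  have hξp' : ∀ y ∈ S', ENNReal.ofReal ξ ≤ p y := fun y hy => by
    rw [← ENNReal.ofReal_toReal (hS' y hy).2.ne]
    exact ENNReal.ofReal_le_ofReal ((hξp y hy).trans
      (mul_le_of_le_one_left ENNReal.toReal_nonneg hκ1))
  refine ⟨m.withDensity fun x => p x - ENNReal.ofReal ξ, ⟨_, hp.sub_const _,
    ⟨S', hS'm, hS'0, ?_⟩, rfl⟩, ?_⟩
  · rintro a rfl x ⟨hx, -⟩ y ⟨hy, -⟩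
    have h1 := h univ rfl x ⟨(hS' x hx).1, trivial⟩ y ⟨(hS' y hy).1, trivial⟩
    have hD0 : 0 ≤ dist x y ^ η := Real.rpow_nonneg dist_nonneg η
    have hD1 : dist x y ^ η ≤ 1 := Real.rpow_le_one dist_nonneg (hm x y) hη.le
    generalize dist x y ^ η = D at *
    have h3 := exp_sub_le hR hRR hD0 hD1
    have h4 := hξp y hy
    have hxf := (hS' x hx).2.ne
    have hyf := (hS' y hy).2.ne
    lift p x to NNReal using hxf with px
    lift p y to NNReal using hyf with py
    simp only [ENNReal.coe_toReal] at h4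
    rw [← ENNReal.ofReal_coe_nnreal, ← ENNReal.ofReal_coe_nnreal,
      ← ENNReal.ofReal_mul (Real.exp_pos _).le] at h1
    rw [← ENNReal.ofReal_coe_nnreal, ← ENNReal.ofReal_coe_nnreal, ← ENNReal.ofReal_sub _ hξ0,
      ← ENNReal.ofReal_sub _ hξ0, ← ENNReal.ofReal_mul (Real.exp_pos _).le]
    apply ENNReal.ofReal_le_ofReal
    rw [ENNReal.ofReal_le_ofReal_iff (by positivity)] at h1
    have h5 : 0 ≤ Real.exp (R' * D) - 1 := by
      have : 0 ≤ R' * D := mul_nonneg (by linarith) hD0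
      have := Real.one_le_exp this; linarith
    have hpy := py.2
    have h6 := mul_le_mul_of_nonneg_right h4 h5
    have h7 := mul_le_mul_of_nonneg_right h3 py.coe_nonneg
    nlinarith
  · rw [← withDensity_const, ← withDensity_add_left measurable_const]
    refine withDensity_congr_ae ?_
    have hS1 : ∀ᵐ x ∂m, x ∈ S' := hS'0
    filter_upwards [hS1] with x hx
    exact (add_tsub_cancel_of_le (hξp' x hx)).symm

end RegularOn

/-! ### Action of the base map on regular measures -/

namespace UniformlyExpandingMap

variable {Y : Type u} [MeasurableSpace Y] [MetricSpace Y] {m : Measure Y} {lam K η : ℝ}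

/-- The Jacobian formula on a full branch, in the form needed to change variables when the density
of an image measure is identified. -/
theorem map_withDensity_inv (T : UniformlyExpandingMap m lam K η) {a : Set Y} (ha : a ∈ T.α) :
    ((m.restrict a).withDensity fun x => ENNReal.ofReal (T.ζ x)⁻¹).map T.F = m := by
  have hF := T.nonsingular.measurable
  ext B hB
  rw [Measure.map_apply hF hB, withDensity_apply _ (hF hB),
    Measure.restrict_restrict (hF hB)]
  have h := T.ζ_jacobian a ha (T.F ⁻¹' B ∩ a) inter_subset_right
    ((hF hB).inter (T.α_measurable a ha))
  rw [← h, inter_comm, image_inter_preimage, inter_comm]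
  exact measure_inter_conull' (measure_mono_null (sdiff_subset_compl _ _) (T.bij a ha).image_full)

/-- The image density is `p * ζ` composed with the inverse branch. Contraction of that branch
multiplies `R` by `lam ^ (-η)`, and the distortion of `ζ` adds `K`. -/
theorem regularOn_map_restrict [IsProbabilityMeasure m] (T : UniformlyExpandingMap m lam K η)
    {a : Set Y} (ha : a ∈ T.α) {R R' : ℝ} (hR : 0 ≤ R) (hRR : K + lam ^ (-η) * R ≤ R')
    {μ : Measure Y} (h : RegularOn m η R T.α μ) :
    RegularOn m η R' {univ} ((μ.restrict a).map T.F) := by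
  obtain ⟨p, hp, ⟨S, hS, hS0, h⟩, rfl⟩ := h
  replace h := h a ha
  have hF := T.nonsingular.measurable
  have ham := T.α_measurable a ha
  have hinj := (T.bij a ha).injOn
  have : Nonempty Y := nonempty_of_isProbabilityMeasure m
  set g := Function.invFunOn T.F a
  have hg : ∀ x ∈ a, g (T.F x) = x := hinj.leftInvOn_invFunOn
  set k : Y → ℝ≥0∞ := fun x => p x * ENNReal.ofReal (T.ζ x)
  have hk : Measurable k := hp.mul T.ζ_measurable.ennreal_ofReal
  have hfull : ∀ᵐ y ∂m, y ∈ T.F '' a := (T.bij a ha).image_full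
  -- The inverse branch `g` need not be measurable. Images of measurable sets are only
  -- null-measurable, so `k ∘ g` is replaced by a measurable representative `q`.
  have hnull : AEMeasurable (k ∘ g) m := by
    refine NullMeasurable.aemeasurable fun C hC => ?_
    refine ((T.bij a ha).image_nullMeasurable (a ∩ k ⁻¹' C) inter_subset_left
      (ham.inter (hk hC))).congr ?_
    filter_upwards [hfull] with y hy
    obtain ⟨x, hx, rfl⟩ := hy
    apply propext
    change T.F x ∈ T.F '' (a ∩ k ⁻¹' C) ↔ k (g (T.F x)) ∈ C
    rw [hg x hx]
    constructor
    · rintro ⟨z, hz, e⟩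
      rw [← hinj hz.1 hx e]; exact hz.2
    · exact fun hC => ⟨x, ⟨hx, hC⟩, rfl⟩
  have hqk := hnull.ae_eq_mk
  have hqm := hnull.measurable_mk
  set q := hnull.mk
  -- By the Jacobian formula the branch maps the null set `a \ S` to a null set, so almost every
  -- point is the image of a point where the regularity of `p` is known.
  have hSfull : ∀ᵐ y ∂m, y ∈ T.F '' (S ∩ a) := by
    have h0 : m (T.F '' (a \ S)) = 0 := by
      rw [T.ζ_jacobian a ha _ sdiff_subset (ham.diff hS)]
      exact setLIntegral_measure_zero _ _ (measure_mono_null (sdiff_subset_compl _ _) hS0)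
    have h0' : ∀ᵐ y ∂m, y ∉ T.F '' (a \ S) := measure_eq_zero_iff_ae_notMem.1 h0
    filter_upwards [hfull, h0'] with y hy hy'
    obtain ⟨x, hx, rfl⟩ := hy
    refine ⟨x, ⟨?_, hx⟩, rfl⟩
    by_contra hxS
    exact hy' ⟨x, ⟨hx, hxS⟩, rfl⟩
  have hall : ∀ᵐ y ∂m, y ∈ T.F '' (S ∩ a) ∧ k (g y) = q y := hSfull.and hqk
  obtain ⟨N, hN, hNm, hN0⟩ := exists_measurable_superset_of_null (ae_iff.1 hall)
  refine ⟨q, hqm, ⟨Nᶜ, hNm.compl, by rwa [compl_compl], ?_⟩, ?_⟩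
  · rintro b rfl y ⟨hy, -⟩ y' ⟨hy', -⟩
    obtain ⟨⟨x, hx, rfl⟩, hq⟩ := not_not.1 (mt (@hN y) hy)
    obtain ⟨⟨x', hx', rfl⟩, hq'⟩ := not_not.1 (mt (@hN y') hy')
    rw [hg x hx.2] at hq
    rw [hg x' hx'.2] at hq'
    rw [← hq, ← hq']
    have hlam : 0 < lam := zero_lt_one.trans T.one_lt_lam
    have e1 : dist x x' ^ η ≤ lam ^ (-η) * dist (T.F x) (T.F x') ^ η := by
      have h1 := T.expansion a ha x hx.2 x' hx'.2
      have h2 := Real.rpow_le_rpow (by positivity) h1 T.η_pos.le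
      rw [Real.mul_rpow hlam.le dist_nonneg] at h2
      rw [Real.rpow_neg hlam.le, le_inv_mul_iff₀ (Real.rpow_pos_of_pos hlam _)]
      exact h2
    have e2 : T.ζ x ≤ Real.exp (K * dist (T.F x) (T.F x') ^ η) * T.ζ x' := by
      have h1 := (abs_le.1 (T.distortion a ha x hx.2 x' hx'.2)).2
      have h2 := Real.exp_le_exp.2 (sub_le_iff_le_add.1 h1)
      rwa [Real.exp_add, Real.exp_log (T.ζ_pos x), Real.exp_log (T.ζ_pos x')] at h2
    set D := dist (T.F x) (T.F x') ^ η
    have hD : 0 ≤ D := Real.rpow_nonneg dist_nonneg _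
    calc p x * ENNReal.ofReal (T.ζ x)
        ≤ (ENNReal.ofReal (Real.exp (R * (lam ^ (-η) * D))) * p x') *
          (ENNReal.ofReal (Real.exp (K * D) * T.ζ x')) := by
          gcongr
          exact (h x hx x' hx').trans (by gcongr)
      _ = ENNReal.ofReal (Real.exp ((K + lam ^ (-η) * R) * D)) *
          (p x' * ENNReal.ofReal (T.ζ x')) := by
          rw [ENNReal.ofReal_mul (Real.exp_pos _).le, add_mul, Real.exp_add,
            ENNReal.ofReal_mul (Real.exp_pos _).le, show R * (lam ^ (-η) * D) =
              lam ^ (-η) * R * D by ring]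
          ring
      _ ≤ _ := by gcongr
  · ext B hB
    have hqF : ∀ᵐ x ∂m, k (g (T.F x)) = q (T.F x) := T.nonsingular.ae hqk
    have hζ : Measurable fun x => ENNReal.ofReal (T.ζ x)⁻¹ := T.ζ_measurable.inv.ennreal_ofReal
    rw [Measure.map_apply hF hB, Measure.restrict_apply (hF hB),
      withDensity_apply _ ((hF hB).inter ham), withDensity_apply _ hB]
    conv_rhs => rw [← T.map_withDensity_inv ha]
    rw [setLIntegral_map hB hqm hF,
      setLIntegral_withDensity_eq_setLIntegral_mul (g := fun x => q (T.F x)) _ hζ (hqm.comp hF)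
        (hF hB),
      Measure.restrict_restrict (hF hB)]
    refine setLIntegral_congr_fun_ae ((hF hB).inter ham) ?_
    filter_upwards [hqF] with x hx hxa
    simp only [Pi.mul_apply]
    rw [← hx, hg x hxa.2]
    change p x = ENNReal.ofReal (T.ζ x)⁻¹ * (p x * ENNReal.ofReal (T.ζ x))
    rw [mul_left_comm, ← ENNReal.ofReal_mul (inv_pos.2 (T.ζ_pos x)).le,
      inv_mul_cancel₀ (T.ζ_pos x).ne', ENNReal.ofReal_one, mul_one]

end UniformlyExpandingMap

namespace YoungTower

variable {Y : Type u} [MeasurableSpace Y] [MetricSpace Y] {m : Measure Y} {lam K η : ℝ}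

theorem measurableSet_τ (T : YoungTower m lam K η) (s : Set ℕ) : MeasurableSet (T.τ ⁻¹' s) :=
  T.τ_measurable (MeasurableSet.of_discrete)

theorem τ_preimage_cases (T : YoungTower m lam K η) (s : Set ℕ) (a : Set Y) (ha : a ∈ T.α) :
    a ⊆ T.τ ⁻¹' s ∨ Disjoint a (T.τ ⁻¹' s) := by
  by_cases h : ∃ x ∈ a, T.τ x ∈ s
  · obtain ⟨x, hx, hs⟩ := h
    refine .inl fun y hy => ?_
    rw [mem_preimage, T.τ_const a ha y hy x hx]; exact hs
  · push Not at h
    exact .inr (disjoint_left.2 h)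

/-- Pushing a piecewise regular measure forward by the base map, restricted to a level set of the
return time, gives a regular measure. -/
theorem regularOn_map_restrict_τ [IsProbabilityMeasure m] (T : YoungTower m lam K η) {R R' : ℝ}
    (hR : 0 ≤ R) (hRR : K + lam ^ (-η) * R ≤ R') {μ : Measure Y} (h : RegularOn m η R T.α μ)
    (s : Set ℕ) : RegularOn m η R' {univ} ((μ.restrict (T.τ ⁻¹' s)).map T.F) := by
  have : Countable T.α := T.α_countable.to_subtype
  have hν := h.restrict (T.measurableSet_τ s) (T.τ_preimage_cases s)
  set ν := μ.restrict (T.τ ⁻¹' s)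
  have e : ν = Measure.sum fun a : ↥T.α => ν.restrict a.1 := by
    rw [← Measure.restrict_iUnion (ι := ↥T.α) (s := Subtype.val)
      (fun a b hab => T.α_disjoint a.2 b.2 (Subtype.coe_ne_coe.2 hab))
      (fun a => T.α_measurable a.1 a.2), ← sUnion_eq_iUnion]
    refine (Measure.restrict_eq_self_of_ae_mem ?_).symm
    exact hν.absolutelyContinuous.ae_le T.α_cover
  rw [e, Measure.map_sum T.nonsingular.measurable.aemeasurable]
  exact .sum fun a => T.regularOn_map_restrict a.2 hR hRR hν

end YoungTower

/-! ### Dynamics of measures on the tower: levels, exits and orbits -/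

namespace YoungTower

variable {Y : Type u} [MeasurableSpace Y] [MetricSpace Y] {m : Measure Y} {lam K η : ℝ}

/-- The number of steps until the next visit to the base. -/
def rem (T : YoungTower m lam K η) (x : T.Space) : ℕ := T.τ x.1.1 - x.1.2

/-- The inclusion of `Y` as the base of the tower. -/
def base (T : YoungTower m lam K η) (y : Y) : T.Space := ⟨(y, 0), T.τ_pos y⟩

/-- A measure on `Y`, seen as a measure on the base of the tower. -/
noncomputable def lift (T : YoungTower m lam K η) (ρ : Measure Y) : Measure T.Space := ρ.map T.base

/-- The part of `ν` at level `l`, as a measure on `Y`. -/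
noncomputable def slice (T : YoungTower m lam K η) (l : ℕ) (ν : Measure T.Space) : Measure Y :=
  (ν.restrict {x | x.1.2 = l}).map fun x => x.1.1

/-- The part of `ν` which next visits the base after exactly `j` steps, moved to the base. -/
noncomputable def exit (T : YoungTower m lam K η) (j : ℕ) (ν : Measure T.Space) : Measure Y :=
  (ν.restrict {x | T.rem x = j}).map fun x => T.F x.1.1

/-- The push-forward of the measure `ρ` on the base by `t` steps of the tower map. -/
noncomputable def orbit (T : YoungTower m lam K η) (ρ : Measure Y) (t : ℕ) : Measure T.Space :=
  (T.lift ρ).map T.map^[t]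

variable (T : YoungTower m lam K η)

theorem measurable_proj : Measurable fun x : T.Space => x.1.1 := by fun_prop

theorem measurable_level : Measurable fun x : T.Space => x.1.2 := by fun_prop

theorem measurable_rem : Measurable T.rem :=
  (T.τ_measurable.comp T.measurable_proj).sub T.measurable_level

theorem measurable_base : Measurable T.base :=
  Measurable.subtype_mk (by fun_prop)

theorem measurable_F_proj : Measurable fun x : T.Space => T.F x.1.1 :=
  T.nonsingular.measurable.comp T.measurable_proj

theorem measurable_iterate (n : ℕ) : Measurable T.map^[n] := T.measurable_map.iterate n

theorem measurableSet_level (s : Set ℕ) : MeasurableSet {x : T.Space | x.1.2 ∈ s} :=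
  T.measurable_level (.of_discrete (s := s))

theorem measurableSet_rem (s : Set ℕ) : MeasurableSet {x : T.Space | T.rem x ∈ s} :=
  T.measurable_rem (.of_discrete (s := s))

theorem measurableSet_rem_eq (j : ℕ) : MeasurableSet {x : T.Space | T.rem x = j} :=
  T.measurableSet_rem {j}

theorem measurableSet_level_and (l : ℕ) {A : Set Y} (hA : MeasurableSet A) :
    MeasurableSet {x : T.Space | x.1.2 = l ∧ x.1.1 ∈ A} :=
  (T.measurableSet_level {l}).inter (T.measurable_proj hA)

theorem rem_pos (x : T.Space) : 1 ≤ T.rem x := by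
  have := x.2; unfold rem; omega

variable {T} in
theorem slice_apply {l : ℕ} {ν : Measure T.Space} {A : Set Y} (hA : MeasurableSet A) :
    T.slice l ν A = ν {x | x.1.2 = l ∧ x.1.1 ∈ A} := by
  rw [slice, Measure.map_apply T.measurable_proj hA,
    Measure.restrict_apply (T.measurable_proj hA), inter_comm]
  rfl

variable {T} in
theorem exit_apply {j : ℕ} {ν : Measure T.Space} {A : Set Y} (hA : MeasurableSet A) :
    T.exit j ν A = ν {x | T.rem x = j ∧ T.F x.1.1 ∈ A} := by
  rw [exit, Measure.map_apply T.measurable_F_proj hA,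
    Measure.restrict_apply (T.measurable_F_proj hA), inter_comm]
  rfl

variable {T} in
theorem exit_univ {j : ℕ} {ν : Measure T.Space} : T.exit j ν univ = ν {x | T.rem x = j} := by
  simp [exit_apply]

variable {T} in
theorem lift_apply {ρ : Measure Y} {s : Set T.Space} (hs : MeasurableSet s) :
    T.lift ρ s = ρ (T.base ⁻¹' s) := Measure.map_apply T.measurable_base hs

variable {T} in
theorem orbit_apply {ρ : Measure Y} {t : ℕ} {s : Set T.Space} (hs : MeasurableSet s) :
    T.orbit ρ t s = T.lift ρ (T.map^[t] ⁻¹' s) := Measure.map_apply (T.measurable_iterate t) hs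

variable {T} in
theorem orbit_univ {ρ : Measure Y} {t : ℕ} : T.orbit ρ t univ = ρ univ := by
  rw [orbit_apply .univ, preimage_univ, lift_apply .univ, preimage_univ]

theorem orbit_zero (ρ : Measure Y) : T.orbit ρ 0 = T.lift ρ := by
  simp [orbit]

theorem orbit_add (ρ : Measure Y) (t i : ℕ) :
    T.orbit ρ (t + i) = (T.orbit ρ t).map T.map^[i] := by
  rw [orbit, orbit, Measure.map_map (T.measurable_iterate i) (T.measurable_iterate t),
    ← Function.iterate_add, add_comm]

theorem orbit_succ (ρ : Measure Y) (t : ℕ) : T.orbit ρ (t + 1) = (T.orbit ρ t).map T.map :=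
  T.orbit_add ρ t 1

instance (ρ : Measure Y) [IsFiniteMeasure ρ] : IsFiniteMeasure (T.lift ρ) := by
  unfold lift; infer_instance

instance (ρ : Measure Y) [IsFiniteMeasure ρ] (t : ℕ) : IsFiniteMeasure (T.orbit ρ t) := by
  unfold orbit; infer_instance

instance (ν : Measure T.Space) [IsFiniteMeasure ν] (l : ℕ) : IsFiniteMeasure (T.slice l ν) := by
  unfold slice; infer_instance

instance (ν : Measure T.Space) [IsFiniteMeasure ν] (j : ℕ) : IsFiniteMeasure (T.exit j ν) := by
  unfold exit; infer_instance

variable {T}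

theorem measure_eq_tsum_level (ν : Measure T.Space) {E : Set T.Space} (hE : MeasurableSet E) :
    ν E = ∑' l : ℕ, ν {x | x.1.2 = l ∧ x ∈ E} := by
  rw [← measure_iUnion]
  · congr 1; ext x; simp
  · intro i j hij
    exact disjoint_left.2 fun x hx hx' => hij (hx.1.symm.trans hx'.1)
  · exact fun l => (T.measurableSet_level {l}).inter hE

theorem measure_eq_tsum_slice (ν : Measure T.Space) {A : ℕ → Set Y}
    (hA : ∀ l, MeasurableSet (A l)) :
    ν {x | x.1.1 ∈ A x.1.2} = ∑' l : ℕ, T.slice l ν (A l) := by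
  rw [measure_eq_tsum_level ν]
  · refine tsum_congr fun l => ?_
    rw [slice_apply (hA l)]
    congr 1; ext x
    simp only [mem_ofPred_eq, and_congr_right_iff]
    rintro rfl; rfl
  · have : {x : T.Space | x.1.1 ∈ A x.1.2} = ⋃ l, ({x | x.1.2 = l} ∩ {x | x.1.1 ∈ A l}) := by
      ext x; simp
    rw [this]
    exact .iUnion fun l => (T.measurableSet_level {l}).inter (T.measurable_proj (hA l))

theorem measure_rem (ν : Measure T.Space) (s : Set ℕ) :
    ν {x | T.rem x ∈ s} = ∑' l : ℕ, T.slice l ν (T.τ ⁻¹' {k | k - l ∈ s}) :=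
  measure_eq_tsum_slice ν (A := fun l => T.τ ⁻¹' {k | k - l ∈ s}) fun _ => T.measurableSet_τ _

theorem exit_eq_sum (j : ℕ) (ν : Measure T.Space) : T.exit j ν =
    Measure.sum fun l => ((T.slice l ν).restrict (T.τ ⁻¹' {l + j})).map T.F := by
  have hF := T.nonsingular.measurable
  ext B hB
  rw [Measure.sum_apply _ hB, exit_apply hB, measure_eq_tsum_level]
  · refine tsum_congr fun l => ?_
    rw [Measure.map_apply hF hB, Measure.restrict_apply (hF hB),
      slice_apply ((hF hB).inter (T.measurableSet_τ _))]
    congr 1; ext x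
    have := x.2
    simp only [rem, mem_ofPred_eq, mem_inter_iff, mem_preimage, mem_singleton_iff]
    constructor
    · rintro ⟨rfl, h, h'⟩; exact ⟨rfl, h', by omega⟩
    · rintro ⟨rfl, h, h'⟩; exact ⟨rfl, by omega, h⟩
  · exact (T.measurableSet_rem {j}).inter (T.measurable_F_proj hB)

theorem regularOn_exit [IsProbabilityMeasure m] {R R' : ℝ} (hR : 0 ≤ R)
    (hRR : K + lam ^ (-η) * R ≤ R') {ν : Measure T.Space}
    (h : ∀ l, RegularOn m η R T.α (T.slice l ν)) (j : ℕ) :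
    RegularOn m η R' {univ} (T.exit j ν) := by
  rw [exit_eq_sum]
  exact .sum fun l => T.regularOn_map_restrict_τ hR hRR (h l) _

theorem map_of_rem_eq_one {x : T.Space} (h : T.rem x = 1) : T.map x = T.base (T.F x.1.1) := by
  have := x.2
  rw [map, dif_neg (by unfold rem at h; omega)]
  rfl

theorem map_of_one_lt_rem {x : T.Space} (h : 1 < T.rem x) :
    (T.map x).1 = (x.1.1, x.1.2 + 1) := by
  rw [map, dif_pos (by unfold rem at h; omega)]

theorem rem_map {x : T.Space} (h : 1 < T.rem x) : T.rem (T.map x) = T.rem x - 1 := by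
  unfold rem at *
  rw [map_of_one_lt_rem h]
  simp only
  omega

theorem iterate_rem (n : ℕ) : ∀ x : T.Space, T.rem x = n + 1 →
    T.map^[n + 1] x = T.base (T.F x.1.1) := by
  induction n with
  | zero => exact fun x hx => map_of_rem_eq_one hx
  | succ n ih =>
    intro x hx
    rw [Function.iterate_succ_apply, ih _ (by rw [rem_map (by omega), hx]; omega),
      map_of_one_lt_rem (by omega)]

theorem level_map_eq_zero_iff (x : T.Space) : (T.map x).1.2 = 0 ↔ T.rem x = 1 := by
  have := T.rem_pos x
  constructor
  · intro h
    by_contra h1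
    rw [map_of_one_lt_rem (by omega)] at h
    simp at h
  · intro h
    rw [map_of_rem_eq_one h]; rfl

theorem slice_zero_map (ν : Measure T.Space) : T.slice 0 (ν.map T.map) = T.exit 1 ν := by
  ext A hA
  rw [slice_apply hA, exit_apply hA, Measure.map_apply T.measurable_map
    (T.measurableSet_level_and 0 hA)]
  congr 1; ext x
  simp only [mem_preimage, mem_ofPred_eq, level_map_eq_zero_iff, and_congr_right_iff]
  intro h
  rw [map_of_rem_eq_one h]; rfl

theorem slice_succ_map (ν : Measure T.Space) (l : ℕ) :
    T.slice (l + 1) (ν.map T.map) = (T.slice l ν).restrict (T.τ ⁻¹' Ioi (l + 1)) := by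
  ext A hA
  rw [slice_apply hA, Measure.restrict_apply hA, slice_apply (hA.inter (T.measurableSet_τ _)),
    Measure.map_apply T.measurable_map
    (T.measurableSet_level_and (l + 1) hA)]
  congr 1; ext x
  have h1 := T.rem_pos x
  have hx := x.2
  simp only [mem_preimage, mem_ofPred_eq, mem_inter_iff, mem_Ioi]
  rcases h1.eq_or_lt with h | h
  · rw [map_of_rem_eq_one h.symm]
    simp only [base, rem] at *
    constructor
    · rintro ⟨h, -⟩; omega
    · rintro ⟨rfl, -, h⟩; omega
  · rw [map_of_one_lt_rem h]
    unfold rem at h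
    constructor
    · rintro ⟨h2, h3⟩
      obtain rfl : x.1.2 = l := by simpa using h2
      exact ⟨rfl, h3, by omega⟩
    · rintro ⟨rfl, h2, h3⟩; exact ⟨rfl, h2⟩

theorem slice_zero_lift (ρ : Measure Y) : T.slice 0 (T.lift ρ) = ρ := by
  ext A hA
  rw [slice_apply hA, lift_apply (T.measurableSet_level_and 0 hA)]
  congr 1; ext y
  simp [base]

theorem slice_succ_lift (ρ : Measure Y) (l : ℕ) : T.slice (l + 1) (T.lift ρ) = 0 := by
  ext A hA
  rw [slice_apply hA, lift_apply (T.measurableSet_level_and (l + 1) hA)]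
  simp [base]

theorem slice_add (ν ν' : Measure T.Space) (l : ℕ) :
    T.slice l (ν + ν') = T.slice l ν + T.slice l ν' := by
  rw [slice, Measure.restrict_add, Measure.map_add _ _ T.measurable_proj]; rfl

/-- The mass in a set after `M` steps, decomposed according to the first visit to the base. -/
theorem measure_iterate_preimage (ν : Measure T.Space) (M : ℕ) {s : Set T.Space}
    (hs : MeasurableSet s) : ν (T.map^[M] ⁻¹' s) =
      ∑ j ∈ Finset.Icc 1 M, T.orbit (T.exit j ν) (M - j) s +
        ν ({x | T.rem x ∈ Ioi M} ∩ T.map^[M] ⁻¹' s) := by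
  set E := T.map^[M] ⁻¹' s with hE
  have hEm : MeasurableSet E := T.measurable_iterate M hs
  have h1 : ∀ j ∈ Finset.Icc 1 M, T.orbit (T.exit j ν) (M - j) s = ν ({x | T.rem x = j} ∩ E) := by
    intro j hj
    rw [Finset.mem_Icc] at hj
    have hs' := T.measurable_iterate (M - j) hs
    rw [orbit_apply hs, lift_apply hs', exit_apply (T.measurable_base hs')]
    congr 1; ext x
    simp only [mem_ofPred_eq, mem_inter_iff, and_congr_right_iff, hE, mem_preimage]
    intro hx
    obtain ⟨i, rfl⟩ : ∃ i, j = i + 1 := ⟨j - 1, by omega⟩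
    rw [← iterate_rem i x hx, ← Function.iterate_add_apply, Nat.sub_add_cancel hj.2]
  rw [Finset.sum_congr rfl h1, ← measure_biUnion_finset, ← measure_union]
  · congr 1; ext x
    have := T.rem_pos x
    simp only [mem_union, mem_iUnion, mem_inter_iff, mem_ofPred_eq, mem_Ioi, Finset.mem_Icc]
    constructor
    · intro h
      rcases le_or_gt (T.rem x) M with h' | h'
      · exact .inl ⟨_, ⟨this, h'⟩, rfl, h⟩
      · exact .inr ⟨h', h⟩
    · rintro (⟨_, _, _, h⟩ | ⟨_, h⟩) <;> exact h
  · refine disjoint_left.2 fun x hx hx' => ?_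
    simp only [mem_iUnion, mem_inter_iff, mem_ofPred_eq, mem_Ioi, Finset.mem_Icc] at hx hx'
    obtain ⟨i, hi, h, -⟩ := hx
    omega
  · exact (T.measurableSet_rem _).inter hEm
  · intro i _ j _ hij
    exact disjoint_left.2 fun x hx hx' => hij (hx.1.symm.trans hx'.1)
  · exact fun j _ => (T.measurableSet_rem {j}).inter hEm

theorem slice_le_univ (ν : Measure T.Space) (l : ℕ) (A : Set Y) : T.slice l ν A ≤ ν univ := by
  refine (measure_mono (subset_univ A)).trans ?_
  rw [slice_apply .univ]; exact measure_mono (subset_univ _)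

theorem slice_orbit_univ_le (ρ : Measure Y) (t l : ℕ) :
    T.slice l (T.orbit ρ (t + l)) univ ≤ T.slice 0 (T.orbit ρ t) univ := by
  induction l with
  | zero => rfl
  | succ l ih =>
    rw [← add_assoc, orbit_succ, slice_succ_map]
    exact (Measure.restrict_le_self _).trans ih

theorem slice_zero_τ_le (ν : Measure T.Space) {i : ℕ} (hi : 1 ≤ i) :
    T.slice 0 ν (T.τ ⁻¹' {i}) ≤ T.slice 0 (ν.map T.map^[i]) univ := by
  rw [slice_apply (T.measurableSet_τ _), slice_apply .univ,
    Measure.map_apply (T.measurable_iterate i) (T.measurableSet_level_and 0 .univ)]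
  refine measure_mono fun x hx => ?_
  obtain ⟨j, rfl⟩ := Nat.exists_eq_add_one.2 hi
  have : T.rem x = j + 1 := by
    unfold rem; rw [hx.1]; exact hx.2
  simp only [mem_preimage, mem_ofPred_eq, iterate_rem j x this]
  exact ⟨rfl, trivial⟩

/-- For a point started on the base, the elapsed time plus the time to the next visit is a sum of
values of `τ` along the `F`-orbit. By nonsingularity almost every point has all these values
divisible by `d`. -/
theorem orbit_rem_eq_zero {ρ : Measure Y} {d : ℕ} (hd : ∀ᵐ y ∂m, d ∣ T.τ y) (hρ : ρ ≪ m) (t j : ℕ)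
    (h : ¬ d ∣ t + j) : T.orbit ρ t {x | T.rem x = j} = 0 := by
  rw [orbit_apply (T.measurableSet_rem_eq j),
    lift_apply (T.measurable_iterate t (T.measurableSet_rem_eq j))]
  have hd' : ∀ᵐ y ∂m, ∀ k, d ∣ T.τ (T.F^[k] y) :=
    ae_all_iff.2 fun k => (T.nonsingular.iterate k).ae hd
  refine hρ (measure_mono_null (fun y hy => ?_) (ae_iff.1 hd'))
  contrapose! h
  rw [mem_ofPred_eq] at h
  push Not at h
  have key : ∀ t : ℕ, ∃ k, (T.map^[t] (T.base y)).1.1 = T.F^[k] y ∧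
      d ∣ t + T.rem (T.map^[t] (T.base y)) := by
    intro t
    induction t with
    | zero => exact ⟨0, rfl, by simpa [rem, base] using h 0⟩
    | succ t ih =>
      obtain ⟨k, hk, hdvd⟩ := ih
      rw [Function.iterate_succ_apply']
      rcases (T.rem_pos (T.map^[t] (T.base y))).eq_or_lt with h1 | h1
      · refine ⟨k + 1, ?_, ?_⟩
        · rw [map_of_rem_eq_one h1.symm, Function.iterate_succ_apply', ← hk]; rfl
        · rw [← h1] at hdvd
          rw [map_of_rem_eq_one h1.symm, hk, ← Function.iterate_succ_apply' T.F]
          exact hdvd.add (h (k + 1))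
      · refine ⟨k, by rw [map_of_one_lt_rem h1]; exact hk, ?_⟩
        rw [rem_map h1]
        convert hdvd using 1
        omega
  obtain ⟨k, -, hk⟩ := key t
  rwa [show T.rem (T.map^[t] (T.base y)) = j from hy] at hk

/-! ### Regularity and size of the levels of an orbit -/

section orbit

variable [IsProbabilityMeasure m] {R : ℝ} {ρ : Measure Y}

/-- Level zero is produced by the base map, which restores the constant `R`. Each higher level is
the previous one restricted to a union of partition elements, which is why regularity is claimed
only on each element of `α`. -/
theorem regularOn_slice_orbit (hR : 0 ≤ R) (hRR : K + lam ^ (-η) * R ≤ R)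
    (hρ : RegularOn m η R {univ} ρ) (t l : ℕ) : RegularOn m η R T.α (T.slice l (T.orbit ρ t)) := by
  induction t generalizing l with
  | zero =>
    rw [orbit_zero]
    cases l with
    | zero => rw [slice_zero_lift]; exact hρ.of_univ
    | succ l => rw [slice_succ_lift]; exact .zero
  | succ t ih =>
    rw [orbit_succ]
    cases l with
    | zero => rw [slice_zero_map]; exact (regularOn_exit hR hRR ih 1).of_univ
    | succ l =>
      rw [slice_succ_map]
      exact (ih l).restrict (T.measurableSet_τ _) (T.τ_preimage_cases _)

theorem regularOn_slice_zero_orbit (hR : 0 ≤ R) (hRR : K + lam ^ (-η) * R ≤ R)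
    (hρ : RegularOn m η R {univ} ρ) (t : ℕ) :
    RegularOn m η R {univ} (T.slice 0 (T.orbit ρ t)) := by
  cases t with
  | zero => rwa [orbit_zero, slice_zero_lift]
  | succ t =>
    rw [orbit_succ, slice_zero_map]
    exact regularOn_exit hR hRR (regularOn_slice_orbit hR hRR hρ t) 1

/-- Mass at level `l` was on the base `l` steps earlier, at points with `τ > l`, and densities on
the base are bounded by the Harnack inequality. -/
theorem slice_orbit_le (hR : 0 ≤ R) (hRR : K + lam ^ (-η) * R ≤ R)
    (hρ : RegularOn m η R {univ} ρ) (t l : ℕ) :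
    T.slice l (T.orbit ρ t) ≤
      (ENNReal.ofReal (Real.exp R) * ρ univ) • m.restrict (T.τ ⁻¹' Ioi l) := by
  have h0 : T.τ ⁻¹' Ioi 0 = univ := eq_univ_of_forall fun y => T.τ_pos y
  have hbase : ∀ t, T.slice 0 (T.orbit ρ t) ≤
      (ENNReal.ofReal (Real.exp R) * ρ univ) • m.restrict (T.τ ⁻¹' Ioi 0) := by
    intro t
    rw [h0, Measure.restrict_univ]
    refine ((regularOn_slice_zero_orbit hR hRR hρ t).le_smul T.dist_le_one T.η_pos hR).trans ?_
    have := (slice_le_univ (T.orbit ρ t) 0 univ).trans orbit_univ.le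
    refine Measure.le_iff.2 fun A hA => ?_
    simp only [Measure.smul_apply, smul_eq_mul]
    gcongr
  induction t generalizing l with
  | zero =>
    cases l with
    | zero => exact hbase 0
    | succ l => rw [orbit_zero, slice_succ_lift]; exact Measure.zero_le _
  | succ t ih =>
    cases l with
    | zero => exact hbase _
    | succ l =>
      rw [orbit_succ, slice_succ_map]
      refine (Measure.restrict_mono subset_rfl (ih l)).trans ?_
      rw [Measure.restrict_smul, Measure.restrict_restrict (T.measurableSet_τ _)]
      refine Measure.le_iff.2 fun A hA => ?_
      simp only [Measure.smul_apply, smul_eq_mul]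
      exact mul_le_mul_right (Measure.restrict_mono inter_subset_left le_rfl A) _

/-- Mass on the base at time `t` next returns at time `t + τ`. Almost surely both `τ` and `t + τ`
are multiples of `d`, hence so is `t`. -/
theorem slice_zero_orbit_eq_zero {d : ℕ} (hd : ∀ᵐ y ∂m, d ∣ T.τ y) (hR : 0 ≤ R)
    (hRR : K + lam ^ (-η) * R ≤ R) (hρ : RegularOn m η R {univ} ρ) (t : ℕ) (h : ¬ d ∣ t) :
    T.slice 0 (T.orbit ρ t) univ = 0 := by
  have h1 := (regularOn_slice_zero_orbit (T := T) hR hRR hρ t).absolutelyContinuous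
  have h2 : T.slice 0 (T.orbit ρ t) (T.τ ⁻¹' {j | d ∣ j})ᶜ = 0 := h1 hd
  rw [← measure_inter_conull' (t := T.τ ⁻¹' {j | d ∣ j}) (measure_mono_null (fun _ h => h.2) h2),
    univ_inter, slice_apply (T.measurableSet_τ _)]
  refine measure_mono_null (t := ⋃ j ∈ {j | d ∣ j}, {x | T.rem x = j}) (fun x hx => ?_) ?_
  · simp only [mem_iUnion]
    refine ⟨_, ?_, rfl⟩
    unfold rem
    rw [hx.1]; exact hx.2
  · refine (measure_biUnion_null_iff (to_countable _)).2 fun j hj => ?_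
    refine orbit_rem_eq_zero hd hρ.absolutelyContinuous t j fun hj' => h ?_
    exact (Nat.dvd_add_left hj).1 hj'

end orbit

end YoungTower

/-! ### Lower bound for the mass on the base at multiples of the period -/

/-- Only finitely many sets `I` lie below `N`, so the threshold of the numerical semigroup generated
by `I` can be chosen uniformly. This is why the constants see `I` only through its maximum. -/
theorem exists_forall_mem_closure_of_gcd_dvd (N : ℕ) : ∃ M : ℕ, ∀ I : Finset ℕ, I.sup id ≤ N →
    ∀ n ≥ M, I.gcd id ∣ n → n ∈ AddSubmonoid.closure (I : Set ℕ) := by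
  choose g hg using fun I : Finset ℕ => Nat.exists_mem_closure_of_ge (I : Set ℕ)
  refine ⟨(Finset.range (N + 1)).powerset.sup g, fun I hI n hn hd => hg I n ?_ ?_⟩
  · refine (Finset.le_sup (f := g) ?_).trans hn
    rw [Finset.mem_powerset]
    intro i hi
    rw [Finset.mem_range]
    have : i ≤ I.sup id := Finset.le_sup (f := id) hi
    omega
  · exact (Finset.dvd_gcd fun i hi => Nat.setGcd_dvd_of_mem hi).trans hd

namespace YoungTower

variable {Y : Type u} [MeasurableSpace Y] [MetricSpace Y] {m : Measure Y} {lam K η : ℝ}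
  {T : YoungTower m lam K η} {d : ℕ} {I : Finset ℕ} {δ : ℝ}

theorem IsNonmixing.ae_dvd (h : T.IsNonmixing d I δ) : ∀ᵐ y ∂m, d ∣ T.τ y := by
  have : ∀ᵐ y ∂m, ∀ j, ¬ d ∣ j → T.τ y ≠ j := by
    refine ae_all_iff.2 fun j => ?_
    by_cases hj : d ∣ j
    · simp [hj]
    · have h0 : m {y | T.τ y = j} = 0 := by
        by_contra h0
        refine hj (h.isGcd.1 j ⟨?_, pos_iff_ne_zero.2 h0⟩)
        by_contra hj0
        obtain rfl : j = 0 := by omega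
        exact hj (dvd_zero d)
      filter_upwards [measure_eq_zero_iff_ae_notMem.1 h0] with y hy _ using hy
  filter_upwards [this] with y hy
  by_contra hd
  exact hy _ hd rfl

theorem IsNonmixing.nonempty (h : T.IsNonmixing d I δ) : I.Nonempty := by
  rw [Finset.nonempty_iff_ne_empty]
  rintro rfl
  have := h.two_le
  rw [← h.I_gcd] at this
  simp at this

theorem IsNonmixing.le_sup (h : T.IsNonmixing d I δ) : d ≤ I.sup id := by
  obtain ⟨i, hi⟩ := h.nonempty
  have h1 : d ∣ i := h.I_gcd ▸ Finset.gcd_dvd hi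
  exact (Nat.le_of_dvd (h.I_pos i hi) h1).trans (Finset.le_sup (f := id) hi)

theorem IsNonmixing.le_one [IsProbabilityMeasure m] (h : T.IsNonmixing d I δ) : δ ≤ 1 := by
  obtain ⟨i, hi⟩ := h.nonempty
  exact (h.I_measure i hi).trans measureReal_le_one

section

variable [IsProbabilityMeasure m] {R : ℝ} {ρ : Measure Y} [IsProbabilityMeasure ρ]

/-- By the Harnack inequality a regular measure on the base gives `{τ = i}` at least `exp (-R) * ε`
of its mass, and all of that is back on the base after `i` steps. Chaining over generators uses at
most `M` such factors, each at most one. -/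
theorem slice_zero_orbit_add_ge (h : T.IsNonmixing d I δ) {ε : ℝ} (hε : 0 < ε) (hεδ : ε ≤ δ)
    (hR : 0 ≤ R)
    (hRR : K + lam ^ (-η) * R ≤ R) (hρ : RegularOn m η R {univ} ρ) {M : ℕ}
    (hM : M ∈ AddSubmonoid.closure (I : Set ℕ)) (t : ℕ) :
    (Real.exp (-R) * ε) ^ M * (T.slice 0 (T.orbit ρ t)).real univ ≤
      (T.slice 0 (T.orbit ρ (t + M))).real univ := by
  have hε1 : Real.exp (-R) * ε ≤ 1 :=
    mul_le_one₀ (Real.exp_le_one_iff.2 (by linarith)) hε.le (hεδ.trans h.le_one)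
  have hε0 : 0 < Real.exp (-R) * ε := by positivity
  induction hM using AddSubmonoid.closure_induction generalizing t with
  | zero => simp
  | mem i hi =>
    have hi1 := h.I_pos i hi
    have h1 := slice_zero_τ_le (T.orbit ρ t) hi1
    rw [← orbit_add] at h1
    have h2 := (regularOn_slice_zero_orbit (T := T) hR hRR hρ t).mul_le_apply T.dist_le_one
      T.η_pos hR (T.measurableSet_τ {i})
    have h3 := ENNReal.toReal_mono (by finiteness) (h2.trans (mul_le_mul_right h1 _))
    simp only [ENNReal.toReal_mul, ENNReal.toReal_ofReal (Real.exp_pos _).le] at h3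
    change (T.slice 0 (T.orbit ρ t)).real univ * m.real {y | T.τ y = i} ≤
      Real.exp R * (T.slice 0 (T.orbit ρ (t + i))).real univ at h3
    have h4 := h.I_measure i hi
    have h5 : (T.slice 0 (T.orbit ρ t)).real univ * ε ≤
      (T.slice 0 (T.orbit ρ t)).real univ * m.real {y | T.τ y = i} := by gcongr; linarith
    calc (Real.exp (-R) * ε) ^ i * (T.slice 0 (T.orbit ρ t)).real univ
        ≤ (Real.exp (-R) * ε) ^ 1 * (T.slice 0 (T.orbit ρ t)).real univ :=
          mul_le_mul_of_nonneg_right (pow_le_pow_of_le_one hε0.le hε1 hi1) measureReal_nonneg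
      _ = Real.exp (-R) * ((T.slice 0 (T.orbit ρ t)).real univ * ε) := by ring
      _ ≤ Real.exp (-R) * (Real.exp R * (T.slice 0 (T.orbit ρ (t + i))).real univ) := by
          exact mul_le_mul_of_nonneg_left (h5.trans h3) (Real.exp_pos _).le
      _ = _ := by rw [← mul_assoc, ← Real.exp_add]; simp
  | add i j _ _ hi hj =>
    calc _ = (Real.exp (-R) * ε) ^ j *
          ((Real.exp (-R) * ε) ^ i * (T.slice 0 (T.orbit ρ t)).real univ) := by
          rw [pow_add]; ring
      _ ≤ (Real.exp (-R) * ε) ^ j * (T.slice 0 (T.orbit ρ (t + i))).real univ := by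
          gcongr; exact hi t
      _ ≤ _ := by rw [← add_assoc]; exact hj (t + i)

theorem tsum_slice_orbit_le (hR : 0 ≤ R) (hRR : K + lam ^ (-η) * R ≤ R)
    (hρ : RegularOn m η R {univ} ρ) {t : ℕ → ℝ} (ht : Summable t)
    (hτ : ∀ n : ℕ, m.real {y | n < T.τ y} ≤ t n) (n H : ℕ) :
    ∑' l, T.slice (l + H) (T.orbit ρ n) univ ≤
      ENNReal.ofReal (Real.exp R * ∑' l, t (l + H)) := by
  have ht0 : ∀ n, 0 ≤ t n := fun n => measureReal_nonneg.trans (hτ n)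
  rw [← tsum_mul_left, ENNReal.ofReal_tsum_of_nonneg
    (fun l => mul_nonneg (Real.exp_pos _).le (ht0 _)) (((summable_nat_add_iff H).2 ht).mul_left _)]
  refine ENNReal.tsum_le_tsum fun l => (slice_orbit_le hR hRR hρ n (l + H) univ).trans ?_
  rw [measure_univ (μ := ρ), mul_one, Measure.smul_apply, smul_eq_mul, Measure.restrict_apply_univ,
    ENNReal.ofReal_mul (Real.exp_pos _).le]
  gcongr
  rw [← ofReal_measureReal]
  exact ENNReal.ofReal_le_ofReal (hτ _)

end

/-- A regular probability measure on the base keeps a definite fraction of its mass on the base at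
all large times which are multiples of the period. -/
theorem exists_le_slice_zero_orbit {R δ₀ : ℝ} (hR : 0 ≤ R) (hδ₀ : 0 < δ₀) (N : ℕ) {t : ℕ → ℝ}
    (ht : Summable t) : ∃ N₀ : ℕ, ∃ c : ℝ, 1 ≤ N₀ ∧ 0 < c ∧ (∀ d, 1 ≤ d → d ≤ N → d ∣ N₀) ∧
      ∀ {Y : Type u} [MeasurableSpace Y] [MetricSpace Y] {m : Measure Y} [IsProbabilityMeasure m]
        {lam K η : ℝ} {T : YoungTower m lam K η} {d : ℕ} {I : Finset ℕ} {δ : ℝ},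
        T.IsNonmixing d I δ → δ₀ ≤ δ → I.sup id ≤ N → K + lam ^ (-η) * R ≤ R →
        (∀ n : ℕ, m.real {y | n < T.τ y} ≤ t n) →
        ∀ (ρ : Measure Y) [IsProbabilityMeasure ρ], RegularOn m η R {univ} ρ →
        ∀ n ≥ N₀, d ∣ n → c ≤ (T.slice 0 (T.orbit ρ n)).real univ := by
  obtain ⟨M, hM⟩ := exists_forall_mem_closure_of_gcd_dvd N
  -- At any time, at most half of the mass of an orbit lies at level `H` or above.
  obtain ⟨H, hH⟩ : ∃ H, Real.exp R * ∑' l, t (l + H) ≤ 1 / 2 := by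
    have h1 := (tendsto_sum_nat_add t).const_mul (Real.exp R)
    rw [mul_zero] at h1
    exact (h1.eventually_le_const (by norm_num : (0 : ℝ) < 1 / 2)).exists
  set ε := Real.exp (-R) * min δ₀ 1
  have hε : 0 < ε := by positivity
  have hε1 : ε ≤ 1 := mul_le_one₀ (Real.exp_le_one_iff.2 (by linarith)) (by positivity)
    (min_le_right _ _)
  -- The factorial makes the delay a multiple of every possible period.
  refine ⟨(M + H + 1) * N.factorial, ε ^ (M + H) * (1 / (2 * (H + 1))),
    Nat.mul_pos (by omega) N.factorial_pos, by positivity,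
    fun d hd hdN => (Nat.dvd_factorial hd hdN).mul_left _, ?_⟩
  intro Y _ _ m _ lam K η T d I δ h hδ hI hRR hτ ρ _ hρ n hn hdn
  have hn' : M + H + 1 ≤ n := (Nat.le_mul_of_pos_right _ N.factorial_pos).trans hn
  obtain ⟨n', rfl⟩ : ∃ n', n = n' + M := ⟨n - M, by omega⟩
  have hsum : (1 : ℝ) / 2 ≤ ∑ l ∈ Finset.range H, (T.slice l (T.orbit ρ n')).real univ := by
    have h1 : ∑' l, T.slice l (T.orbit ρ n') univ = 1 := by
      have := measure_eq_tsum_slice (T.orbit ρ n') (A := fun _ => univ) (fun _ => .univ)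
      rw [← this]
      simp [orbit_univ]
    have h2 := tsum_slice_orbit_le hR hRR hρ ht hτ n' H
    rw [← ENNReal.summable.sum_add_tsum_nat_add' (k := H)] at h1
    have h3 := add_le_add_right (h2.trans (ENNReal.ofReal_le_ofReal hH))
      (∑ l ∈ Finset.range H, T.slice l (T.orbit ρ n') univ)
    rw [h1] at h3
    have h5 : ∀ l ∈ Finset.range H, T.slice l (T.orbit ρ n') univ ≠ ∞ := fun l _ => by finiteness
    have h6 := ENNReal.sum_ne_top.2 h5
    have h4 := ENNReal.toReal_mono (ENNReal.add_ne_top.2 ⟨h6, ENNReal.ofReal_ne_top⟩) h3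
    rw [ENNReal.toReal_add h6 ENNReal.ofReal_ne_top,
      ENNReal.toReal_ofReal (by norm_num), ENNReal.toReal_sum h5,
      ENNReal.toReal_one] at h4
    simp only [Measure.real]
    linarith
  -- Pigeonhole over the lowest `H` levels. The mass found was on the base `l` steps earlier, at a
  -- time `s` which must be a multiple of `d` because the base mass there is positive. So `l + M` is
  -- a multiple of `d` past the threshold `M`, hence a sum of elements of `I`.
  obtain ⟨l, hl, hle⟩ : ∃ l ∈ Finset.range H,
      1 / (2 * ((H : ℝ) + 1)) ≤ (T.slice l (T.orbit ρ n')).real univ := by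
    by_contra! hcon
    have h5 := Finset.sum_le_sum fun l hl => (hcon l hl).le
    rw [Finset.sum_const, Finset.card_range, nsmul_eq_mul] at h5
    have h6 : (H : ℝ) * (1 / (2 * (H + 1))) < 1 / 2 := by
      rw [mul_one_div, div_lt_div_iff₀ (by positivity) (by positivity)]; linarith
    linarith
  rw [Finset.mem_range] at hl
  obtain ⟨s, rfl⟩ : ∃ s, n' = s + l := ⟨n' - l, by omega⟩
  have hb : 1 / (2 * ((H : ℝ) + 1)) ≤ (T.slice 0 (T.orbit ρ s)).real univ :=
    hle.trans (ENNReal.toReal_mono (by finiteness) (slice_orbit_univ_le ρ s l))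
  have hds : d ∣ s := by
    by_contra hds
    rw [Measure.real, slice_zero_orbit_eq_zero h.ae_dvd hR hRR hρ s hds] at hb
    have : 0 < 1 / (2 * ((H : ℝ) + 1)) := by positivity
    simp only [ENNReal.toReal_zero] at hb
    linarith
  have hmem : l + M ∈ AddSubmonoid.closure (I : Set ℕ) := by
    refine hM I hI _ (by omega) ?_
    rw [h.I_gcd]
    exact (Nat.dvd_add_right hds).1 (by rwa [← add_assoc])
  have := slice_zero_orbit_add_ge h (by positivity) ((min_le_left δ₀ 1).trans hδ) hR hRR hρ hmem s
  rw [← add_assoc] at this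
  refine le_trans ?_ this
  gcongr ?_ * ?_
  · exact pow_le_pow_of_le_one hε.le hε1 (by omega)

end YoungTower

/-! ### Product couplings of entrance times and the renewal inequality -/

/-- Two families of masses `A j ≤ w j` and `A' j ≤ w' j`, indexed by entrance times, whose members
can be compared pairwise, are compared after summation; the errors are weighted by the law of the
maximum of two independent entrance times. -/
theorem exists_coupling_weights {N : ℕ} {W r r' : ℝ} {w w' A A' H : ℕ → ℝ} (hW : 0 < W)
    (hw : ∀ j, 0 ≤ w j) (hw' : ∀ j, 0 ≤ w' j) (hr : 0 ≤ r) (hr' : 0 ≤ r') (hA' : ∀ j, 0 ≤ A' j)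
    (hsum : ∑ j ∈ Finset.Icc 1 N, w j + r = W) (hsum' : ∑ j ∈ Finset.Icc 1 N, w' j + r' = W)
    (hA : ∀ j, A j ≤ w j)
    (hpair : ∀ j ∈ Finset.Icc 1 N, ∀ j' ∈ Finset.Icc 1 N,
      w' j' * A j ≤ w j * A' j' + w j * w' j' * H (N - max j j')) :
    ∃ p : ℕ → ℝ, (∀ k, 0 ≤ p k) ∧ ∑ k ∈ Finset.Icc 1 N, p k ≤ W ∧
      (∀ i, ∑ k ∈ Finset.Icc (i + 1) N, p k ≤
        ∑ k ∈ Finset.Icc (i + 1) N, w k + ∑ k ∈ Finset.Icc (i + 1) N, w' k) ∧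
      ∑ j ∈ Finset.Icc 1 N, A j ≤
        ∑ j ∈ Finset.Icc 1 N, A' j + r' + ∑ k ∈ Finset.Icc 1 N, p k * H (N - k) := by
  set S := Finset.Icc 1 N with hS
  set g : ℕ × ℕ → ℝ := fun x => w x.1 * w' x.2 with hg
  have hg0 : ∀ x, 0 ≤ g x := fun x => mul_nonneg (hw _) (hw' _)
  have hwW : ∑ j ∈ S, w j ≤ W := by linarith
  have hwW' : ∑ j ∈ S, w' j ≤ W := by linarith
  have hw0 : 0 ≤ ∑ j ∈ S, w j := Finset.sum_nonneg fun j _ => hw j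
  have hw0' : 0 ≤ ∑ j ∈ S, w' j := Finset.sum_nonneg fun j _ => hw' j
  have hmaps : ∀ x ∈ S ×ˢ S, max x.1 x.2 ∈ S := by
    intro x hx
    simp only [hS, Finset.mem_product, Finset.mem_Icc] at hx ⊢
    omega
  have htot : ∑ x ∈ S ×ˢ S, g x = (∑ j ∈ S, w j) * ∑ j ∈ S, w' j := by
    rw [Finset.sum_mul_sum, Finset.sum_product]
  refine ⟨fun k => W⁻¹ * ∑ x ∈ S ×ˢ S with max x.1 x.2 = k, g x,
    fun k => mul_nonneg (inv_pos.2 hW).le (Finset.sum_nonneg fun x _ => hg0 x), ?_, ?_, ?_⟩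
  · rw [← Finset.mul_sum, Finset.sum_fiberwise_of_maps_to hmaps, htot, inv_mul_le_iff₀ hW]
    gcongr
  · intro i
    rw [← Finset.mul_sum, inv_mul_le_iff₀ hW]
    have hsub : Finset.Icc (i + 1) N ⊆ S := Finset.Icc_subset_Icc (by omega) le_rfl
    set E := Finset.Icc (i + 1) N with hE
    have hu : ∑ k ∈ E, ∑ x ∈ S ×ˢ S with max x.1 x.2 = k, g x =
        ∑ x ∈ S ×ˢ S with max x.1 x.2 ∈ E, g x :=
      Finset.sum_fiberwise_eq_sum_filter _ _ _ _
    rw [hu]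
    -- A union bound: the maximum exceeds `i` only if one of the two entrance times does.
    calc ∑ x ∈ S ×ˢ S with max x.1 x.2 ∈ E, g x ≤ ∑ x ∈ E ×ˢ S ∪ S ×ˢ E, g x := by
          refine Finset.sum_le_sum_of_subset_of_nonneg ?_ fun x _ _ => hg0 x
          intro x hx
          simp only [Finset.mem_filter, Finset.mem_product, Finset.mem_union, hS, hE,
            Finset.mem_Icc] at hx ⊢
          omega
      _ ≤ ∑ x ∈ E ×ˢ S, g x + ∑ x ∈ S ×ˢ E, g x := by
          rw [← Finset.sum_union_inter]
          exact le_add_of_nonneg_right (Finset.sum_nonneg fun x _ => hg0 x)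
      _ = (∑ k ∈ E, w k) * ∑ k ∈ S, w' k + (∑ k ∈ S, w k) * ∑ k ∈ E, w' k := by
          rw [Finset.sum_mul_sum, Finset.sum_mul_sum, Finset.sum_product, Finset.sum_product]
      _ ≤ (∑ k ∈ E, w k) * W + W * ∑ k ∈ E, w' k := by
          have := Finset.sum_nonneg fun j (_ : j ∈ E) => hw j
          have := Finset.sum_nonneg fun j (_ : j ∈ E) => hw' j
          gcongr
      _ = _ := by ring
  · have hH : W * ∑ k ∈ S, W⁻¹ * (∑ x ∈ S ×ˢ S with max x.1 x.2 = k, g x) * H (N - k) =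
        ∑ x ∈ S ×ˢ S, g x * H (N - max x.1 x.2) := by
      rw [← Finset.sum_fiberwise_of_maps_to hmaps, Finset.mul_sum]
      refine Finset.sum_congr rfl fun k _ => ?_
      rw [mul_assoc, mul_inv_cancel_left₀ hW.ne', Finset.sum_mul]
      refine Finset.sum_congr rfl fun x hx => ?_
      rw [(Finset.mem_filter.1 hx).2]
    have hAw : ∑ j ∈ S, A j ≤ W := (Finset.sum_le_sum fun j _ => hA j).trans hwW
    have hA0 : 0 ≤ ∑ j ∈ S, A' j := Finset.sum_nonneg fun j _ => hA' j
    have h1 : (∑ j ∈ S, A j) * ∑ j ∈ S, w' j ≤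
        (∑ j ∈ S, w j) * ∑ j ∈ S, A' j + ∑ x ∈ S ×ˢ S, g x * H (N - max x.1 x.2) := by
      rw [Finset.sum_mul_sum, Finset.sum_mul_sum, Finset.sum_product, ← Finset.sum_add_distrib]
      refine Finset.sum_le_sum fun j hj => ?_
      rw [← Finset.sum_add_distrib]
      refine Finset.sum_le_sum fun j' hj' => ?_
      rw [mul_comm]
      exact hpair j hj j' hj'
    -- The sum of the `w'` falls short of `W` by `r'`. That part of `W * ∑ A` has no partner and is
    -- bounded by `W * r'`, hence the term `r'` in the conclusion.
    have h2 : W * ∑ j ∈ S, A j ≤ W * (∑ j ∈ S, A' j + r' +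
        ∑ k ∈ S, W⁻¹ * (∑ x ∈ S ×ˢ S with max x.1 x.2 = k, g x) * H (N - k)) := by
      rw [mul_add, hH]
      nlinarith [mul_le_mul_of_nonneg_right hwW hA0, mul_le_mul_of_nonneg_right hAw hr']
    exact le_of_mul_le_mul_left h2 hW

/-- The rate `H` is compatible with the renewal inequality: coupling a proportion `ξ` of the mass
costs `N₀` steps, and the law of the waiting time for the next attempt has tail `q`. -/
def IsRenewalRate (ξ : ℝ) (N₀ : ℕ) (q H : ℕ → ℝ) : Prop :=
  (∀ N < N₀, 1 ≤ H N) ∧ ∀ N, 1 ≤ H (N + N₀) ∨ ∀ p : ℕ → ℝ, (∀ k, 0 ≤ p k) →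
    ∑ k ∈ Finset.Icc 1 N, p k ≤ 1 - ξ → (∀ i, ∑ k ∈ Finset.Icc (i + 1) N, p k ≤ 2 * q i) →
    ∑ k ∈ Finset.Icc 1 N, p k * H (N - k) + 2 * q N ≤ H (N + N₀)

/-! ### Coupling two orbits started on the base -/

namespace YoungTower

variable {Y : Type u} [MeasurableSpace Y] [MetricSpace Y] {m : Measure Y} {lam K η : ℝ}
  {T : YoungTower m lam K η}

theorem lift_smul (ρ : Measure Y) (c : ℝ≥0∞) : T.lift (c • ρ) = c • T.lift ρ :=
  Measure.map_smul _ _ _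

theorem orbit_smul (ρ : Measure Y) (c : ℝ≥0∞) (n : ℕ) :
    T.orbit (c • ρ) n = c • T.orbit ρ n := by
  rw [orbit, lift_smul, Measure.map_smul, orbit]

theorem lift_add (ρ ρ' : Measure Y) : T.lift (ρ + ρ') = T.lift ρ + T.lift ρ' :=
  Measure.map_add _ _ T.measurable_base

theorem lift_slice_zero (ν : Measure T.Space) :
    T.lift (T.slice 0 ν) = ν.restrict {x | x.1.2 ∈ ({0} : Set ℕ)} := by
  ext s hs
  rw [lift_apply hs, slice_apply (T.measurable_base hs), Measure.restrict_apply hs]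
  congr 1; ext x
  simp only [mem_ofPred_eq, mem_preimage, mem_inter_iff, mem_singleton_iff]
  rw [and_comm]
  refine and_congr_left fun h => ?_
  rw [show T.base x.1.1 = x from Subtype.ext (Prod.ext rfl h.symm)]

theorem eq_lift_slice_zero_add (ν : Measure T.Space) :
    ν = T.lift (T.slice 0 ν) + ν.restrict {x | x.1.2 ∈ ({0} : Set ℕ)ᶜ} := by
  rw [lift_slice_zero]
  exact (Measure.restrict_add_restrict_compl (T.measurableSet_level {0})).symm

theorem slice_restrict_level (ν : Measure T.Space) (l : ℕ) (s : Set ℕ) (hl : l ∈ s) :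
    T.slice l (ν.restrict {x | x.1.2 ∈ s}) = T.slice l ν := by
  ext A hA
  have hm := T.measurableSet_level_and l hA
  rw [slice_apply hA, slice_apply hA, Measure.restrict_apply hm]
  congr 1; ext x
  simp only [mem_ofPred_eq, mem_inter_iff, and_iff_left_iff_imp]
  rintro ⟨rfl, -⟩; exact hl

theorem slice_restrict_level_of_notMem (ν : Measure T.Space) (l : ℕ) (s : Set ℕ) (hl : l ∉ s) :
    T.slice l (ν.restrict {x | x.1.2 ∈ s}) = 0 := by
  ext A hA
  have hm := T.measurableSet_level_and l hA
  rw [slice_apply hA, Measure.restrict_apply hm]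
  refine measure_mono_null (t := ∅) (fun x hx => ?_) (by simp)
  obtain ⟨⟨rfl, -⟩, h⟩ := hx
  exact hl h

/-- The tail of the time of the next visit to the base. -/
theorem measure_rem_Ioi_le [IsProbabilityMeasure m] {C : ℝ} (hC : 0 ≤ C) {ν : Measure T.Space}
    (hν : ∀ l, T.slice l ν ≤ ENNReal.ofReal C • m.restrict (T.τ ⁻¹' Ioi l)) {t : ℕ → ℝ}
    (ht : Summable t) (hτ : ∀ n : ℕ, m.real {y | n < T.τ y} ≤ t n) (i : ℕ) :
    ν.real {x | T.rem x ∈ Ioi i} ≤ C * ∑' l, t (l + i) := by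
  have ht0 : ∀ n, 0 ≤ t n := fun n => measureReal_nonneg.trans (hτ n)
  refine ENNReal.toReal_le_of_le_ofReal
    (mul_nonneg hC (tsum_nonneg fun l => ht0 (l + i))) ?_
  rw [measure_rem, ← tsum_mul_left, ENNReal.ofReal_tsum_of_nonneg
    (fun l => mul_nonneg hC (ht0 _)) (((summable_nat_add_iff i).2 ht).mul_left _)]
  refine ENNReal.tsum_le_tsum fun l => (hν l _).trans ?_
  rw [Measure.smul_apply, smul_eq_mul, Measure.restrict_apply (T.measurableSet_τ _),
    ENNReal.ofReal_mul hC]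
  gcongr
  refine (measure_mono (t := {y | l + i < T.τ y}) fun y hy => ?_).trans ?_
  · have h1 : i < T.τ y - l := hy.1
    show l + i < T.τ y
    omega
  · rw [← ofReal_measureReal]
    exact ENNReal.ofReal_le_ofReal (hτ _)

theorem sum_exit_add_tail (ν : Measure T.Space) [IsFiniteMeasure ν] (N : ℕ) :
    ∑ j ∈ Finset.Icc 1 N, (T.exit j ν).real univ + ν.real {x | T.rem x ∈ Ioi N} =
      ν.real univ := by
  have h := measure_iterate_preimage ν N .univ
  simp only [preimage_univ, inter_univ, orbit_univ] at h
  simp only [Measure.real]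
  rw [h, ENNReal.toReal_add (ENNReal.sum_ne_top.2 fun j _ => by finiteness) (by finiteness),
    ENNReal.toReal_sum fun j _ => by finiteness]

theorem sum_exit_le_tail (ν : Measure T.Space) [IsFiniteMeasure ν] (i N : ℕ) :
    ∑ j ∈ Finset.Icc (i + 1) N, (T.exit j ν).real univ ≤ ν.real {x | T.rem x ∈ Ioi i} := by
  simp only [Measure.real, exit_univ]
  rw [← ENNReal.toReal_sum fun j _ => by finiteness, ← measure_biUnion_finset]
  · refine ENNReal.toReal_mono (by finiteness) (measure_mono ?_)
    intro x hx
    simp only [mem_iUnion, Finset.mem_Icc, mem_ofPred_eq, mem_Ioi] at hx ⊢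
    obtain ⟨j, hj, h⟩ := hx
    omega
  · intro i _ j _ hij
    exact disjoint_left.2 fun x hx hx' => hij (hx.symm.trans hx')
  · exact fun j _ => T.measurableSet_rem_eq j

theorem real_iterate_preimage (ν : Measure T.Space) [IsFiniteMeasure ν] (M : ℕ) {s : Set T.Space}
    (hs : MeasurableSet s) : ν.real (T.map^[M] ⁻¹' s) =
      ∑ j ∈ Finset.Icc 1 M, (T.orbit (T.exit j ν) (M - j)).real s +
        ν.real ({x | T.rem x ∈ Ioi M} ∩ T.map^[M] ⁻¹' s) := by
  simp only [Measure.real]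
  rw [measure_iterate_preimage ν M hs,
    ENNReal.toReal_add (ENNReal.sum_ne_top.2 fun j _ => by finiteness) (by finiteness),
    ENNReal.toReal_sum fun j _ => by finiteness]

/-- Any two regular probability measures on the base are `H`-close, as seen in the tower at times
`n`, `n'` which are congruent modulo `d` and at least `N`. -/
def IsCoupled (T : YoungTower m lam K η) (d : ℕ) (R : ℝ) (N : ℕ) (h : ℝ) : Prop :=
  ∀ ρ ρ' : Measure Y, IsProbabilityMeasure ρ → IsProbabilityMeasure ρ' →
    RegularOn m η R {univ} ρ → RegularOn m η R {univ} ρ' → ∀ n n' : ℕ, min n n' = N →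
    n ≡ n' [MOD d] → ∀ s, MeasurableSet s → (T.orbit ρ n).real s ≤ (T.orbit ρ' n').real s + h

/-- Homogeneous form, obtained by normalising both measures. Cross-multiplying by the masses allows
zero measures, which occur among the exits. -/
theorem IsCoupled.finite {d : ℕ} {R : ℝ} {N : ℕ} {h : ℝ} (hc : T.IsCoupled d R N h)
    {ρ ρ' : Measure Y} [IsFiniteMeasure ρ] [IsFiniteMeasure ρ'] (hρ : RegularOn m η R {univ} ρ)
    (hρ' : RegularOn m η R {univ} ρ') {n n' : ℕ} (hN : min n n' = N) (hnn : n ≡ n' [MOD d])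
    {s : Set T.Space} (hs : MeasurableSet s) :
    ρ'.real univ * (T.orbit ρ n).real s ≤
      ρ.real univ * (T.orbit ρ' n').real s + ρ.real univ * ρ'.real univ * h := by
  rcases eq_or_ne ρ 0 with rfl | h0
  · have : T.orbit (0 : Measure Y) n = 0 := by simp [orbit, lift]
    simp [this]
  rcases eq_or_ne ρ' 0 with rfl | h0'
  · simp only [measureReal_zero_apply, zero_mul, mul_zero, add_zero]
    positivity
  have : NeZero ρ := ⟨h0⟩
  have : NeZero ρ' := ⟨h0'⟩
  have key := hc ((ρ univ)⁻¹ • ρ) ((ρ' univ)⁻¹ • ρ') inferInstance inferInstance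
    (hρ.smul _) (hρ'.smul _) n n' hN hnn s hs
  rw [orbit_smul, orbit_smul, measureReal_ennreal_smul_apply, measureReal_ennreal_smul_apply,
    ENNReal.toReal_inv, ENNReal.toReal_inv] at key
  have hp : 0 < ρ.real univ := measureReal_univ_pos
  have hp' : 0 < ρ'.real univ := measureReal_univ_pos
  change (ρ.real univ)⁻¹ * _ ≤ (ρ'.real univ)⁻¹ * _ + h at key
  have := mul_le_mul_of_nonneg_left key (mul_pos hp hp').le
  rw [mul_add] at this
  calc _ = ρ.real univ * ρ'.real univ * ((ρ.real univ)⁻¹ * (T.orbit ρ n).real s) := by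
        field_simp
    _ ≤ _ := this
    _ = _ := by field_simp

/-- Part of a regular measure on the base that is evolved for a long time can be split off as a
multiple of `m` on the base. -/
theorem exists_orbit_eq_add [IsProbabilityMeasure m] {R R' c ξ : ℝ} (hR : 0 ≤ R) (hRR : R < R')
    (hK : K + lam ^ (-η) * R ≤ R) {ρ : Measure Y} [IsFiniteMeasure ρ]
    (hρ : RegularOn m η R {univ} ρ) {n : ℕ} (hc : c ≤ (T.slice 0 (T.orbit ρ n)).real univ)
    (hξ0 : 0 ≤ ξ) (hξ : ξ ≤ (R' - R) / (Real.exp R' - 1) * (Real.exp (-R) * c)) :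
    ∃ ν : Measure T.Space, T.orbit ρ n = ENNReal.ofReal ξ • T.lift m + ν ∧
      ∀ l, RegularOn m η R' T.α (T.slice l ν) := by
  have hpos : 0 ≤ (R' - R) / (Real.exp R' - 1) := by
    have := Real.add_one_le_exp R'
    exact div_nonneg (by linarith) (by linarith)
  obtain ⟨σ, hσ, e⟩ := (regularOn_slice_zero_orbit (T := T) hR hK hρ n).sub T.dist_le_one T.η_pos
    hR hRR hξ0 (hξ.trans (by gcongr))
  refine ⟨T.lift σ + (T.orbit ρ n).restrict {x | x.1.2 ∈ ({0} : Set ℕ)ᶜ}, ?_, fun l => ?_⟩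
  · rw [← add_assoc, ← lift_smul, ← lift_add, ← e]
    exact eq_lift_slice_zero_add _
  · rw [slice_add]
    cases l with
    | zero =>
      rw [slice_zero_lift, slice_restrict_level_of_notMem _ _ _ (by simp), add_zero]
      exact hσ.of_univ
    | succ l =>
      rw [slice_succ_lift, slice_restrict_level _ _ _ (by simp), zero_add]
      exact (regularOn_slice_orbit hR hK hρ n _).mono hRR.le

/-- Strong induction on `N = M + N₀`. Both orbits are stopped `M` steps before the end, where each
contains `ξ` times `m` on the base. These parts then evolve identically and cancel. The remainders
enter the base at times `j` and `j'` in pieces that are `R`-regular again. When `d` divides `j` and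
`j'`, the remaining times `M - j` and `M - j'` are congruent with minimum `M - max j j' < N`, and
the induction hypothesis applies. The parts that do not return within `M` steps give the error `2 *
q M`. -/
theorem isCoupled [IsProbabilityMeasure m] {d N₀ : ℕ} {R R' c ξ : ℝ} {t H : ℕ → ℝ}
    (hd : ∀ᵐ y ∂m, d ∣ T.τ y) (hR : 0 ≤ R) (hRR : R < R') (hK : K + lam ^ (-η) * R' ≤ R)
    (ht : Summable t) (hτ : ∀ n : ℕ, m.real {y | n < T.τ y} ≤ t n) (hN₀ : 1 ≤ N₀)
    (hdN₀ : d ∣ N₀)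
    (hc : ∀ (ρ : Measure Y) [IsProbabilityMeasure ρ], RegularOn m η R {univ} ρ →
      ∀ n ≥ N₀, d ∣ n → c ≤ (T.slice 0 (T.orbit ρ n)).real univ)
    (hξ0 : 0 < ξ) (hξ1 : ξ < 1) (hξ : ξ ≤ (R' - R) / (Real.exp R' - 1) * (Real.exp (-R) * c))
    (hH : IsRenewalRate ξ N₀ (fun i => Real.exp R * ∑' l, t (l + i)) H) (N : ℕ) :
    T.IsCoupled d R N (H N) := by
  have hlam : 0 ≤ lam ^ (-η) := Real.rpow_nonneg (zero_lt_one.trans T.one_lt_lam).le _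
  have hK' : K + lam ^ (-η) * R ≤ R := le_trans (by gcongr) hK
  induction N using Nat.strong_induction_on with
  | _ N ih =>
  have htriv : 1 ≤ H N → T.IsCoupled d R N (H N) := by
    intro h1 ρ ρ' _ _ _ _ n n' _ _ s _
    have h2 : (T.orbit ρ n).real s ≤ 1 := by
      refine (measureReal_mono (subset_univ s)).trans ?_
      rw [Measure.real, orbit_univ]; simp
    have h3 : 0 ≤ (T.orbit ρ' n').real s := measureReal_nonneg
    linarith
  rcases lt_or_ge N N₀ with hN | hN
  · exact htriv (hH.1 N hN)
  obtain ⟨M, rfl⟩ : ∃ M, N = M + N₀ := ⟨N - N₀, by omega⟩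
  rcases hH.2 M with h1 | hrec
  · exact htriv h1
  intro ρ ρ' hρp hρp' hρ hρ' n n' hmin hmod s hs
  obtain ⟨a, rfl⟩ : ∃ a, n = a + M := ⟨n - M, by omega⟩
  obtain ⟨a', rfl⟩ : ∃ a', n' = a' + M := ⟨n' - M, by omega⟩
  have haa : a ≡ a' [MOD d] := Nat.ModEq.add_right_cancel' M hmod
  -- The smaller of `a` and `a'` is exactly `N₀`, a multiple of `d`, and the other is congruent to
  -- it.
  have hda : d ∣ a ∧ d ∣ a' := by
    rcases le_total a a' with h | h
    · have : a = N₀ := by omega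
      subst this
      exact ⟨hdN₀, (haa.dvd_iff dvd_rfl).1 hdN₀⟩
    · have : a' = N₀ := by omega
      subst this
      exact ⟨(haa.dvd_iff dvd_rfl).2 hdN₀, hdN₀⟩
  obtain ⟨ν, hν, hνr⟩ := exists_orbit_eq_add hR hRR hK' hρ (hc ρ hρ a (by omega) hda.1) hξ0.le hξ
  obtain ⟨ν', hν', hνr'⟩ :=
    exists_orbit_eq_add hR hRR hK' hρ' (hc ρ' hρ' a' (by omega) hda.2) hξ0.le hξ
  have hle : ν ≤ T.orbit ρ a := by rw [hν]; exact Measure.le_add_left le_rfl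
  have hle' : ν' ≤ T.orbit ρ' a' := by rw [hν']; exact Measure.le_add_left le_rfl
  have : IsFiniteMeasure ν := isFiniteMeasure_of_le _ hle
  have : IsFiniteMeasure ν' := isFiniteMeasure_of_le _ hle'
  have hq : ∀ (ρ : Measure Y) [IsProbabilityMeasure ρ], RegularOn m η R {univ} ρ →
      ∀ a i, (T.orbit ρ a).real {x | T.rem x ∈ Ioi i} ≤ Real.exp R * ∑' l, t (l + i) := by
    intro ρ _ hρ a i
    refine measure_rem_Ioi_le (Real.exp_pos _).le (fun l => ?_) ht hτ i
    have := slice_orbit_le (T := T) hR hK' hρ a l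
    rwa [measure_univ (μ := ρ), mul_one] at this
  have htail : ∀ i, ν.real {x | T.rem x ∈ Ioi i} ≤ Real.exp R * ∑' l, t (l + i) := fun i =>
    (ENNReal.toReal_mono (by finiteness) (hle _)).trans (hq ρ hρ a i)
  have htail' : ∀ i, ν'.real {x | T.rem x ∈ Ioi i} ≤ Real.exp R * ∑' l, t (l + i) := fun i =>
    (ENNReal.toReal_mono (by finiteness) (hle' _)).trans (hq ρ' hρ' a' i)
  have hfin : IsFiniteMeasure (ENNReal.ofReal ξ • T.lift m) :=
    Measure.smul_finite _ ENNReal.ofReal_ne_top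
  have hmass : ∀ (ρ : Measure Y) [IsProbabilityMeasure ρ] (a : ℕ) (ν : Measure T.Space)
      [IsFiniteMeasure ν], T.orbit ρ a = ENNReal.ofReal ξ • T.lift m + ν →
      ν.real univ = 1 - ξ := by
    intro ρ _ a ν _ hν
    have h1 := congrArg (fun μ : Measure T.Space => μ.real univ) hν
    rw [measureReal_add_apply, measureReal_ennreal_smul_apply, ENNReal.toReal_ofReal hξ0.le,
      Measure.real, orbit_univ, Measure.real, lift_apply .univ] at h1
    simp only [preimage_univ, measure_univ, ENNReal.toReal_one, mul_one] at h1
    linarith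
  have hexp : ∀ (ρ : Measure Y) [IsProbabilityMeasure ρ] (a : ℕ) (ν : Measure T.Space)
      [IsFiniteMeasure ν], T.orbit ρ a = ENNReal.ofReal ξ • T.lift m + ν →
      (T.orbit ρ (a + M)).real s = ξ * (T.orbit m M).real s +
        ∑ j ∈ Finset.Icc 1 M, (T.orbit (T.exit j ν) (M - j)).real s +
        ν.real ({x | T.rem x ∈ Ioi M} ∩ T.map^[M] ⁻¹' s) := by
    intro ρ _ a ν _ hν
    rw [orbit_add, measureReal_def, Measure.map_apply (T.measurable_iterate M) hs,
      ← measureReal_def, hν, measureReal_add_apply, measureReal_ennreal_smul_apply,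
      ENNReal.toReal_ofReal hξ0.le, real_iterate_preimage ν M hs, add_assoc, measureReal_def,
      ← orbit_apply hs, ← measureReal_def]
  -- Pieces entering the base at a time that is not a multiple of `d` are dominated by a null part
  -- of the orbit, so the non-congruent pairs contribute nothing.
  have hzero : ∀ (ρ : Measure Y) (a : ℕ) (ν : Measure T.Space), RegularOn m η R {univ} ρ →
      d ∣ a → ν ≤ T.orbit ρ a → ∀ j, ¬ d ∣ j → (T.exit j ν).real univ = 0 := by
    intro ρ a ν hρ ha hle j hj
    rw [measureReal_def, exit_univ, ENNReal.toReal_eq_zero_iff]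
    left
    refine le_antisymm ((hle _).trans (orbit_rem_eq_zero hd hρ.absolutelyContinuous a j ?_).le)
      zero_le
    rwa [Nat.dvd_add_right ha]
  obtain ⟨p, hp0, hp1, hp2, hp3⟩ := exists_coupling_weights (N := M) (W := 1 - ξ)
    (r := ν.real {x | T.rem x ∈ Ioi M}) (r' := ν'.real {x | T.rem x ∈ Ioi M})
    (w := fun j => (T.exit j ν).real univ) (w' := fun j => (T.exit j ν').real univ)
    (A := fun j => (T.orbit (T.exit j ν) (M - j)).real s)
    (A' := fun j => (T.orbit (T.exit j ν') (M - j)).real s) (H := H) (by linarith)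
    (fun _ => measureReal_nonneg) (fun _ => measureReal_nonneg) measureReal_nonneg
    measureReal_nonneg (fun _ => measureReal_nonneg)
    ((sum_exit_add_tail ν M).trans (hmass ρ a ν hν))
    ((sum_exit_add_tail ν' M).trans (hmass ρ' a' ν' hν'))
    (fun j => by
      refine (measureReal_mono (subset_univ s)).trans ?_
      rw [measureReal_def, orbit_univ, ← measureReal_def])
    (fun j hj j' hj' => by
      rw [Finset.mem_Icc] at hj hj'
      by_cases hdj : d ∣ j
      · by_cases hdj' : d ∣ j'
        · refine (ih (M - max j j') (by omega)).finite (regularOn_exit (by linarith) hK hνr j)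
            (regularOn_exit (by linarith) hK hνr' j') (by omega) ?_ hs
          have h1 := (Nat.modEq_zero_iff_dvd.2 hdj).trans (Nat.modEq_zero_iff_dvd.2 hdj').symm
          refine Nat.ModEq.add_right_cancel h1 ?_
          rw [Nat.sub_add_cancel hj.2, Nat.sub_add_cancel hj'.2]
        · have h0 := hzero ρ' a' ν' hρ' hda.2 hle' j' hdj'
          simp only [h0, zero_mul, mul_zero, add_zero]
          positivity
      · have h0 := hzero ρ a ν hρ hda.1 hle j hdj
        have h1 : (T.orbit (T.exit j ν) (M - j)).real s ≤ 0 := by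
          refine (measureReal_mono (subset_univ s)).trans ?_
          rw [measureReal_def, orbit_univ, ← measureReal_def, h0]
        simp only [h0, zero_mul, add_zero]
        exact mul_nonpos_of_nonneg_of_nonpos measureReal_nonneg h1)
  have hmain := hrec p hp0 hp1 fun i => by
    have h1 := (sum_exit_le_tail ν i M).trans (htail i)
    have h2 := (sum_exit_le_tail ν' i M).trans (htail' i)
    have h3 := hp2 i
    simp only at h3 ⊢
    linarith
  rw [hexp ρ a ν hν, hexp ρ' a' ν' hν']
  have h4 : ν.real ({x | T.rem x ∈ Ioi M} ∩ T.map^[M] ⁻¹' s) ≤ ν.real {x | T.rem x ∈ Ioi M} :=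
    measureReal_mono inter_subset_left
  have h5 : 0 ≤ ν'.real ({x | T.rem x ∈ Ioi M} ∩ T.map^[M] ⁻¹' s) := measureReal_nonneg
  have h6 := htail M
  have h7 := htail' M
  simp only at hmain hp3
  linarith

end YoungTower

/-! ### From base measures to measures on the whole tower -/

/-- The integral of `|h|` is at most twice the supremum of `|∫ x in s, h x|`. -/
theorem integral_abs_le_of_forall_setIntegral_le {X : Type u} [MeasurableSpace X] {μ : Measure X}
    {h : X → ℝ} (hh : Integrable h μ) {D : ℝ}
    (hD : ∀ s, MeasurableSet s → |∫ x in s, h x ∂μ| ≤ D) : ∫ x, |h x| ∂μ ≤ 2 * D := by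
  obtain ⟨g, hg, hgh⟩ := hh.1
  have hs : MeasurableSet {x | 0 ≤ g x} := measurableSet_le measurable_const hg.measurable
  rw [← integral_add_compl hs hh.abs]
  have h1 : ∫ x in {x | 0 ≤ g x}, |h x| ∂μ = ∫ x in {x | 0 ≤ g x}, h x ∂μ := by
    refine setIntegral_congr_ae hs ?_
    filter_upwards [hgh] with x hx hx0
    rw [hx, abs_of_nonneg hx0]
  have h2 : ∫ x in {x | 0 ≤ g x}ᶜ, |h x| ∂μ = -∫ x in {x | 0 ≤ g x}ᶜ, h x ∂μ := by
    rw [← integral_neg]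
    refine setIntegral_congr_ae hs.compl ?_
    filter_upwards [hgh] with x hx hx0
    rw [hx, abs_of_neg (lt_of_not_ge (show ¬ 0 ≤ g x from hx0))]
  have h3 := (abs_le.1 (hD _ hs)).2
  have h4 := (abs_le.1 (hD _ hs.compl)).1
  linarith

/-- Two windows of `d` consecutive integers each meet every residue class exactly once, so their
terms can be matched by residue. This is where summing over a period removes the congruence
condition. -/
theorem sum_range_le_sum_range_of_modEq {d : ℕ} {M M' : ℕ} {f g : ℕ → ℝ} {b : ℝ}
    (h : ∀ k ∈ Finset.range d, ∀ k' ∈ Finset.range d, M + k ≡ M' + k' [MOD d] →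
      f k ≤ g k' + b) :
    ∑ k ∈ Finset.range d, f k ≤ ∑ k ∈ Finset.range d, g k + d * b := by
  rcases Nat.eq_zero_or_pos d with rfl | hd
  · simp
  -- The term `(d - 1) * M'` plays the role of `-M'` modulo `d`.
  set e : ℕ → ℕ := fun k => (M + k + (d - 1) * M') % d
  have he : ∀ k, M + k ≡ M' + e k [MOD d] := by
    intro k
    have h1 : M' + e k ≡ M' + (M + k + (d - 1) * M') [MOD d] :=
      (Nat.ModEq.refl M').add (Nat.mod_modEq _ _)
    have h2 : M' + (M + k + (d - 1) * M') = M + k + d * M' := by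
      obtain ⟨c, rfl⟩ : ∃ c, d = c + 1 := ⟨d - 1, by omega⟩
      simp only [Nat.add_sub_cancel]; ring
    rw [h2] at h1
    refine (h1.trans ?_).symm
    simp [Nat.ModEq]
  have hmaps : ∀ k ∈ Finset.range d, e k ∈ Finset.range d := fun k _ =>
    Finset.mem_range.2 (Nat.mod_lt _ hd)
  have hinj : Set.InjOn e (Finset.range d) := by
    intro k hk k' hk' hkk
    have h1 : M + k ≡ M + k' [MOD d] := (he k).trans (by rw [hkk]; exact (he k').symm)
    have h2 := Nat.ModEq.add_left_cancel' M h1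
    rw [Finset.coe_range, mem_Iio] at hk hk'
    rwa [Nat.ModEq, Nat.mod_eq_of_lt hk, Nat.mod_eq_of_lt hk'] at h2
  have hsurj : Set.SurjOn e (Finset.range d) (Finset.range d) :=
    Finset.surjOn_of_injOn_of_card_le e hmaps hinj le_rfl
  have hsum : ∑ k ∈ Finset.range d, g (e k) = ∑ k ∈ Finset.range d, g k :=
    Finset.sum_nbij e hmaps hinj hsurj fun _ _ => rfl
  calc ∑ k ∈ Finset.range d, f k ≤ ∑ k ∈ Finset.range d, (g (e k) + b) :=
        Finset.sum_le_sum fun k hk => h k hk (e k) (hmaps k hk) (he k)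
    _ = _ := by rw [Finset.sum_add_distrib, hsum]; simp

/-- Convolving the rate `H` with a law whose tail is at most `2 q` gives at most the rate `G`. -/
def IsConvolvedRate (q H G : ℕ → ℝ) : Prop :=
  ∀ (N : ℕ) (p : ℕ → ℝ), (∀ k, 0 ≤ p k) → ∑ k ∈ Finset.Icc 1 N, p k ≤ 1 →
    (∀ i, ∑ k ∈ Finset.Icc (i + 1) N, p k ≤ 2 * q i) →
    ∑ k ∈ Finset.Icc 1 N, p k * H (N - k) + 2 * q N ≤ G N

namespace YoungTower

variable {Y : Type u} [MeasurableSpace Y] [MetricSpace Y] {m : Measure Y} {lam K η : ℝ}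
  {T : YoungTower m lam K η}

theorem orbit_real_preimage (ρ : Measure Y) (n k : ℕ) {s : Set T.Space} (hs : MeasurableSet s) :
    (T.orbit ρ n).real (T.map^[k] ⁻¹' s) = (T.orbit ρ (n + k)).real s := by
  rw [orbit_add, measureReal_def, measureReal_def, Measure.map_apply (T.measurable_iterate k) hs]

/-- Two piecewise regular measures on the tower of the same mass are close to each other after a
long time, on average over a period. -/
theorem sum_measure_iterate_le [IsProbabilityMeasure m] {d : ℕ} {R R' C : ℝ} {t H G : ℕ → ℝ}
    (hd : 1 ≤ d) (hR : 0 ≤ R') (hK : K + lam ^ (-η) * R' ≤ R) (ht : Summable t)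
    (hτ : ∀ n : ℕ, m.real {y | n < T.τ y} ≤ t n) (hH : Antitone H)
    (hc : ∀ N, T.IsCoupled d R N (H N)) (hG : IsConvolvedRate (fun i => ∑' l, t (l + i)) H G)
    (hC : 0 < C) {ν ν' : Measure T.Space} [IsFiniteMeasure ν] [IsFiniteMeasure ν']
    (hν : ∀ l, RegularOn m η R' T.α (T.slice l ν)) (hν' : ∀ l, RegularOn m η R' T.α (T.slice l ν'))
    (hνC : ∀ l, T.slice l ν ≤ ENNReal.ofReal C • m.restrict (T.τ ⁻¹' Ioi l))
    (hνC' : ∀ l, T.slice l ν' ≤ ENNReal.ofReal C • m.restrict (T.τ ⁻¹' Ioi l))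
    (hW : 0 < ν.real univ) (hWC : ν.real univ ≤ C) (hνν : ν.real univ = ν'.real univ) (N : ℕ)
    {s : Set T.Space} (hs : MeasurableSet s) :
    ∑ k ∈ Finset.range d, ν.real (T.map^[N + k] ⁻¹' s) ≤
      ∑ k ∈ Finset.range d, ν'.real (T.map^[N + k] ⁻¹' s) + d * (C * G N) := by
  have hd0 : (0 : ℝ) < d := by exact_mod_cast hd
  have hexp : ∀ (ν : Measure T.Space) [IsFiniteMeasure ν], ∀ k, ν.real (T.map^[N + k] ⁻¹' s) =
      ∑ j ∈ Finset.Icc 1 N, (T.orbit (T.exit j ν) (N - j + k)).real s +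
        ν.real ({x | T.rem x ∈ Ioi N} ∩ T.map^[N] ⁻¹' (T.map^[k] ⁻¹' s)) := by
    intro ν _ k
    rw [add_comm N k, Function.iterate_add, preimage_comp,
      real_iterate_preimage ν N (T.measurable_iterate k hs)]
    simp only [orbit_real_preimage _ _ _ hs]
  -- Entrance times are now arbitrary modulo `d`, so two pieces are comparable only after summing
  -- over a window of `d` times.
  set A : Measure T.Space → ℕ → ℝ := fun ν j =>
    ∑ k ∈ Finset.range d, (T.orbit (T.exit j ν) (N - j + k)).real s with hA
  have hsum : ∀ (ν : Measure T.Space) [IsFiniteMeasure ν],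
      ∑ k ∈ Finset.range d, ν.real (T.map^[N + k] ⁻¹' s) = ∑ j ∈ Finset.Icc 1 N, A ν j +
        ∑ k ∈ Finset.range d,
          ν.real ({x | T.rem x ∈ Ioi N} ∩ T.map^[N] ⁻¹' (T.map^[k] ⁻¹' s)) := by
    intro ν _
    rw [Finset.sum_congr rfl fun k _ => hexp ν k, Finset.sum_add_distrib, Finset.sum_comm]
  have htail := measure_rem_Ioi_le hC.le hνC ht hτ
  have htail' := measure_rem_Ioi_le hC.le hνC' ht hτ
  obtain ⟨p, hp0, hp1, hp2, hp3⟩ := exists_coupling_weights (N := N) (W := ν.real univ)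
    (r := ν.real {x | T.rem x ∈ Ioi N}) (r' := ν'.real {x | T.rem x ∈ Ioi N})
    (w := fun j => (T.exit j ν).real univ) (w' := fun j => (T.exit j ν').real univ)
    (A := fun j => (d : ℝ)⁻¹ * A ν j) (A' := fun j => (d : ℝ)⁻¹ * A ν' j) (H := H) hW
    (fun _ => measureReal_nonneg) (fun _ => measureReal_nonneg) measureReal_nonneg
    measureReal_nonneg
    (fun _ => mul_nonneg (inv_pos.2 hd0).le (Finset.sum_nonneg fun _ _ => measureReal_nonneg))
    (sum_exit_add_tail ν N) ((sum_exit_add_tail ν' N).trans hνν.symm)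
    (fun j => by
      rw [inv_mul_le_iff₀ hd0, hA]
      calc _ ≤ ∑ k ∈ Finset.range d, (T.exit j ν).real univ := by
            refine Finset.sum_le_sum fun k _ => ?_
            refine (measureReal_mono (subset_univ s)).trans ?_
            rw [measureReal_def, orbit_univ, ← measureReal_def]
        _ = _ := by simp)
    (fun j hj j' hj' => by
      rw [Finset.mem_Icc] at hj hj'
      have key : ∑ k ∈ Finset.range d,
            (T.exit j' ν').real univ * (T.orbit (T.exit j ν) (N - j + k)).real s ≤
          ∑ k ∈ Finset.range d,
            (T.exit j ν).real univ * (T.orbit (T.exit j' ν') (N - j' + k)).real s +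
          d * ((T.exit j ν).real univ * (T.exit j' ν').real univ * H (N - max j j')) := by
        refine sum_range_le_sum_range_of_modEq (M := N - j) (M' := N - j') fun k _ k' _ hkk => ?_
        refine ((hc (min (N - j + k) (N - j' + k'))).finite (regularOn_exit hR hK hν j)
          (regularOn_exit hR hK hν' j') rfl hkk hs).trans ?_
        gcongr
        -- The window offsets only increase the smaller of the two times beyond `N - max j j'`, and
        -- `H` is antitone.
        exact hH (by omega)
      rw [← Finset.mul_sum, ← Finset.mul_sum] at key
      have := mul_le_mul_of_nonneg_left key (inv_pos.2 hd0).le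
      rw [mul_add, inv_mul_cancel_left₀ hd0.ne'] at this
      calc _ = (d : ℝ)⁻¹ * ((T.exit j' ν').real univ * A ν j) := by ring
        _ ≤ _ := this
        _ = _ := by ring)
  -- Dividing by `C` normalises the weights to mass at most one and their tails to the tail sums of
  -- `t`.
  have hmain := hG N (fun k => C⁻¹ * p k) (fun k => mul_nonneg (inv_pos.2 hC).le (hp0 k))
    (by rw [← Finset.mul_sum, inv_mul_le_iff₀ hC]; linarith)
    (fun i => by
      rw [← Finset.mul_sum, inv_mul_le_iff₀ hC]
      have h1 := (sum_exit_le_tail ν i N).trans (htail i)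
      have h2 := (sum_exit_le_tail ν' i N).trans (htail' i)
      have h3 := hp2 i
      simp only at h3 ⊢
      linarith)
  have hmain2 := mul_le_mul_of_nonneg_left hmain hC.le
  have e1 : C * ∑ k ∈ Finset.Icc 1 N, C⁻¹ * p k * H (N - k) =
      ∑ k ∈ Finset.Icc 1 N, p k * H (N - k) := by
    rw [Finset.mul_sum]
    refine Finset.sum_congr rfl fun k _ => ?_
    rw [mul_assoc, mul_inv_cancel_left₀ hC.ne']
  simp only at hmain2
  rw [mul_add, e1] at hmain2
  rw [← Finset.mul_sum, ← Finset.mul_sum] at hp3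
  have hp4 := mul_le_mul_of_nonneg_left hp3 hd0.le
  rw [mul_add, mul_add, mul_inv_cancel_left₀ hd0.ne', mul_inv_cancel_left₀ hd0.ne'] at hp4
  rw [hsum ν, hsum ν']
  have h5 : ∑ k ∈ Finset.range d,
      ν.real ({x | T.rem x ∈ Ioi N} ∩ T.map^[N] ⁻¹' (T.map^[k] ⁻¹' s)) ≤
      d * (C * ∑' l, t (l + N)) := by
    calc _ ≤ ∑ k ∈ Finset.range d, C * ∑' l, t (l + N) := Finset.sum_le_sum fun k _ =>
          (measureReal_mono inter_subset_left).trans (htail N)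
      _ = _ := by simp
  have h6 : 0 ≤ ∑ k ∈ Finset.range d,
      ν'.real ({x | T.rem x ∈ Ioi N} ∩ T.map^[N] ⁻¹' (T.map^[k] ⁻¹' s)) :=
    Finset.sum_nonneg fun _ _ => measureReal_nonneg
  have h7 := mul_le_mul_of_nonneg_left (htail' N) hd0.le
  have h8 := mul_le_mul_of_nonneg_left hmain2 hd0.le
  linarith

/-! ### The probability measure of the tower and the duality of its transfer operator -/

theorem measurableEmbedding_val : MeasurableEmbedding (Subtype.val : T.Space → Y × ℕ) :=
  .subtype_coe (measurableSet_lt measurable_snd (T.τ_measurable.comp measurable_fst))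

theorem ofReal_meanReturn : ENNReal.ofReal T.meanReturn = ∫⁻ y, (T.τ y : ℝ≥0∞) ∂m := by
  rw [meanReturn, ofReal_integral_eq_lintegral_ofReal T.τ_integrable
    (.of_forall fun y => by positivity)]
  simp

/-- The restriction of `g` to level `l`, as a function on `Y`. -/
noncomputable def fiber (T : YoungTower m lam K η) (g : T.Space → ℝ≥0∞) (l : ℕ) (y : Y) :
    ℝ≥0∞ := by
  classical exact if h : l < T.τ y then g ⟨(y, l), h⟩ else 0

theorem measurable_fiber {g : T.Space → ℝ≥0∞} (hg : Measurable g) (l : ℕ) :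
    Measurable (T.fiber g l) := by
  classical
  refine Measurable.dite (s := {y | l < T.τ y}) (f := fun y => g ⟨(y.1, l), y.2⟩)
    (g := fun _ => 0) (hg.comp (Measurable.subtype_mk (by fun_prop))) measurable_const
    (T.measurableSet_τ (Ioi l))

theorem integrable_transfer_iterate {φ : T.Space → ℝ} (hφ : Integrable φ T.measure) (n : ℕ) :
    Integrable (T.transfer^[n] φ) T.measure := by
  cases n with
  | zero => exact hφ
  | succ n =>
    rw [Function.iterate_succ_apply']
    exact integrable_transferOp _ _ _

theorem slice_withDensity (ν : Measure T.Space) {g : T.Space → ℝ≥0∞} (hg : Measurable g) (l : ℕ) :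
    T.slice l (ν.withDensity g) = (T.slice l ν).withDensity (T.fiber g l) := by
  have hm := measurable_fiber hg l
  ext A hA
  have hl : MeasurableSet {x : T.Space | x.1.2 = l} := T.measurableSet_level {l}
  rw [slice, slice, Measure.map_apply T.measurable_proj hA, withDensity_apply _ hA,
    setLIntegral_map hA hm T.measurable_proj, restrict_withDensity hl,
    withDensity_apply _ (T.measurable_proj hA)]
  refine setLIntegral_congr_fun_ae (T.measurable_proj hA) ?_
  filter_upwards [ae_restrict_mem hl] with x hx _
  obtain rfl : x.1.2 = l := hx
  rw [fiber, dif_pos x.2]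

section measure

variable [IsProbabilityMeasure m]

theorem measure_apply {E : Set T.Space} (hE : MeasurableSet E) :
    T.measure E = (ENNReal.ofReal T.meanReturn)⁻¹ *
      ∑' l, m {y | (y, l) ∈ (Subtype.val '' E : Set (Y × ℕ))} := by
  rw [measure, Measure.smul_apply, smul_eq_mul, measurableEmbedding_val.comap_apply,
    Measure.prod_apply_symm (measurableEmbedding_val.measurableSet_image.2 hE), lintegral_count]
  rfl

theorem one_le_ofReal_meanReturn : 1 ≤ ENNReal.ofReal T.meanReturn := by
  rw [ofReal_meanReturn]
  calc (1 : ℝ≥0∞) = ∫⁻ _, 1 ∂m := by simp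
    _ ≤ _ := lintegral_mono fun y => by
        have := T.τ_pos y
        simp only; exact_mod_cast this

instance : IsProbabilityMeasure T.measure := by
  constructor
  rw [measure, Measure.smul_apply, smul_eq_mul, measurableEmbedding_val.comap_apply,
    Measure.prod_apply (measurableEmbedding_val.measurableSet_image.2 .univ)]
  have : ∀ y, Measure.count (Prod.mk y ⁻¹' (Subtype.val '' (univ : Set T.Space))) =
      (T.τ y : ℝ≥0∞) := by
    intro y
    have e : Prod.mk y ⁻¹' (Subtype.val '' (univ : Set T.Space)) =
        ((Finset.range (T.τ y) : Finset ℕ) : Set ℕ) := by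
      ext l; simp
    rw [e, Measure.count_apply_finset]; simp
  rw [lintegral_congr this, ← ofReal_meanReturn]
  exact ENNReal.inv_mul_cancel (zero_lt_one.trans_le one_le_ofReal_meanReturn).ne'
    ENNReal.ofReal_ne_top

theorem slice_measure (l : ℕ) : T.slice l T.measure =
    (ENNReal.ofReal T.meanReturn)⁻¹ • m.restrict (T.τ ⁻¹' Ioi l) := by
  ext A hA
  rw [slice_apply hA, measure_apply (T.measurableSet_level_and l hA), Measure.smul_apply,
    smul_eq_mul, Measure.restrict_apply hA, tsum_eq_single l]
  · congr 2
    ext y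
    simp only [mem_ofPred_eq, mem_image, Subtype.exists, mem_inter_iff, mem_preimage, mem_Ioi]
    constructor
    · rintro ⟨⟨y', l'⟩, h, ⟨rfl, h2⟩, h3⟩
      simp only [Prod.mk.injEq] at h3
      obtain ⟨rfl, -⟩ := h3
      exact ⟨h2, h⟩
    · rintro ⟨h1, h2⟩
      exact ⟨(y, l), h2, ⟨rfl, h1⟩, rfl⟩
  · intro l' hl'
    refine measure_mono_null (t := ∅) (fun y hy => ?_) (by simp)
    obtain ⟨x, ⟨hx, -⟩, h⟩ := hy
    rw [h] at hx
    exact hl' hx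

theorem measure_null_iff {E : Set T.Space} (hE : MeasurableSet E) :
    T.measure E = 0 ↔ ∀ l, m {y | (y, l) ∈ (Subtype.val '' E : Set (Y × ℕ))} = 0 := by
  rw [measure_apply hE, mul_eq_zero, ENNReal.tsum_eq_zero, or_iff_right]
  exact ENNReal.inv_ne_zero.2 ENNReal.ofReal_ne_top

/-- Points of level `l` in the preimage of `E` either climb into level `l + 1` of `E` or are sent by
`F` into level zero of `E`. Nonsingularity of `F` handles the second case. -/
theorem quasiMeasurePreserving_map : Measure.QuasiMeasurePreserving T.map T.measure T.measure := by
  refine ⟨T.measurable_map, Measure.AbsolutelyContinuous.mk fun E hE h0 => ?_⟩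
  rw [Measure.map_apply T.measurable_map hE, measure_null_iff (T.measurable_map hE)]
  rw [measure_null_iff hE] at h0
  intro l
  refine measure_mono_null (fun y hy => ?_)
    (measure_union_null (h0 (l + 1)) (T.nonsingular.preimage_null (h0 0)))
  obtain ⟨x, hx, hxy⟩ := hy
  obtain ⟨rfl, rfl⟩ := Prod.ext_iff.1 hxy
  rcases (T.rem_pos x).eq_or_lt with h | h
  · right
    rw [mem_preimage, map_of_rem_eq_one h.symm] at hx
    exact ⟨_, hx, rfl⟩
  · left
    exact ⟨_, hx, map_of_one_lt_rem h⟩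

theorem setIntegral_transfer_iterate {φ : T.Space → ℝ} (hφ : Integrable φ T.measure) (n : ℕ)
    {s : Set T.Space} (hs : MeasurableSet s) :
    ∫ x in s, (T.transfer^[n] φ) x ∂T.measure = ∫ x in T.map^[n] ⁻¹' s, φ x ∂T.measure := by
  induction n generalizing s with
  | zero => rfl
  | succ n ih =>
    rw [Function.iterate_succ_apply', transfer,
      setIntegral_transferOp quasiMeasurePreserving_map (integrable_transfer_iterate hφ n) hs,
      ih (T.measurable_map hs), ← preimage_comp, ← Function.iterate_succ']

end measure

/-! ### Decay for Hölder observables -/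

section observable

variable {φ : T.Space → ℝ} {M : ℝ}

theorem abs_le_of_holderNorm_le (hM : 0 ≤ M) (h : T.holderNorm φ ≤ ENNReal.ofReal M)
    (x : T.Space) : |φ x| ≤ M := by
  have h1 := (le_iSup (fun x => ENNReal.ofReal |φ x|) x).trans (le_add_self.trans h)
  exact (ENNReal.ofReal_le_ofReal_iff hM).1 h1

theorem abs_sub_le_of_holderNorm_le (hM : 0 ≤ M) (h : T.holderNorm φ ≤ ENNReal.ofReal M)
    {x y : T.Space} (hxy : x.1.2 = y.1.2) : |φ x - φ y| ≤ M * dist x.1.1 y.1.1 ^ η := by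
  rcases eq_or_ne x y with rfl | hne
  · have := Real.rpow_nonneg (dist_nonneg (x := x.1.1) (y := x.1.1)) η
    simp only [sub_self, abs_zero]; positivity
  · have h1 : ENNReal.ofReal (|φ x - φ y| / T.towerDist x y ^ η) ≤ ENNReal.ofReal M := by
      refine le_trans ?_ (le_self_add.trans h)
      exact le_iSup_of_le x (le_iSup_of_le y (le_iSup_of_le hne le_rfl))
    rw [ENNReal.ofReal_le_ofReal_iff hM, towerDist, if_pos hxy, div_le_iff₀] at h1
    · exact h1
    · refine Real.rpow_pos_of_pos (dist_pos.2 fun h => hne ?_) _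
      exact Subtype.ext (Prod.ext h hxy)

variable [IsProbabilityMeasure m]

/-- The oscillation bound holds pointwise for `ψ`, while measurability is available only for `g`.
The set where they disagree is null on each level and is discarded in the definition of regularity.
-/
theorem regularOn_slice_withDensity {g : T.Space → ℝ≥0∞} (hg : Measurable g) {ψ : T.Space → ℝ}
    (hgψ : ∀ᵐ x ∂T.measure, g x = ENNReal.ofReal (ψ x)) {R : ℝ}
    (hψ : ∀ x y : T.Space, x.1.2 = y.1.2 → ψ x ≤ Real.exp (R * dist x.1.1 y.1.1 ^ η) * ψ y)
    (l : ℕ) : RegularOn m η R T.α (T.slice l (T.measure.withDensity g)) := by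
  obtain ⟨N, hN, hNm, hN0⟩ := exists_measurable_superset_of_null (ae_iff.1 hgψ)
  rw [measure_null_iff hNm] at hN0
  have hm := measurable_fiber hg l
  obtain ⟨N', hN', hNm', hN0'⟩ := exists_measurable_superset_of_null (hN0 l)
  have hreg : RegularOn m η R T.α (m.withDensity (T.fiber g l)) := by
    refine ⟨_, hm, ⟨N'ᶜ, hNm'.compl, by rwa [compl_compl], ?_⟩, rfl⟩
    rintro a ha x ⟨hx, hxa⟩ y ⟨hy, hya⟩
    have hτ := T.τ_const a ha x hxa y hya
    by_cases hl : l < T.τ x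
    · have hl' : l < T.τ y := hτ ▸ hl
      rw [fiber, fiber, dif_pos hl, dif_pos hl']
      have e : ∀ z (hz : l < T.τ z), z ∉ N' → g ⟨(z, l), hz⟩ = ENNReal.ofReal (ψ ⟨(z, l), hz⟩) := by
        intro z hz hzN
        by_contra hne
        exact hzN (hN' ⟨_, hN hne, rfl⟩)
      rw [e x hl hx, e y hl' hy, ← ENNReal.ofReal_mul (Real.exp_pos _).le]
      exact ENNReal.ofReal_le_ofReal (hψ ⟨(x, l), hl⟩ ⟨(y, l), hl'⟩ rfl)
    · rw [fiber, dif_neg hl]; exact zero_le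
  rw [slice_withDensity _ hg, slice_measure, withDensity_smul_measure,
    ← restrict_withDensity (T.measurableSet_τ _)]
  exact (hreg.restrict (T.measurableSet_τ _) (T.τ_preimage_cases _)).smul _

theorem slice_withDensity_le {g : T.Space → ℝ≥0∞} {C : ℝ≥0∞}
    (hgC : ∀ᵐ x ∂T.measure, g x ≤ C) (l : ℕ) :
    T.slice l (T.measure.withDensity g) ≤ C • m.restrict (T.τ ⁻¹' Ioi l) := by
  have h1 : T.measure.withDensity g ≤ C • T.measure := by
    rw [← withDensity_const]
    exact withDensity_mono hgC
  refine Measure.le_iff.2 fun A hA => ?_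
  calc T.slice l (T.measure.withDensity g) A ≤ C * T.slice l T.measure A := by
        rw [slice_apply hA, slice_apply hA]
        exact h1 _
    _ ≤ _ := by
        rw [slice_measure, Measure.smul_apply, Measure.smul_apply, smul_eq_mul, smul_eq_mul]
        gcongr
        exact mul_le_of_le_one_left zero_le (ENNReal.inv_le_one.2 one_le_ofReal_meanReturn)

/-- Adding `2 * M` puts the density between `M` and `3 * M`, so the additive Hölder bound `M * D` is
at most `D` times the density and becomes multiplicative with a constant `R' ≥ 1`. The zero mean
gives the two measures equal mass, and by duality set integrals of iterates of the transfer operator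
are differences of masses of preimages. The factor `6` is the bound `3 * M` on the densities,
doubled by splitting into positive and negative parts. -/
theorem cycleDecay_le {d : ℕ} {R R' : ℝ} {t H G : ℕ → ℝ}
    (hd : 1 ≤ d) (hR : 1 ≤ R') (hK : K + lam ^ (-η) * R' ≤ R) (ht : Summable t)
    (hτ : ∀ n : ℕ, m.real {y | n < T.τ y} ≤ t n) (hH : Antitone H)
    (hc : ∀ N, T.IsCoupled d R N (H N)) (hG : IsConvolvedRate (fun i => ∑' l, t (l + i)) H G)
    (hφ : AEStronglyMeasurable φ T.measure) (hφM : T.holderNorm φ ≤ ENNReal.ofReal M) (hM : 0 < M)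
    (hφ0 : ∫ x, φ x ∂T.measure = 0) (n : ℕ) :
    T.cycleDecay d φ n ≤ 6 * d * M * G (n * d) := by
  have hb := abs_le_of_holderNorm_le hM.le hφM
  have hint : Integrable φ T.measure :=
    (integrable_const M).mono' hφ (.of_forall fun x => by simpa using hb x)
  set g : T.Space → ℝ≥0∞ := fun x => ENNReal.ofReal (hφ.mk φ x + 2 * M) with hg
  have hgm : Measurable g := (hφ.stronglyMeasurable_mk.measurable.add_const _).ennreal_ofReal
  have hgφ : ∀ᵐ x ∂T.measure, g x = ENNReal.ofReal (φ x + 2 * M) := by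
    filter_upwards [hφ.ae_eq_mk] with x hx
    rw [hg, hx]
  set ν := T.measure.withDensity g with hν
  set ν' := T.measure.withDensity fun _ => ENNReal.ofReal (2 * M) with hν'
  have hνfin : ∀ E, MeasurableSet E →
      ν E = ENNReal.ofReal (∫ x in E, (φ x + 2 * M) ∂T.measure) := by
    intro E hE
    rw [hν, withDensity_apply _ hE, ofReal_integral_eq_lintegral_ofReal
      (f := fun x => φ x + 2 * M) (hint.add (integrable_const (2 * M))).integrableOn
      (.of_forall fun x => by have := (abs_le.1 (hb x)).1; simp only [Pi.zero_apply]; linarith)]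
    exact lintegral_congr_ae (ae_restrict_of_ae hgφ)
  have hνreal : ∀ E, MeasurableSet E → ν.real E = ∫ x in E, φ x ∂T.measure + ν'.real E := by
    intro E hE
    have h0 : 0 ≤ ∫ x in E, (φ x + 2 * M) ∂T.measure :=
      setIntegral_nonneg hE fun x _ => by have := (abs_le.1 (hb x)).1; linarith
    rw [measureReal_def, hνfin E hE, ENNReal.toReal_ofReal h0,
      integral_add hint.integrableOn (integrable_const _).integrableOn, hν', withDensity_const,
      measureReal_ennreal_smul_apply, ENNReal.toReal_ofReal (by positivity)]
    simp [mul_comm]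
  have hfin : IsFiniteMeasure ν := ⟨by rw [hνfin _ .univ]; exact ENNReal.ofReal_lt_top⟩
  have hfin' : IsFiniteMeasure ν' := by
    rw [hν', withDensity_const]; exact Measure.smul_finite _ ENNReal.ofReal_ne_top
  have hmass' : ν'.real univ = 2 * M := by
    rw [hν', withDensity_const, measureReal_ennreal_smul_apply,
      ENNReal.toReal_ofReal (by positivity)]
    simp
  have hmass : ν.real univ = 2 * M := by
    rw [hνreal _ .univ, hmass', Measure.restrict_univ, hφ0, zero_add]
  have hνr : ∀ l, RegularOn m η R' T.α (T.slice l ν) := by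
    refine regularOn_slice_withDensity hgm hgφ fun x y hxy => ?_
    have h1 := (abs_le.1 (abs_sub_le_of_holderNorm_le hM.le hφM hxy)).2
    have h2 := (abs_le.1 (hb y)).1
    set D := dist x.1.1 y.1.1 ^ η
    have hD : 0 ≤ D := Real.rpow_nonneg dist_nonneg _
    have h3 : D + 1 ≤ Real.exp (R' * D) :=
      le_trans (by nlinarith) (Real.add_one_le_exp (R' * D))
    have h4 := mul_le_mul_of_nonneg_right h3 (by linarith : 0 ≤ φ y + 2 * M)
    have h5 := mul_le_mul_of_nonneg_left (by linarith : M ≤ φ y + 2 * M) hD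
    linarith
  have hνr' : ∀ l, RegularOn m η R' T.α (T.slice l ν') := by
    refine regularOn_slice_withDensity (ψ := fun _ => 2 * M) measurable_const
      (.of_forall fun x => rfl) fun x y hxy => ?_
    set D := dist x.1.1 y.1.1 ^ η
    have hD : 0 ≤ D := Real.rpow_nonneg dist_nonneg _
    have h3 : 1 ≤ Real.exp (R' * D) := Real.one_le_exp (by positivity)
    nlinarith
  have hνC : ∀ l, T.slice l ν ≤ ENNReal.ofReal (3 * M) • m.restrict (T.τ ⁻¹' Ioi l) := by
    refine slice_withDensity_le ?_
    filter_upwards [hgφ] with x hx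
    rw [hx]
    have := (abs_le.1 (hb x)).2
    exact ENNReal.ofReal_le_ofReal (by linarith)
  have hνC' : ∀ l, T.slice l ν' ≤ ENNReal.ofReal (3 * M) • m.restrict (T.τ ⁻¹' Ioi l) :=
    slice_withDensity_le (.of_forall fun x => ENNReal.ofReal_le_ofReal (by linarith))
  have hsum : Integrable (fun x => ∑ k ∈ Finset.range d, (T.transfer^[n * d + k] φ) x)
      T.measure := integrable_finsetSum _ fun k _ => integrable_transfer_iterate hint _
  have hle := integral_abs_le_of_forall_setIntegral_le hsum (D := d * (3 * M * G (n * d)))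
    fun s hs => by
      rw [integral_finsetSum _ fun k _ => (integrable_transfer_iterate hint _).integrableOn]
      have e : ∀ k ∈ Finset.range d, ∫ x in s, (T.transfer^[n * d + k] φ) x ∂T.measure =
          ν.real (T.map^[n * d + k] ⁻¹' s) - ν'.real (T.map^[n * d + k] ⁻¹' s) := by
        intro k _
        rw [setIntegral_transfer_iterate hint _ hs, hνreal _ (T.measurable_iterate _ hs)]
        ring
      rw [Finset.sum_congr rfl e, Finset.sum_sub_distrib, abs_sub_le_iff]
      have h1 := sum_measure_iterate_le hd (by linarith) hK ht hτ hH hc hG (by positivity) hνr hνr'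
        hνC hνC' (by rw [hmass]; positivity) (by rw [hmass]; linarith) (by rw [hmass, hmass'])
        (n * d) hs
      have h2 := sum_measure_iterate_le hd (by linarith) hK ht hτ hH hc hG (by positivity) hνr' hνr
        hνC' hνC (by rw [hmass']; positivity) (by rw [hmass']; linarith) (by rw [hmass, hmass'])
        (n * d) hs
      constructor <;> linarith
  rw [cycleDecay]
  linarith

end observable

end YoungTower

/-! ### Polynomial solutions of the renewal inequality -/

open Filter Topology in
theorem exists_rpow_le_of_one_lt {c : ℝ} (hc : 1 < c) (b : ℝ) :
    ∃ ε : ℝ, 0 < ε ∧ ε ≤ 1 / 2 ∧ (1 - ε) ^ (-b) ≤ c := by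
  have h1 : Tendsto (fun ε : ℝ => (1 - ε) ^ (-b)) (𝓝[>] 0) (𝓝 ((1 - 0) ^ (-b))) := by
    refine Tendsto.mono_left ?_ nhdsWithin_le_nhds
    exact ((continuous_const.sub continuous_id).continuousAt.rpow_const (.inl (by norm_num)))
  rw [sub_zero, Real.one_rpow] at h1
  have h2 : ∀ᶠ ε : ℝ in 𝓝[>] 0, ε ≤ 1 / 2 :=
    (eventually_le_nhds (by norm_num : (0 : ℝ) < 1 / 2)).filter_mono nhdsWithin_le_nhds
  obtain ⟨ε, h, h', h''⟩ := ((h1.eventually_le_const hc).and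
    (h2.and self_mem_nhdsWithin)).exists
  exact ⟨ε, h'', h', h⟩

theorem IsRenewalRate.mono {ξ : ℝ} {N₀ : ℕ} {q q' H : ℕ → ℝ} (h : IsRenewalRate ξ N₀ q' H)
    (hq : ∀ i, q i ≤ q' i) : IsRenewalRate ξ N₀ q H := by
  refine ⟨h.1, fun N => (h.2 N).imp_right fun h2 p hp0 hp1 hp2 => ?_⟩
  have := h2 p hp0 hp1 fun i => (hp2 i).trans (by linarith [hq i])
  linarith [hq N]

theorem IsConvolvedRate.mono {q q' H G : ℕ → ℝ} (h : IsConvolvedRate q' H G)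
    (hq : ∀ i, q i ≤ q' i) : IsConvolvedRate q H G := by
  intro N p hp0 hp1 hp2
  have := h N p hp0 hp1 fun i => (hp2 i).trans (by linarith [hq i])
  linarith [hq N]

/-- The polynomial rate `min 1 (C (N + 1) ^ (-b))`. -/
noncomputable def polyRate (C b : ℝ) (N : ℕ) : ℝ := min 1 (C * ((N : ℝ) + 1) ^ (-b))

theorem polyRate_antitone {C b : ℝ} (hC : 0 ≤ C) (hb : 0 ≤ b) : Antitone (polyRate C b) := by
  intro N M h
  unfold polyRate
  refine min_le_min_left _ (mul_le_mul_of_nonneg_left ?_ hC)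
  exact Real.rpow_le_rpow_of_nonpos (by positivity) (by gcongr) (by linarith)

/-- Split at `k` near `ε * (N + 1)`. For smaller `k` the rate at `N - k` is at most `(1 - ε) ^ (-b)`
times `C * (N + 1) ^ (-b)`. For larger `k` it is bounded by `1` and the tail of `p` provides the
decay. Truncating the rate at `1` keeps `C` out of the second term, so a large `C` can dominate it.
-/
theorem sum_mul_polyRate_le {C q b b₂ ε W : ℝ} (hC : 0 ≤ C) (hq : 0 ≤ q) (hb : 0 < b)
    (hb₂ : b ≤ b₂) (hε0 : 0 < ε) (hε1 : ε ≤ 1 / 2) {N : ℕ} {p : ℕ → ℝ} (hp0 : ∀ k, 0 ≤ p k)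
    (hp1 : ∑ k ∈ Finset.Icc 1 N, p k ≤ W)
    (hp2 : ∀ i : ℕ, ∑ k ∈ Finset.Icc (i + 1) N, p k ≤ 2 * (q * ((i : ℝ) + 1) ^ (-b))) :
    ∑ k ∈ Finset.Icc 1 N, p k * polyRate C b (N - k) ≤
      (W * C * (1 - ε) ^ (-b₂) + 2 * q * ε ^ (-b₂)) * ((N : ℝ) + 1) ^ (-b) := by
  set X : ℝ := (N : ℝ) + 1 with hX
  have hX0 : 0 < X := by positivity
  have hXb : 0 < X ^ (-b) := Real.rpow_pos_of_pos hX0 _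
  set i := ⌊ε * X⌋₊ with hi
  have hpt : ∀ k ∈ Finset.Icc 1 N, p k * polyRate C b (N - k) ≤
      p k * (C * (1 - ε) ^ (-b₂) * X ^ (-b)) + if k ∈ Finset.Icc (i + 1) N then p k else 0 := by
    intro k hk
    rw [Finset.mem_Icc] at hk
    have h1ε : 0 < (1 - ε) ^ (-b₂) := Real.rpow_pos_of_pos (by linarith) _
    have h0 : 0 ≤ p k * (C * (1 - ε) ^ (-b₂) * X ^ (-b)) :=
      mul_nonneg (hp0 k) (by positivity)
    split_ifs with hki
    · have : p k * polyRate C b (N - k) ≤ p k * 1 :=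
        mul_le_mul_of_nonneg_left (min_le_left _ _) (hp0 k)
      linarith
    · rw [add_zero]
      refine mul_le_mul_of_nonneg_left ((min_le_right _ _).trans ?_) (hp0 k)
      rw [mul_assoc]
      refine mul_le_mul_of_nonneg_left ?_ hC
      have hki' : k ≤ i := by
        by_contra h
        exact hki (Finset.mem_Icc.2 ⟨by omega, hk.2⟩)
      have h2 : (k : ℝ) ≤ ε * X := (Nat.le_floor_iff (by positivity)).1 hki'
      rw [Nat.cast_sub hk.2]
      calc ((N : ℝ) - k + 1) ^ (-b) ≤ ((1 - ε) * X) ^ (-b) :=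
            Real.rpow_le_rpow_of_nonpos (mul_pos (by linarith) hX0) (by rw [hX] at h2 ⊢; linarith)
              (by linarith)
        _ = (1 - ε) ^ (-b) * X ^ (-b) := Real.mul_rpow (by linarith) hX0.le
        _ ≤ _ := by
            gcongr ?_ * _
            exact Real.rpow_le_rpow_of_exponent_ge (by linarith) (by linarith) (by linarith)
  have htail : ∑ k ∈ Finset.Icc (i + 1) N, p k ≤ 2 * q * ε ^ (-b₂) * X ^ (-b) := by
    refine (hp2 i).trans ?_
    have h1 : ((i : ℝ) + 1) ^ (-b) ≤ (ε * X) ^ (-b) :=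
      Real.rpow_le_rpow_of_nonpos (by positivity) (Nat.lt_floor_add_one _).le (by linarith)
    rw [Real.mul_rpow hε0.le hX0.le] at h1
    have h2 : ε ^ (-b) ≤ ε ^ (-b₂) :=
      Real.rpow_le_rpow_of_exponent_ge hε0 (by linarith) (by linarith)
    calc 2 * (q * ((i : ℝ) + 1) ^ (-b)) ≤ 2 * (q * (ε ^ (-b₂) * X ^ (-b))) := by
          gcongr; exact h1.trans (by gcongr)
      _ = _ := by ring
  calc _ ≤ ∑ k ∈ Finset.Icc 1 N, (p k * (C * (1 - ε) ^ (-b₂) * X ^ (-b)) +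
        if k ∈ Finset.Icc (i + 1) N then p k else 0) := Finset.sum_le_sum hpt
    _ = (∑ k ∈ Finset.Icc 1 N, p k) * (C * (1 - ε) ^ (-b₂) * X ^ (-b)) +
        ∑ k ∈ Finset.Icc (i + 1) N, p k := by
        rw [Finset.sum_add_distrib, ← Finset.sum_mul, Finset.sum_ite_mem,
          Finset.inter_eq_right.2 (Finset.Icc_subset_Icc (by omega) le_rfl)]
    _ ≤ W * (C * (1 - ε) ^ (-b₂) * X ^ (-b)) + 2 * q * ε ^ (-b₂) * X ^ (-b) := by
        have h1ε : 0 < (1 - ε) ^ (-b₂) := Real.rpow_pos_of_pos (by linarith) _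
        gcongr
    _ = _ := by ring

/-- The gain `ξ` is shared out: `ε` is so small that the early terms cost at most `1 - ξ / 2`, the
remaining terms fit into `ξ / 4` of `C`, and the delay `N₀` reduces the rate by a factor of at least
`1 - ξ / 4`. -/
theorem exists_isRenewalRate_polyRate {ξ q b₂ : ℝ} (hξ0 : 0 < ξ) (hξ1 : ξ < 1) (hq : 0 ≤ q)
    {N₀ : ℕ} (hN₀ : 1 ≤ N₀) (hb₂ : 0 < b₂) :
    ∃ C : ℝ, 1 ≤ C ∧ ∀ b, 0 < b → b ≤ b₂ →
      IsRenewalRate ξ N₀ (fun i => q * ((i : ℝ) + 1) ^ (-b)) (polyRate C b) := by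
  obtain ⟨ε, hε0, hε1, hε⟩ := exists_rpow_le_of_one_lt
    (show 1 < (1 - ξ / 2) / (1 - ξ) by rw [lt_div_iff₀ (by linarith)]; linarith) b₂
  obtain ⟨ω, hω0, hω1, hω⟩ := exists_rpow_le_of_one_lt
    (show 1 < (1 - ξ / 4)⁻¹ by rw [one_lt_inv₀ (by linarith)]; linarith) b₂
  have hN₀' : (1 : ℝ) ≤ N₀ := by exact_mod_cast hN₀
  set X₀ : ℝ := N₀ / ω with hX₀
  -- With `C ≥ C₁` the truncated rate is still `1` as long as `N + 1 ≤ X₀`. Beyond that, `N₀` is at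
  -- most the fraction `ω` of `N + 1`.
  set C₁ : ℝ := (X₀ + N₀) ^ b₂ with hC₁
  -- Solves `ξ / 4 * C₂ = 2 * q * ε ^ (-b₂) + 2 * q`, the total of the terms free of `C`.
  set C₂ : ℝ := 8 * q * (ε ^ (-b₂) + 1) / ξ with hC₂
  have hX₀0 : 0 < X₀ := by positivity
  have hεb : 0 < ε ^ (-b₂) := Real.rpow_pos_of_pos hε0 _
  have hC₁1 : 1 ≤ C₁ := Real.one_le_rpow (by linarith) hb₂.le
  have hC₂0 : 0 ≤ C₂ := by positivity
  refine ⟨C₁ + C₂, by linarith, fun b hb hbb => ⟨fun N hN => ?_, fun N => ?_⟩⟩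
  · refine le_min le_rfl ?_
    rw [Real.rpow_neg (by positivity), ← div_eq_mul_inv,
      one_le_div (Real.rpow_pos_of_pos (by positivity) _)]
    have hN' : (N : ℝ) + 1 ≤ N₀ := by exact_mod_cast hN
    calc ((N : ℝ) + 1) ^ b ≤ ((N : ℝ) + 1) ^ b₂ :=
          Real.rpow_le_rpow_of_exponent_le (by linarith [Nat.cast_nonneg (α := ℝ) N]) hbb
      _ ≤ C₁ := Real.rpow_le_rpow (by positivity) (by linarith) hb₂.le
      _ ≤ _ := by linarith
  · set C := C₁ + C₂ with hC
    set X : ℝ := (N : ℝ) + 1 with hX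
    have hX1 : 0 < X := by positivity
    by_cases h1 : 1 ≤ polyRate C b (N + N₀)
    · exact .inl h1
    right
    intro p hp0 hp1 hp2
    have hlt : C * (X + N₀) ^ (-b) < 1 := by
      by_contra h
      refine h1 (le_min le_rfl ?_)
      rw [not_lt] at h
      convert h using 3
      push_cast; ring
    have heq : polyRate C b (N + N₀) = C * (X + N₀) ^ (-b) := by
      rw [← min_eq_right hlt.le, polyRate]
      congr 3
      push_cast; ring
    have hXX : X₀ < X := by
      by_contra h
      rw [not_lt] at h
      rw [Real.rpow_neg (by positivity), ← div_eq_mul_inv,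
        div_lt_one (Real.rpow_pos_of_pos (by positivity) _)] at hlt
      have h2 : (X + N₀) ^ b ≤ C₁ :=
        (Real.rpow_le_rpow_of_exponent_le (by linarith) hbb).trans
          (Real.rpow_le_rpow (by positivity) (by linarith) hb₂.le)
      linarith
    have hshift : (1 - ξ / 4) * X ^ (-b) ≤ (X + N₀) ^ (-b) := by
      have h2 : X + N₀ ≤ X * (1 - ω)⁻¹ := by
        have h3 : (N₀ : ℝ) ≤ ω * X := by
          rw [hX₀, div_lt_iff₀ hω0] at hXX; linarith
        rw [← div_eq_mul_inv, le_div_iff₀ (by linarith)]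
        nlinarith
      calc (1 - ξ / 4) * X ^ (-b) ≤ ((1 - ω)⁻¹) ^ (-b) * X ^ (-b) := by
            gcongr ?_ * _
            rw [Real.inv_rpow (by linarith)]
            refine (le_inv_comm₀ (by linarith) (Real.rpow_pos_of_pos (by linarith) _)).2
              (le_trans ?_ hω)
            exact Real.rpow_le_rpow_of_exponent_ge (by linarith) (by linarith) (by linarith)
        _ = (X * (1 - ω)⁻¹) ^ (-b) := by
            rw [Real.mul_rpow hX1.le (inv_nonneg.2 (by linarith)), mul_comm]
        _ ≤ _ := Real.rpow_le_rpow_of_nonpos (by positivity) h2 (by linarith)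
    have hC0 : 0 ≤ C := by linarith
    have hsum := sum_mul_polyRate_le hC0 hq hb hbb hε0 hε1 hp0 hp1 hp2
    rw [heq]
    have hXb : 0 < X ^ (-b) := Real.rpow_pos_of_pos hX1 _
    have h3 : (1 - ξ) * C * (1 - ε) ^ (-b₂) ≤ C * (1 - ξ / 2) := by
      rw [le_div_iff₀ (by linarith)] at hε
      nlinarith
    have h4 : 2 * q * ε ^ (-b₂) + 2 * q ≤ ξ / 4 * C := by
      have : ξ / 4 * C₂ = 2 * q * ε ^ (-b₂) + 2 * q := by
        rw [hC₂]; field_simp; ring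
      nlinarith
    have h5 := mul_le_mul_of_nonneg_left hshift hC0
    have h6 : ((1 - ξ) * C * (1 - ε) ^ (-b₂) + 2 * q * ε ^ (-b₂) + 2 * q) * X ^ (-b) ≤
        (C * (1 - ξ / 4)) * X ^ (-b) := by gcongr; linarith
    linarith

theorem exists_isConvolvedRate_polyRate {C q b₂ : ℝ} (hC : 0 ≤ C) (hq : 0 ≤ q) :
    ∃ C' : ℝ, 0 ≤ C' ∧ ∀ b, 0 < b → b ≤ b₂ →
      IsConvolvedRate (fun i => q * ((i : ℝ) + 1) ^ (-b)) (polyRate C b)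
        (fun N => C' * ((N : ℝ) + 1) ^ (-b)) := by
  have h2 : (0 : ℝ) < (1 - 1 / 2 : ℝ) ^ (-b₂) := Real.rpow_pos_of_pos (by norm_num) _
  have h3 : (0 : ℝ) < (1 / 2 : ℝ) ^ (-b₂) := Real.rpow_pos_of_pos (by norm_num) _
  refine ⟨1 * C * (1 - 1 / 2) ^ (-b₂) + 2 * q * (1 / 2) ^ (-b₂) + 2 * q, by positivity,
    fun b hb hbb N p hp0 hp1 hp2 => ?_⟩
  have := sum_mul_polyRate_le hC hq hb hbb (by norm_num : (0 : ℝ) < 1 / 2) le_rfl hp0 hp1 hp2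
  simp only
  linarith

/-- A discrete derivative of `k ^ (-b)`, used to bound tail sums by telescoping with a constant
uniform in `b`. -/
theorem mul_rpow_le_sub {b k : ℝ} (hb : 0 < b) (hk : 1 ≤ k) :
    b / 2 ^ (b + 1) * k ^ (-(b + 1)) ≤ k ^ (-b) - (k + 1) ^ (-b) := by
  have hk0 : 0 < k := by linarith
  have h1 : (k + 1) ^ (-b) * (1 + b / (k + 1)) ≤ k ^ (-b) := by
    have h2 : 1 + b / (k + 1) ≤ ((k + 1) / k) ^ b := by
      rw [Real.rpow_def_of_pos (by positivity)]
      have h3 := Real.one_sub_inv_le_log_of_pos (show 0 < (k + 1) / k by positivity)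
      have h4 : 1 - ((k + 1) / k)⁻¹ = 1 / (k + 1) := by field_simp; ring
      rw [h4] at h3
      have h5 := Real.add_one_le_exp (Real.log ((k + 1) / k) * b)
      have h6 := mul_le_mul_of_nonneg_right h3 hb.le
      have h7 : 1 / (k + 1) * b = b / (k + 1) := by ring
      linarith
    calc _ ≤ (k + 1) ^ (-b) * ((k + 1) / k) ^ b := by gcongr
      _ = k ^ (-b) := by
        rw [Real.div_rpow (by positivity) hk0.le, Real.rpow_neg (by positivity),
          Real.rpow_neg hk0.le]
        have := Real.rpow_pos_of_pos (show 0 < k + 1 by positivity) b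
        field_simp
  have h8 : (2 * k) ^ (-(b + 1)) ≤ (k + 1) ^ (-(b + 1)) :=
    Real.rpow_le_rpow_of_nonpos (by positivity) (by linarith) (by linarith)
  have h9 : (k + 1) ^ (-(b + 1)) = (k + 1) ^ (-b) * (1 / (k + 1)) := by
    rw [neg_add, Real.rpow_add (by positivity), Real.rpow_neg_one, one_div]
  rw [Real.mul_rpow (by norm_num) hk0.le, h9, Real.rpow_neg (by norm_num)] at h8
  have h10 := mul_le_mul_of_nonneg_left h8 hb.le
  calc b / 2 ^ (b + 1) * k ^ (-(b + 1)) = b * ((2 ^ (b + 1))⁻¹ * k ^ (-(b + 1))) := by ring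
    _ ≤ b * ((k + 1) ^ (-b) * (1 / (k + 1))) := h10
    _ = (k + 1) ^ (-b) * (1 + b / (k + 1)) - (k + 1) ^ (-b) := by ring
    _ ≤ _ := by linarith

theorem summable_and_tsum_rpow_le {b b₁ b₂ : ℝ} (hb₁ : 0 < b₁) (hb : b₁ ≤ b) (hb₂ : b ≤ b₂)
    (i : ℕ) : (Summable fun l : ℕ => ((l : ℝ) + i + 1) ^ (-(b + 1))) ∧
      ∑' l : ℕ, ((l : ℝ) + i + 1) ^ (-(b + 1)) ≤ 2 ^ (b₂ + 1) / b₁ * ((i : ℝ) + 1) ^ (-b) := by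
  have hb0 : 0 < b := hb₁.trans_le hb
  have hsum : ∀ n : ℕ, ∑ l ∈ Finset.range n, ((l : ℝ) + i + 1) ^ (-(b + 1)) ≤
      2 ^ (b₂ + 1) / b₁ * ((i : ℝ) + 1) ^ (-b) := by
    intro n
    have h1 : ∀ l ∈ Finset.range n, ((l : ℝ) + i + 1) ^ (-(b + 1)) ≤ 2 ^ (b₂ + 1) / b₁ *
        (((l : ℝ) + i + 1) ^ (-b) - (((l + 1 : ℕ) : ℝ) + i + 1) ^ (-b)) := by
      intro l _
      have hk : (1 : ℝ) ≤ (l : ℝ) + i + 1 := by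
        have : (0 : ℝ) ≤ (l : ℝ) + i := by positivity
        linarith
      have h2 := mul_rpow_le_sub hb0 hk
      have h3 : b₁ / 2 ^ (b₂ + 1) ≤ b / 2 ^ (b + 1) := by
        gcongr; norm_num
      have h4 : 0 < ((l : ℝ) + i + 1) ^ (-(b + 1)) := Real.rpow_pos_of_pos (by positivity) _
      have h5 := (mul_le_mul_of_nonneg_right h3 h4.le).trans h2
      push_cast
      rw [show (l : ℝ) + 1 + i + 1 = l + i + 1 + 1 by ring]
      have h6 : (0 : ℝ) < 2 ^ (b₂ + 1) := by positivity
      calc _ = 2 ^ (b₂ + 1) / b₁ * (b₁ / 2 ^ (b₂ + 1) * ((l : ℝ) + i + 1) ^ (-(b + 1))) := by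
            field_simp
        _ ≤ _ := by gcongr
    refine (Finset.sum_le_sum h1).trans ?_
    rw [← Finset.mul_sum, Finset.sum_range_sub' (fun l : ℕ => ((l : ℝ) + i + 1) ^ (-b))]
    have h7 : 0 < ((n : ℝ) + i + 1) ^ (-b) := Real.rpow_pos_of_pos (by positivity) _
    gcongr
    simp only [Nat.cast_zero, zero_add]
    linarith
  have h0 : ∀ l : ℕ, 0 ≤ ((l : ℝ) + i + 1) ^ (-(b + 1)) := fun l =>
    Real.rpow_nonneg (by positivity) _
  exact ⟨summable_of_sum_range_le h0 hsum, Real.tsum_le_of_sum_range_le h0 hsum⟩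

/-! ### Stretched exponential solutions of the renewal inequality -/

/-- The term of order `j` of the exponential series, with `j * γ ≥ 2`, gives a comparison with `1 /
n ^ 2`. -/
theorem summable_exp_neg_mul_rpow {c γ : ℝ} (hc : 0 < c) (hγ : 0 < γ) :
    Summable fun n : ℕ => Real.exp (-c * (n : ℝ) ^ γ) := by
  obtain ⟨j, hj⟩ := exists_nat_ge (2 / γ)
  rw [div_le_iff₀ hγ] at hj
  rw [← summable_nat_add_iff 1]
  have h1 : Summable fun n : ℕ => (j.factorial / c ^ j) * (1 / ((n + 1 : ℕ) : ℝ) ^ 2) :=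
    (((summable_nat_add_iff 1).2 (Real.summable_one_div_nat_pow.2 one_lt_two))).mul_left _
  refine h1.of_nonneg_of_le (fun n => (Real.exp_pos _).le) fun n => ?_
  set x : ℝ := ((n + 1 : ℕ) : ℝ) with hx
  have hx1 : 1 ≤ x := by rw [hx]; exact_mod_cast Nat.le_add_left 1 n
  have hx0 : 0 < x := by linarith
  have h2 := Real.pow_div_factorial_le_exp (c * x ^ γ) (by positivity) j
  have h3 : x ^ 2 ≤ (x ^ γ) ^ j := by
    rw [← Real.rpow_natCast (x ^ γ), ← Real.rpow_mul hx0.le, ← Real.rpow_natCast x 2]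
    exact Real.rpow_le_rpow_of_exponent_le hx1 (by push_cast; linarith)
  rw [mul_pow] at h2
  have hf : (0 : ℝ) < j.factorial := by exact_mod_cast j.factorial_pos
  have h4 : c ^ j * x ^ 2 / j.factorial ≤ Real.exp (c * x ^ γ) := le_trans (by gcongr) h2
  rw [neg_mul, Real.exp_neg]
  calc (Real.exp (c * x ^ γ))⁻¹ ≤ (c ^ j * x ^ 2 / j.factorial)⁻¹ := by gcongr
    _ = _ := by field_simp

/-- Since `(l + i + 1) ^ γ` dominates both `(l + 1) ^ γ₁` and `(i + 1) ^ γ`, half of `A₁` pays for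
summability in `l` and the other half keeps the decay in `i`. -/
theorem tsum_exp_neg_mul_rpow_le {A A₁ γ γ₁ : ℝ} (hA₁ : 0 < A₁) (hA : A₁ ≤ A) (hγ₁ : 0 < γ₁)
    (hγ : γ₁ ≤ γ) (i : ℕ) :
    ∑' l : ℕ, Real.exp (-A * ((l : ℝ) + i + 1) ^ γ) ≤
      (∑' l : ℕ, Real.exp (-(A₁ / 2) * ((l + 1 : ℕ) : ℝ) ^ γ₁)) *
        Real.exp (-(A₁ / 2) * ((i : ℝ) + 1) ^ γ) := by
  rw [← tsum_mul_right]
  have hs := ((summable_nat_add_iff 1).2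
    (summable_exp_neg_mul_rpow (half_pos hA₁) hγ₁)).mul_right
      (Real.exp (-(A₁ / 2) * ((i : ℝ) + 1) ^ γ))
  refine Real.tsum_le_of_sum_range_le (fun _ => (Real.exp_pos _).le) fun n => ?_
  refine (Finset.sum_le_sum fun l _ => ?_).trans
    (hs.sum_le_tsum (Finset.range n) fun _ _ => by positivity)
  rw [← Real.exp_add, Real.exp_le_exp]
  have h1 : ((l + 1 : ℕ) : ℝ) ^ γ₁ ≤ ((l : ℝ) + i + 1) ^ γ := by
    push_cast
    refine (Real.rpow_le_rpow_of_exponent_le (by linarith [Nat.cast_nonneg (α := ℝ) l]) hγ).trans ?_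
    exact Real.rpow_le_rpow (by positivity) (by linarith [Nat.cast_nonneg (α := ℝ) i])
      (by linarith)
  have h2 : ((i : ℝ) + 1) ^ γ ≤ ((l : ℝ) + i + 1) ^ γ :=
    Real.rpow_le_rpow (by positivity) (by linarith [Nat.cast_nonneg (α := ℝ) l]) (by linarith)
  have h3 : 0 ≤ ((l : ℝ) + i + 1) ^ γ := Real.rpow_nonneg (by positivity) _
  nlinarith

/-- The stretched exponential rate `C exp (-B N ^ γ)`. -/
noncomputable def expRate (B C γ : ℝ) (N : ℕ) : ℝ := C * Real.exp (-B * (N : ℝ) ^ γ)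

theorem expRate_antitone {B C γ : ℝ} (hB : 0 ≤ B) (hC : 0 ≤ C) (hγ : 0 ≤ γ) :
    Antitone (expRate B C γ) := by
  intro N M h
  unfold expRate
  have : (N : ℝ) ^ γ ≤ (M : ℝ) ^ γ := Real.rpow_le_rpow (by positivity) (by exact_mod_cast h) hγ
  gcongr ?_ * Real.exp ?_
  nlinarith

-- For small `B` the exponential moment of `p` barely exceeds its mass: below a cutoff `Q` the
-- exponential is at most `1 + ω`, and beyond it the tail bound beats the exponential. Both choices
-- are uniform in `γ`.
open Filter Topology in
theorem exists_sum_mul_exp_le {q a γ₁ ω : ℝ} (hq : 0 ≤ q) (ha : 0 < a) (hγ₁ : 0 < γ₁)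
    (hω : 0 < ω) (N₀ : ℕ) : ∃ B : ℝ, 0 < B ∧ B ≤ a ∧ 1 - ω ≤ Real.exp (-B * N₀) ∧
      ∀ γ, γ₁ ≤ γ → γ ≤ 1 → ∀ (N : ℕ) (p : ℕ → ℝ), (∀ k, 0 ≤ p k) →
        ∑ k ∈ Finset.Icc 1 N, p k ≤ 1 →
        (∀ i : ℕ, ∑ k ∈ Finset.Icc (i + 1) N, p k ≤
          2 * (q * Real.exp (-a * ((i : ℝ) + 1) ^ γ))) →
        ∑ k ∈ Finset.Icc 1 N, p k * Real.exp (B * (k : ℝ) ^ γ) ≤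
          ∑ k ∈ Finset.Icc 1 N, p k + 2 * ω := by
  set f : ℕ → ℝ := fun n => 2 * q * Real.exp (-(a / 2) * (n : ℝ) ^ γ₁) with hf
  have hfs : Summable f := (summable_exp_neg_mul_rpow (half_pos ha) hγ₁).mul_left _
  have hf0 : ∀ n, 0 ≤ f n := fun n => by positivity
  obtain ⟨Q, hQ⟩ : ∃ Q, ∑' l, f (l + Q) ≤ ω :=
    ((tendsto_sum_nat_add f).eventually_le_const hω).exists
  obtain ⟨B, hB0, hBa, hBQ, hBN⟩ : ∃ B : ℝ, 0 < B ∧ B ≤ a / 2 ∧ Real.exp (B * Q) - 1 ≤ ω ∧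
      1 - ω ≤ Real.exp (-B * N₀) := by
    have h1 : Tendsto (fun B : ℝ => Real.exp (B * Q) - 1) (𝓝[>] 0) (𝓝 (Real.exp (0 * Q) - 1)) :=
      (Continuous.tendsto (by fun_prop) 0).mono_left nhdsWithin_le_nhds
    have h2 : Tendsto (fun B : ℝ => Real.exp (-B * N₀)) (𝓝[>] 0) (𝓝 (Real.exp (-0 * N₀))) :=
      (Continuous.tendsto (by fun_prop) 0).mono_left nhdsWithin_le_nhds
    have h3 : ∀ᶠ B : ℝ in 𝓝[>] 0, B ≤ a / 2 :=
      (eventually_le_nhds (half_pos ha)).filter_mono nhdsWithin_le_nhds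
    simp only [zero_mul, Real.exp_zero, sub_self, neg_zero] at h1 h2
    obtain ⟨B, h, h', h'', h'''⟩ := ((h1.eventually_le_const hω).and
      ((h2.eventually_const_le (by linarith : 1 - ω < 1)).and (h3.and self_mem_nhdsWithin))).exists
    exact ⟨B, h''', h'', h, h'⟩
  refine ⟨B, hB0, by linarith, hBN, fun γ hγ hγ1 N p hp0 hp1 hp2 => ?_⟩
  -- The upper end `N + 1 + Q` makes the shifted interval a range of length `N + 1` even when `Q >
  -- N`.
  have hpt : ∀ k ∈ Finset.Icc 1 N, p k * Real.exp (B * (k : ℝ) ^ γ) ≤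
      p k + ω * p k + if k ∈ Finset.Ico Q (N + 1 + Q) then f k else 0 := by
    intro k hk
    rw [Finset.mem_Icc] at hk
    have hk1 : (1 : ℝ) ≤ k := by exact_mod_cast hk.1
    split_ifs with h
    · have h1 : p k ≤ 2 * (q * Real.exp (-a * (k : ℝ) ^ γ)) := by
        obtain ⟨i, rfl⟩ : ∃ i, k = i + 1 := ⟨k - 1, by omega⟩
        have h2 := hp2 i
        push_cast
        exact (Finset.single_le_sum (fun k _ => hp0 k)
          (Finset.mem_Icc.2 ⟨le_rfl, hk.2⟩)).trans h2
      have h2 : (k : ℝ) ^ γ₁ ≤ (k : ℝ) ^ γ := Real.rpow_le_rpow_of_exponent_le hk1 hγ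
      have h3 : 0 ≤ (k : ℝ) ^ γ := by positivity
      have h4 : p k * Real.exp (B * (k : ℝ) ^ γ) ≤ f k := by
        calc _ ≤ 2 * (q * Real.exp (-a * (k : ℝ) ^ γ)) * Real.exp (B * (k : ℝ) ^ γ) := by gcongr
          _ = 2 * q * Real.exp (-a * (k : ℝ) ^ γ + B * (k : ℝ) ^ γ) := by
            rw [Real.exp_add]; ring
          _ ≤ 2 * q * Real.exp (-(a / 2) * (k : ℝ) ^ γ₁) := by
            gcongr
            nlinarith
      have h5 := mul_nonneg hω.le (hp0 k)
      linarith [hp0 k]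
    · have hkQ : k < Q := by
        by_contra hkQ
        exact h (Finset.mem_Ico.2 ⟨by omega, by omega⟩)
      have h1 : (k : ℝ) ^ γ ≤ Q := by
        calc (k : ℝ) ^ γ ≤ (k : ℝ) ^ (1 : ℝ) := Real.rpow_le_rpow_of_exponent_le hk1 hγ1
          _ = k := Real.rpow_one _
          _ ≤ Q := by exact_mod_cast hkQ.le
      have h2 : Real.exp (B * (k : ℝ) ^ γ) ≤ 1 + ω :=
        (Real.exp_le_exp.2 (mul_le_mul_of_nonneg_left h1 hB0.le)).trans (by linarith)
      have h3 := mul_le_mul_of_nonneg_left h2 (hp0 k)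
      linarith
  refine (Finset.sum_le_sum hpt).trans ?_
  rw [Finset.sum_add_distrib, Finset.sum_add_distrib, ← Finset.mul_sum, Finset.sum_ite_mem]
  have h1 : ∑ k ∈ Finset.Icc 1 N ∩ Finset.Ico Q (N + 1 + Q), f k ≤ ω := by
    refine (Finset.sum_le_sum_of_subset_of_nonneg Finset.inter_subset_right
      fun k _ _ => hf0 k).trans ?_
    rw [Finset.sum_Ico_eq_sum_range, Nat.add_sub_cancel]
    refine le_trans ?_ hQ
    simp only [add_comm Q]
    exact ((summable_nat_add_iff Q).2 hfs).sum_le_tsum _ fun _ _ => hf0 _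
  have h2 : ω * ∑ k ∈ Finset.Icc 1 N, p k ≤ ω * 1 := mul_le_mul_of_nonneg_left hp1 hω.le
  linarith

/-- For `γ ≤ 1` the power `x ^ γ` is subadditive, so the convolution reduces to an exponential
moment of `p`. -/
theorem sum_mul_expRate_le {B C γ : ℝ} (hB : 0 ≤ B) (hC : 0 ≤ C) (hγ0 : 0 < γ) (hγ1 : γ ≤ 1)
    {N : ℕ} {p : ℕ → ℝ} (hp0 : ∀ k, 0 ≤ p k) :
    ∑ k ∈ Finset.Icc 1 N, p k * expRate B C γ (N - k) ≤
      C * Real.exp (-B * (N : ℝ) ^ γ) *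
        ∑ k ∈ Finset.Icc 1 N, p k * Real.exp (B * (k : ℝ) ^ γ) := by
  rw [Finset.mul_sum]
  refine Finset.sum_le_sum fun k hk => ?_
  rw [Finset.mem_Icc] at hk
  unfold expRate
  have h1 : (N : ℝ) ^ γ ≤ ((N - k : ℕ) : ℝ) ^ γ + (k : ℝ) ^ γ := by
    have := Real.rpow_add_le_add_rpow (Nat.cast_nonneg (α := ℝ) (N - k))
      (Nat.cast_nonneg (α := ℝ) k) hγ0.le hγ1
    rwa [← Nat.cast_add, Nat.sub_add_cancel hk.2] at this
  calc p k * (C * Real.exp (-B * ((N - k : ℕ) : ℝ) ^ γ))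
      ≤ p k * (C * Real.exp (-B * (N : ℝ) ^ γ + B * (k : ℝ) ^ γ)) := by
        have := hp0 k
        gcongr
        nlinarith
    _ = _ := by rw [Real.exp_add]; ring

/-- With `ω = ξ / 4` the moment of a law of mass at most `1 - ξ` is at most `1 - ξ / 2`. The forcing
term takes up at most `ξ / 4` of `C`, and the delay `N₀` costs a factor of at least `1 - ξ / 4`. -/
theorem exists_isRenewalRate_expRate {ξ q a γ₁ : ℝ} (hξ0 : 0 < ξ) (hξ1 : ξ < 1) (hq : 0 ≤ q)
    (ha : 0 < a) (hγ₁ : 0 < γ₁) (N₀ : ℕ) : ∃ B C C' : ℝ, 0 < B ∧ 0 ≤ C ∧ 0 ≤ C' ∧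
      ∀ γ, γ₁ ≤ γ → γ ≤ 1 →
        IsRenewalRate ξ N₀ (fun i => q * Real.exp (-a * ((i : ℝ) + 1) ^ γ)) (expRate B C γ) ∧
        IsConvolvedRate (fun i => q * Real.exp (-a * ((i : ℝ) + 1) ^ γ)) (expRate B C γ)
          (expRate B C' γ) := by
  obtain ⟨B, hB0, hBa, hBN, hB⟩ := exists_sum_mul_exp_le hq ha hγ₁
    (by positivity : 0 < ξ / 4) N₀
  -- The `2` makes the rate at least `1` before time `N₀`, and `8 * q / ξ` absorbs the forcing term
  -- `2 * q`.
  set C : ℝ := 2 + 8 * q / ξ with hC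
  have hC0 : 0 ≤ C := by positivity
  have hCq : 2 * q ≤ ξ / 4 * C := by
    have : ξ / 4 * (8 * q / ξ) = 2 * q := by field_simp; ring
    rw [hC, mul_add, this]; linarith
  have hqN : ∀ γ, γ₁ ≤ γ → ∀ N : ℕ, Real.exp (-a * ((N : ℝ) + 1) ^ γ) ≤
      Real.exp (-B * (N : ℝ) ^ γ) := by
    intro γ hγ N
    have h1 : (N : ℝ) ^ γ ≤ ((N : ℝ) + 1) ^ γ :=
      Real.rpow_le_rpow (by positivity) (by linarith) (by linarith)
    have h2 : (0 : ℝ) ≤ (N : ℝ) ^ γ := by positivity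
    rw [Real.exp_le_exp]
    nlinarith
  refine ⟨B, C, 2 * C + 2 * q, hB0, hC0, by positivity, fun γ hγ hγ1 => ⟨⟨fun N hN => ?_,
    fun N => .inr fun p hp0 hp1 hp2 => ?_⟩, fun N p hp0 hp1 hp2 => ?_⟩⟩
  · have h1 : (N : ℝ) ^ γ ≤ N₀ := by
      rcases Nat.eq_zero_or_pos N with rfl | hN0
      · rw [Nat.cast_zero, Real.zero_rpow (by linarith)]; positivity
      · calc (N : ℝ) ^ γ ≤ (N : ℝ) ^ (1 : ℝ) :=
              Real.rpow_le_rpow_of_exponent_le (by exact_mod_cast hN0) hγ1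
          _ = N := Real.rpow_one _
          _ ≤ N₀ := by exact_mod_cast hN.le
    have h2 : Real.exp (-B * N₀) ≤ Real.exp (-B * (N : ℝ) ^ γ) := by
      rw [Real.exp_le_exp]; nlinarith
    have h3 : (2 : ℝ) ≤ C := by rw [hC]; linarith [show 0 ≤ 8 * q / ξ by positivity]
    unfold expRate
    nlinarith
  · have h1 := hB γ hγ hγ1 N p hp0 (by linarith) hp2
    have h2 := sum_mul_expRate_le hB0.le hC0 (by linarith) hγ1 (N := N) hp0
    have h3 := hqN γ hγ N
    have h4 : Real.exp (-B * (N : ℝ) ^ γ) * Real.exp (-B * N₀) ≤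
        Real.exp (-B * ((N + N₀ : ℕ) : ℝ) ^ γ) := by
      rw [← Real.exp_add, Real.exp_le_exp]
      have h5 := Real.rpow_add_le_add_rpow (Nat.cast_nonneg (α := ℝ) N)
        (Nat.cast_nonneg (α := ℝ) N₀) (by linarith : 0 ≤ γ) hγ1
      have h6 : (N₀ : ℝ) ^ γ ≤ N₀ := by
        rcases Nat.eq_zero_or_pos N₀ with rfl | hN0
        · rw [Nat.cast_zero, Real.zero_rpow (by linarith)]
        · calc (N₀ : ℝ) ^ γ ≤ (N₀ : ℝ) ^ (1 : ℝ) :=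
                Real.rpow_le_rpow_of_exponent_le (by exact_mod_cast hN0) hγ1
            _ = N₀ := Real.rpow_one _
      push_cast
      nlinarith
    set E := Real.exp (-B * (N : ℝ) ^ γ) with hE
    have hE0 : 0 < E := Real.exp_pos _
    have h7 : C * E * ∑ k ∈ Finset.Icc 1 N, p k * Real.exp (B * (k : ℝ) ^ γ) ≤
        C * E * (1 - ξ / 2) := by gcongr; linarith
    have h8 : C * (E * (1 - ξ / 4)) ≤ expRate B C γ (N + N₀) := by
      unfold expRate
      gcongr
      exact le_trans (by gcongr) h4
    have h9 : q * Real.exp (-a * ((N : ℝ) + 1) ^ γ) ≤ q * E := by gcongr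
    have h10 := mul_le_mul_of_nonneg_right hCq hE0.le
    simp only
    linarith
  · have h1 := hB γ hγ hγ1 N p hp0 hp1 hp2
    have h2 := sum_mul_expRate_le hB0.le hC0 (by linarith) hγ1 (N := N) hp0
    have h3 := hqN γ hγ N
    set E := Real.exp (-B * (N : ℝ) ^ γ) with hE
    have hE0 : 0 < E := Real.exp_pos _
    have h7 : C * E * ∑ k ∈ Finset.Icc 1 N, p k * Real.exp (B * (k : ℝ) ^ γ) ≤
        C * E * 2 := by gcongr; linarith
    have h9 : q * Real.exp (-a * ((N : ℝ) + 1) ^ γ) ≤ q * E := by gcongr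
    unfold expRate at h2 ⊢
    simp only
    linarith

/-! ### Uniform constants and their continuous dependence on the parameters -/

open Topology in
/-- A convex-set-valued map which locally admits constant selections has a continuous selection. -/
theorem exists_continuousOn_forall_mem {X E : Type*} [MetricSpace X] [NormedAddCommGroup E]
    [NormedSpace ℝ E] {D : Set X} {s : X → Set E} (e : E) (hs : ∀ x ∈ D, Convex ℝ (s x))
    (h : ∀ x ∈ D, ∃ c, ∀ᶠ y in 𝓝 x, y ∈ D → c ∈ s y) :
    ∃ f : X → E, ContinuousOn f D ∧ (∀ x ∈ D, f x ∈ s x) ∧ ∀ x ∉ D, f x = e := by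
  classical
  obtain ⟨g, hg⟩ := exists_continuous_forall_mem_convex_of_local_const (X := D)
    (t := fun x => s x.1) (fun x => hs x.1 x.2) fun x => by
      obtain ⟨c, hc⟩ := h x.1 x.2
      refine ⟨c, ?_⟩
      filter_upwards [continuous_subtype_val.continuousAt.eventually hc] with y hy using hy y.2
  refine ⟨fun x => if hx : x ∈ D then g ⟨x, hx⟩ else e, ?_, fun x hx => ?_, fun x hx => dif_neg hx⟩
  · rw [continuousOn_iff_continuous_domRestrict]
    convert g.continuous using 1
    ext x
    simp
  · simp only [dif_pos hx]
    exact hg ⟨x, hx⟩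

namespace YoungTower

/-- The decay of `cycleDecay` is governed by any rate compatible with the renewal inequality; the
constants are uniform over all towers with controlled geometry and controlled tails. -/
theorem exists_cycleDecay_le {θ K₁ δ₀ : ℝ} (hθ0 : 0 < θ) (hθ1 : θ < 1) (hK₁ : 0 < K₁)
    (hδ₀ : 0 < δ₀) (N : ℕ) {t₀ : ℕ → ℝ} (ht₀ : Summable t₀) :
    ∃ (ξ : ℝ) (N₀ : ℕ) (C₀ : ℝ), 0 < ξ ∧ ξ < 1 ∧ 1 ≤ N₀ ∧ 0 < C₀ ∧
      ∀ {Y : Type u} [MeasurableSpace Y] [MetricSpace Y] {m : Measure Y} [IsProbabilityMeasure m]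
        {lam K η : ℝ} {T : YoungTower m lam K η} {d : ℕ} {I : Finset ℕ} {δ : ℝ},
        T.IsNonmixing d I δ → δ₀ ≤ δ → I.sup id ≤ N → lam ^ (-η) ≤ θ → K ≤ K₁ →
        ∀ t : ℕ → ℝ, Summable t → (∀ n, t n ≤ t₀ n) →
        (∀ n : ℕ, m.real {y | n < T.τ y} ≤ t n) → ∀ H G : ℕ → ℝ, Antitone H →
        IsRenewalRate ξ N₀ (fun i => C₀ * ∑' l, t (l + i)) H →
        IsConvolvedRate (fun i => ∑' l, t (l + i)) H G → (∀ n, 0 ≤ G n) →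
        ∀ φ : T.Space → ℝ, AEStronglyMeasurable φ T.measure → T.holderNorm φ < ∞ →
        ∫ x, φ x ∂T.measure = 0 → ∀ n : ℕ,
        T.cycleDecay d φ n ≤ 6 * N * (T.holderNorm φ).toReal * G (n * d) := by
  -- With `R' = R + 1 / θ` this choice solves `K₁ + θ * R' = R`. It also gives `R' ≥ 1`, as Hölder
  -- observables require.
  set R := (K₁ + 1) / (1 - θ) with hR
  have h1θ : 0 < 1 - θ := by linarith
  have hR0 : 0 ≤ R := by positivity
  set R' := R + 1 / θ with hR'
  have hRR : R < R' := by
    have : 0 < 1 / θ := by positivity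
    linarith
  have hR'1 : 1 ≤ R' := by
    have : 1 ≤ 1 / θ := by rw [le_div_iff₀ hθ0]; linarith
    linarith
  have hKR : K₁ + θ * R' = R := by
    rw [hR', hR]; field_simp; ring
  obtain ⟨N₀, c, hN₀, hc0, hdN₀, hc⟩ := exists_le_slice_zero_orbit.{u} hR0 hδ₀ N ht₀
  set κ := (R' - R) / (Real.exp R' - 1) * (Real.exp (-R) * c)
  have hκ : 0 < κ := by
    have h1 := Real.add_one_le_exp R'
    have h2 : 0 < (R' - R) / (Real.exp R' - 1) := div_pos (by linarith) (by linarith)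
    positivity
  refine ⟨min (1 / 2) κ, N₀, Real.exp R, by positivity,
    (min_le_left _ _).trans_lt (by norm_num), hN₀, Real.exp_pos _, ?_⟩
  intro Y _ _ m _ lam K η T d I δ hT hδ hI hlam hK t ht htt hτ H G hHa hH hG hG0 φ hφ hφM hφ0 n
  have hlam0 : 0 ≤ lam ^ (-η) := Real.rpow_nonneg (zero_lt_one.trans T.one_lt_lam).le _
  have hKR' : K + lam ^ (-η) * R' ≤ R := by
    rw [← hKR]
    gcongr
  have hKR0 : K + lam ^ (-η) * R ≤ R := le_trans (by gcongr) hKR'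
  have hd1 : 1 ≤ d := one_le_two.trans hT.two_le
  have hdN : d ≤ N := hT.le_sup.trans hI
  have hcoup := isCoupled (T := T) hT.ae_dvd hR0 hRR hKR' ht hτ hN₀ (hdN₀ d hd1 hdN)
    (fun ρ _ hρ n hn hdn => hc hT hδ hI hKR0 (fun n => (hτ n).trans (htt n)) ρ hρ n hn hdn)
    (by positivity) ((min_le_left _ _).trans_lt (by norm_num)) (min_le_right _ _) hH
  set M₀ := (T.holderNorm φ).toReal with hM₀
  -- Taking `M` strictly above the norm keeps it positive even when `φ = 0`. The norm itself is
  -- reached in the limit.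
  have key : ∀ M > M₀, T.cycleDecay d φ n ≤ 6 * d * M * G (n * d) := fun M hM =>
    cycleDecay_le hd1 hR'1 hKR' ht hτ hHa hcoup hG hφ
      (by rw [← ENNReal.ofReal_toReal hφM.ne]; exact ENNReal.ofReal_le_ofReal hM.le)
      (ENNReal.toReal_nonneg.trans_lt hM) hφ0 n
  have hlim : T.cycleDecay d φ n ≤ 6 * d * M₀ * G (n * d) := by
    refine ge_of_tendsto (x := nhdsWithin M₀ (Ioi M₀)) (f := fun M => 6 * d * M * G (n * d)) ?_
      (Filter.eventually_of_mem self_mem_nhdsWithin key)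
    exact (Continuous.tendsto (by fun_prop) M₀).mono_left nhdsWithin_le_nhds
  refine hlim.trans ?_
  have : 0 ≤ M₀ := ENNReal.toReal_nonneg
  have := hG0 (n * d)
  gcongr

/-- `C` is an admissible constant for polynomial decay. -/
def IsPolyConstant (lam K η : ℝ) (N : ℕ) (δ β Cτ C : ℝ) : Prop :=
  ∀ (Y : Type u) [MeasurableSpace Y] [MetricSpace Y] (m : Measure Y) [IsProbabilityMeasure m]
    (T : YoungTower m lam K η) (d : ℕ) (I : Finset ℕ), T.IsNonmixing d I δ → I.sup id = N →
    (∀ n : ℕ, 0 < n → m.real {y | n ≤ T.τ y} ≤ Cτ * (n : ℝ) ^ (-β)) →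
    ∀ φ : T.Space → ℝ, AEStronglyMeasurable φ T.measure → T.holderNorm φ < ∞ →
    ∫ x, φ x ∂T.measure = 0 → ∀ n : ℕ, 0 < n →
    T.cycleDecay d φ n ≤ C * (T.holderNorm φ).toReal * (n : ℝ) ^ (-(β - 1))

/-- `(B, C)` are admissible constants for stretched exponential decay. -/
def IsExpConstant (lam K η : ℝ) (N : ℕ) (δ A γ Cτ B C : ℝ) : Prop :=
  ∀ (Y : Type u) [MeasurableSpace Y] [MetricSpace Y] (m : Measure Y) [IsProbabilityMeasure m]
    (T : YoungTower m lam K η) (d : ℕ) (I : Finset ℕ), T.IsNonmixing d I δ → I.sup id = N →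
    (∀ n : ℕ, 0 < n → m.real {y | n ≤ T.τ y} ≤ Cτ * Real.exp (-A * (n : ℝ) ^ γ)) →
    ∀ φ : T.Space → ℝ, AEStronglyMeasurable φ T.measure → T.holderNorm φ < ∞ →
    ∫ x, φ x ∂T.measure = 0 → ∀ n : ℕ,
    T.cycleDecay d φ n ≤ C * (T.holderNorm φ).toReal * Real.exp (-B * (n : ℝ) ^ γ)

theorem rpow_neg_le_rpow_neg {lam lam₁ η η₁ : ℝ} (h1 : 1 < lam₁) (hl : lam₁ ≤ lam) (h0 : 0 < η₁)
    (hη : η₁ ≤ η) : lam ^ (-η) ≤ lam₁ ^ (-η₁) :=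
  (Real.rpow_le_rpow_of_nonpos (by linarith) hl (by linarith)).trans
    (Real.rpow_le_rpow_of_exponent_le h1.le (by linarith))

/-- One constant serves a whole box of parameters. This local uniformity is what the continuous
selection needs. -/
theorem exists_isPolyConstant {lam₁ K₁ η₁ δ₁ β₁ β₂ C₁ : ℝ} (N : ℕ) (hlam : 1 < lam₁) (hK : 0 < K₁)
    (hη : 0 < η₁) (hδ : 0 < δ₁) (hβ : 1 < β₁) (hC : 0 < C₁) :
    ∃ C : ℝ, 0 < C ∧ ∀ lam K η δ β Cτ : ℝ, lam₁ ≤ lam → K ≤ K₁ → η₁ ≤ η → δ₁ ≤ δ → β₁ ≤ β →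
      β ≤ β₂ → 0 ≤ Cτ → Cτ ≤ C₁ → IsPolyConstant.{u} lam K η N δ β Cτ C := by
  have hb₁ : 0 < β₁ - 1 := by linarith
  have hsum := fun (β : ℝ) (h₁ : β₁ ≤ β) (h₂ : β ≤ max β₁ β₂) (i : ℕ) =>
    summable_and_tsum_rpow_le (b := β - 1) (b₂ := max β₁ β₂ - 1) hb₁ (by linarith)
      (by linarith) i
  simp only [sub_add_cancel] at hsum
  have hs₀ : Summable fun n : ℕ => C₁ * ((n : ℝ) + 1) ^ (-β₁) := by
    have := (hsum β₁ le_rfl (le_max_left _ _) 0).1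
    simp only [Nat.cast_zero, add_zero] at this
    exact this.mul_left _
  obtain ⟨ξ, N₀, C₀, hξ0, hξ1, hN₀, hC₀, hmain⟩ := exists_cycleDecay_le.{u}
    (Real.rpow_pos_of_pos (by linarith : 0 < lam₁) (-η₁))
    (Real.rpow_lt_one_of_one_lt_of_neg hlam (by linarith)) hK hδ N hs₀
  set D : ℝ := 2 ^ max β₁ β₂ / (β₁ - 1)
  have hD : 0 < D := by positivity
  have hb₂ : 0 < max β₁ β₂ - 1 := by linarith [le_max_left β₁ β₂]
  obtain ⟨C, hC1, hren⟩ := exists_isRenewalRate_polyRate hξ0 hξ1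
    (by positivity : 0 ≤ C₀ * (C₁ * D)) hN₀ hb₂
  obtain ⟨C', hC'0, hconv⟩ := exists_isConvolvedRate_polyRate (C := C) (b₂ := max β₁ β₂ - 1)
    (by linarith) (by positivity : 0 ≤ C₁ * D)
  -- The `+ 1` keeps the constant positive even if `N` or `C'` vanishes.
  refine ⟨6 * N * C' + 1, by positivity, ?_⟩
  intro lam K η δ β Cτ h1 h2 h3 h4 h5 h6 h7 h8 Y _ _ m _ T d I hT hI hτ φ hφ hφM hφ0 n hn
  have h6' : β ≤ max β₁ β₂ := h6.trans (le_max_right _ _)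
  have hq : ∀ i : ℕ, ∑' l : ℕ, Cτ * (((l + i : ℕ) : ℝ) + 1) ^ (-β) ≤
      C₁ * D * ((i : ℝ) + 1) ^ (-(β - 1)) := by
    intro i
    have := (hsum β h5 h6' i).2
    rw [tsum_mul_left, mul_assoc]
    push_cast
    gcongr
  have hle := hmain hT h4 hI.le (rpow_neg_le_rpow_neg hlam h1 hη h3) h2
    (fun n => Cτ * ((n : ℝ) + 1) ^ (-β))
    (by
      have := (hsum β h5 h6' 0).1
      simp only [Nat.cast_zero, add_zero] at this
      exact this.mul_left _)
    (fun n => by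
      have h9 : ((n : ℝ) + 1) ^ (-β) ≤ ((n : ℝ) + 1) ^ (-β₁) :=
        Real.rpow_le_rpow_of_exponent_le (by linarith [Nat.cast_nonneg (α := ℝ) n]) (by linarith)
      have h10 : 0 ≤ ((n : ℝ) + 1) ^ (-β) := Real.rpow_nonneg (by positivity) _
      exact mul_le_mul h8 h9 h10 hC.le)
    (fun n => by exact_mod_cast hτ (n + 1) n.succ_pos)
    (polyRate C (β - 1)) (fun n => C' * ((n : ℝ) + 1) ^ (-(β - 1)))
    (polyRate_antitone (by linarith) (by linarith))
    ((hren (β - 1) (by linarith) (by linarith)).mono fun i => by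
      rw [mul_assoc]
      exact mul_le_mul_of_nonneg_left (hq i) hC₀.le)
    ((hconv (β - 1) (by linarith) (by linarith)).mono hq)
    (fun n => mul_nonneg hC'0 (Real.rpow_nonneg (by positivity) _)) φ hφ hφM hφ0 n
  have hd1 : 1 ≤ d := one_le_two.trans hT.two_le
  have hn0 : (0 : ℝ) < n := by exact_mod_cast hn
  have h11 : (((n * d : ℕ) : ℝ) + 1) ^ (-(β - 1)) ≤ (n : ℝ) ^ (-(β - 1)) := by
    refine Real.rpow_le_rpow_of_nonpos hn0 ?_ (by linarith)
    have : (n : ℝ) ≤ ((n * d : ℕ) : ℝ) := by exact_mod_cast Nat.le_mul_of_pos_right n hd1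
    linarith
  have h12 : 0 ≤ (n : ℝ) ^ (-(β - 1)) := Real.rpow_nonneg hn0.le _
  have h13 : 0 ≤ (T.holderNorm φ).toReal := ENNReal.toReal_nonneg
  calc T.cycleDecay d φ n
      ≤ 6 * N * (T.holderNorm φ).toReal * (C' * (((n * d : ℕ) : ℝ) + 1) ^ (-(β - 1))) := hle
    _ ≤ 6 * N * (T.holderNorm φ).toReal * (C' * (n : ℝ) ^ (-(β - 1))) := by gcongr
    _ ≤ _ := by nlinarith [mul_nonneg h13 h12]

theorem exists_isExpConstant {lam₁ K₁ η₁ δ₁ A₁ γ₁ C₁ : ℝ} (N : ℕ) (hlam : 1 < lam₁) (hK : 0 < K₁)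
    (hη : 0 < η₁) (hδ : 0 < δ₁) (hA : 0 < A₁) (hγ : 0 < γ₁) (hC : 0 < C₁) :
    ∃ B C : ℝ, 0 < B ∧ 0 < C ∧ ∀ lam K η δ A γ Cτ : ℝ, lam₁ ≤ lam → K ≤ K₁ → η₁ ≤ η → δ₁ ≤ δ →
      A₁ ≤ A → γ₁ ≤ γ → γ ≤ 1 → 0 ≤ Cτ → Cτ ≤ C₁ →
      IsExpConstant.{u} lam K η N δ A γ Cτ B C := by
  have hpoint : ∀ A γ : ℝ, A₁ ≤ A → γ₁ ≤ γ → ∀ n : ℕ,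
      Real.exp (-A * ((n : ℝ) + 1) ^ γ) ≤ Real.exp (-A₁ * ((n : ℝ) + 1) ^ γ₁) := by
    intro A γ hA' hγ' n
    have h9 : ((n : ℝ) + 1) ^ γ₁ ≤ ((n : ℝ) + 1) ^ γ :=
      Real.rpow_le_rpow_of_exponent_le (by linarith [Nat.cast_nonneg (α := ℝ) n]) hγ'
    have h10 : 0 ≤ ((n : ℝ) + 1) ^ γ₁ := Real.rpow_nonneg (by positivity) _
    rw [Real.exp_le_exp]
    nlinarith
  have hsm : Summable fun n : ℕ => Real.exp (-A₁ * ((n : ℝ) + 1) ^ γ₁) := by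
    exact_mod_cast (summable_nat_add_iff 1).2 (summable_exp_neg_mul_rpow hA hγ)
  have hs₀ : Summable fun n : ℕ => C₁ * Real.exp (-A₁ * ((n : ℝ) + 1) ^ γ₁) := hsm.mul_left _
  obtain ⟨ξ, N₀, C₀, hξ0, hξ1, hN₀, hC₀, hmain⟩ := exists_cycleDecay_le.{u}
    (Real.rpow_pos_of_pos (by linarith : 0 < lam₁) (-η₁))
    (Real.rpow_lt_one_of_one_lt_of_neg hlam (by linarith)) hK hδ N hs₀
  set D : ℝ := ∑' l : ℕ, Real.exp (-(A₁ / 2) * ((l + 1 : ℕ) : ℝ) ^ γ₁)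
  have hD : 0 ≤ D := tsum_nonneg fun _ => (Real.exp_pos _).le
  obtain ⟨B, C, C', hB, hC0, hC'0, hrate⟩ := exists_isRenewalRate_expRate hξ0 hξ1
    -- The factor `C₀ + 1` dominates both `C₀` and `1`, so one choice of `B` serves the renewal and
    -- the convolution inequalities.
    (by positivity : 0 ≤ (C₀ + 1) * (C₁ * D)) (half_pos hA) hγ N₀
  refine ⟨B, 6 * N * C' + 1, hB, by positivity, ?_⟩
  intro lam K η δ A γ Cτ h1 h2 h3 h4 h5 h6 h6' h7 h8 Y _ _ m _ T d I hT hI hτ φ hφ hφM hφ0 n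
  have hq : ∀ i : ℕ, ∑' l : ℕ, Cτ * Real.exp (-A * (((l + i : ℕ) : ℝ) + 1) ^ γ) ≤
      C₁ * D * Real.exp (-(A₁ / 2) * ((i : ℝ) + 1) ^ γ) := by
    intro i
    have := tsum_exp_neg_mul_rpow_le hA h5 hγ h6 i
    rw [tsum_mul_left, mul_assoc]
    push_cast
    gcongr
  have hle := hmain hT h4 hI.le (rpow_neg_le_rpow_neg hlam h1 hη h3) h2
    (fun n => Cτ * Real.exp (-A * ((n : ℝ) + 1) ^ γ))
    ((hsm.of_nonneg_of_le (fun _ => (Real.exp_pos _).le) (hpoint A γ h5 h6)).mul_left _)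
    (fun n => mul_le_mul h8 (hpoint A γ h5 h6 n) (Real.exp_pos _).le hC.le)
    (fun n => by exact_mod_cast hτ (n + 1) n.succ_pos)
    (expRate B C γ) (expRate B C' γ) (expRate_antitone hB.le hC0 (by linarith))
    ((hrate γ h6 h6').1.mono fun i => by
      have := mul_le_mul_of_nonneg_left (hq i) hC₀.le
      have h9 : 0 ≤ C₁ * D * Real.exp (-(A₁ / 2) * ((i : ℝ) + 1) ^ γ) := by positivity
      linarith)
    ((hrate γ h6 h6').2.mono fun i => by
      have := hq i
      have h9 : 0 ≤ C₁ * D * Real.exp (-(A₁ / 2) * ((i : ℝ) + 1) ^ γ) := by positivity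
      have h10 := mul_nonneg hC₀.le h9
      linarith)
    (fun n => mul_nonneg hC'0 (Real.exp_pos _).le) φ hφ hφM hφ0 n
  have hd1 : 1 ≤ d := one_le_two.trans hT.two_le
  have h11 : Real.exp (-B * ((n * d : ℕ) : ℝ) ^ γ) ≤ Real.exp (-B * (n : ℝ) ^ γ) := by
    have h12 : (n : ℝ) ≤ ((n * d : ℕ) : ℝ) := by exact_mod_cast Nat.le_mul_of_pos_right n hd1
    have h13 : (n : ℝ) ^ γ ≤ ((n * d : ℕ) : ℝ) ^ γ :=
      Real.rpow_le_rpow (by positivity) h12 (by linarith)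
    rw [Real.exp_le_exp]
    nlinarith
  have h13 : 0 ≤ (T.holderNorm φ).toReal := ENNReal.toReal_nonneg
  have h14 : 0 < Real.exp (-B * (n : ℝ) ^ γ) := Real.exp_pos _
  calc T.cycleDecay d φ n
      ≤ 6 * N * (T.holderNorm φ).toReal * (C' * Real.exp (-B * ((n * d : ℕ) : ℝ) ^ γ)) := hle
    _ ≤ 6 * N * (T.holderNorm φ).toReal * (C' * Real.exp (-B * (n : ℝ) ^ γ)) := by gcongr
    _ ≤ _ := by nlinarith [mul_nonneg h13 h14.le]

theorem convex_isPolyConstant (lam K η : ℝ) (N : ℕ) (δ β Cτ : ℝ) :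
    Convex ℝ {C : ℝ | 0 < C ∧ IsPolyConstant.{u} lam K η N δ β Cτ C} := by
  have h0 : Convex ℝ {C : ℝ | 0 < C} := convex_Ioi 0
  refine h0.inter ?_
  intro C hC C' hC' a b ha hb hab Y _ _ m _ T d I hT hI hτ φ hφ hφM hφ0 n hn
  have h1 := hC Y m T d I hT hI hτ φ hφ hφM hφ0 n hn
  have h2 := hC' Y m T d I hT hI hτ φ hφ hφM hφ0 n hn
  have h3 := mul_le_mul_of_nonneg_left h1 ha
  have h4 := mul_le_mul_of_nonneg_left h2 hb
  calc T.cycleDecay d φ n = a * T.cycleDecay d φ n + b * T.cycleDecay d φ n := by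
        rw [← add_mul, hab, one_mul]
    _ ≤ _ := by
        simp only [smul_eq_mul]
        linarith

theorem cycleDecay_nonneg {Y : Type u} [MeasurableSpace Y] [MetricSpace Y] {m : Measure Y}
    {lam K η : ℝ} (T : YoungTower m lam K η) (d : ℕ) (φ : T.Space → ℝ) (n : ℕ) :
    0 ≤ T.cycleDecay d φ n := integral_nonneg fun _ => abs_nonneg _

/-- Moving the exponential to the left makes the bound linear in `C` and convex in `B`, because
`cycleDecay` is nonnegative and `exp` is convex. -/
theorem convex_isExpConstant (lam K η : ℝ) (N : ℕ) (δ A γ Cτ : ℝ) :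
    Convex ℝ {x : ℝ × ℝ | (0 < x.1 ∧ 0 < x.2) ∧
      IsExpConstant.{u} lam K η N δ A γ Cτ x.1 x.2} := by
  have h0 : Convex ℝ {x : ℝ × ℝ | 0 < x.1 ∧ 0 < x.2} := by
    have h : Convex ℝ (Ioi (0 : ℝ)) := convex_Ioi 0
    exact h.prod h
  refine h0.inter ?_
  rintro ⟨B, C⟩ hC ⟨B', C'⟩ hC' a b ha hb hab Y _ _ m _ T d I hT hI hτ φ hφ hφM hφ0 n
  have h1 := hC Y m T d I hT hI hτ φ hφ hφM hφ0 n
  have h2 := hC' Y m T d I hT hI hτ φ hφ hφM hφ0 n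
  have hF := cycleDecay_nonneg T d φ n
  simp only [Prod.smul_mk, Prod.mk_add_mk, smul_eq_mul, neg_mul, Real.exp_neg] at h1 h2 ⊢
  set F := T.cycleDecay d φ n
  set x := (n : ℝ) ^ γ
  rw [← div_eq_mul_inv, le_div_iff₀ (Real.exp_pos _)] at h1 h2 ⊢
  have h3 : Real.exp ((a * B + b * B') * x) ≤ a * Real.exp (B * x) + b * Real.exp (B' * x) := by
    have := convexOn_exp.2 (mem_univ (B * x)) (mem_univ (B' * x)) ha hb hab
    simp only [smul_eq_mul] at this
    rwa [show (a * B + b * B') * x = a * (B * x) + b * (B' * x) by ring]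
  have h4 := mul_le_mul_of_nonneg_left h3 hF
  have h5 := mul_le_mul_of_nonneg_left h1 ha
  have h6 := mul_le_mul_of_nonneg_left h2 hb
  linarith

open Topology Filter in
theorem exists_continuousOn_isPolyConstant : ∃ C : ℝ × ℝ × ℝ × ℕ × ℝ × ℝ × ℝ → ℝ,
    ContinuousOn C (Ioi 1 ×ˢ Ioi 0 ×ˢ Ioc 0 1 ×ˢ univ ×ˢ Ioi 0 ×ˢ Ioi 1 ×ˢ Ioi 0) ∧
    (∀ p, 0 < C p) ∧ ∀ lam K η : ℝ, ∀ N : ℕ, ∀ δ β Cτ : ℝ, 1 < lam → 0 < K → 0 < η → η ≤ 1 →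
      0 < δ → 1 < β → 0 < Cτ →
      IsPolyConstant.{u} lam K η N δ β Cτ (C (lam, K, η, N, δ, β, Cτ)) := by
  obtain ⟨C, hC, hC1, hC2⟩ := exists_continuousOn_forall_mem
    (D := (Ioi 1 ×ˢ Ioi 0 ×ˢ Ioc 0 1 ×ˢ univ ×ˢ Ioi 0 ×ˢ Ioi 1 ×ˢ Ioi 0 :
      Set (ℝ × ℝ × ℝ × ℕ × ℝ × ℝ × ℝ)))
    (s := fun p => {C : ℝ | 0 < C ∧ IsPolyConstant.{u} p.1 p.2.1 p.2.2.1 p.2.2.2.1 p.2.2.2.2.1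
      p.2.2.2.2.2.1 p.2.2.2.2.2.2 C}) 1 (fun p _ => convex_isPolyConstant _ _ _ _ _ _ _) (by
    rintro ⟨lam, K, η, N, δ, β, Cτ⟩ ⟨h1, h2, h3, -, h5, h6, h7⟩
    simp only [mem_Ioi, mem_Ioc] at h1 h2 h3 h5 h6 h7
    obtain ⟨C, hC0, hC⟩ := exists_isPolyConstant.{u} (lam₁ := (1 + lam) / 2) (K₁ := K + 1)
      (η₁ := η / 2) (δ₁ := δ / 2) (β₁ := (1 + β) / 2) (β₂ := β + 1) (C₁ := Cτ + 1) N
      (by linarith) (by linarith) (by linarith) (by linarith) (by linarith) (by linarith)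
    refine ⟨C, ?_⟩
    have e1 : ∀ᶠ x in 𝓝 lam, (1 + lam) / 2 ≤ x := eventually_ge_nhds (by linarith)
    have e2 : ∀ᶠ x in 𝓝 K, x ≤ K + 1 := eventually_le_nhds (by linarith)
    have e3 : ∀ᶠ x in 𝓝 η, η / 2 ≤ x := eventually_ge_nhds (by linarith)
    -- The parameter `max I` lives in a discrete space and is fixed locally.
    have e4 : ∀ᶠ x in 𝓝 N, x = N := by simp
    have e5 : ∀ᶠ x in 𝓝 δ, δ / 2 ≤ x := eventually_ge_nhds (by linarith)
    have e6 : ∀ᶠ x in 𝓝 β, (1 + β) / 2 ≤ x := eventually_ge_nhds (by linarith)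
    have e6' : ∀ᶠ x in 𝓝 β, x ≤ β + 1 := eventually_le_nhds (by linarith)
    have e7 : ∀ᶠ x in 𝓝 Cτ, x ≤ Cτ + 1 := eventually_le_nhds (by linarith)
    simp only [nhds_prod_eq]
    filter_upwards [e1.prod_mk (e2.prod_mk (e3.prod_mk (e4.prod_mk
      (e5.prod_mk ((e6.and e6').prod_mk e7)))))]
    rintro ⟨lam', K', η', N', δ', β', Cτ'⟩ ⟨g1, g2, g3, g4, g5, g6, g7⟩ hD
    simp only at g1 g2 g3 g4 g5 g6 g7
    subst g4
    exact ⟨hC0, hC _ _ _ _ _ _ g1 g2 g3 g5 g6.1 g6.2 hD.2.2.2.2.2.2.le g7⟩)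
  refine ⟨C, hC, fun p => ?_, fun lam K η N δ β Cτ h1 h2 h3 h3' h5 h6 h7 =>
    (hC1 (lam, K, η, N, δ, β, Cτ) ⟨h1, h2, ⟨h3, h3'⟩, trivial, h5, h6, h7⟩).2⟩
  by_cases hp : p ∈ (Ioi 1 ×ˢ Ioi 0 ×ˢ Ioc 0 1 ×ˢ univ ×ˢ Ioi 0 ×ˢ Ioi 1 ×ˢ Ioi 0 :
      Set (ℝ × ℝ × ℝ × ℕ × ℝ × ℝ × ℝ))
  · exact (hC1 p hp).1
  · rw [hC2 p hp]; exact one_pos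

open Topology Filter in
theorem exists_continuousOn_isExpConstant : ∃ B C : ℝ × ℝ × ℝ × ℕ × ℝ × ℝ × ℝ × ℝ → ℝ,
    ContinuousOn B
      (Ioi 1 ×ˢ Ioi 0 ×ˢ Ioc 0 1 ×ˢ univ ×ˢ Ioi 0 ×ˢ Ioi 0 ×ˢ Ioc 0 1 ×ˢ Ioi 0) ∧
    ContinuousOn C
      (Ioi 1 ×ˢ Ioi 0 ×ˢ Ioc 0 1 ×ˢ univ ×ˢ Ioi 0 ×ˢ Ioi 0 ×ˢ Ioc 0 1 ×ˢ Ioi 0) ∧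
    (∀ p, 0 < B p) ∧ (∀ p, 0 < C p) ∧ ∀ lam K η : ℝ, ∀ N : ℕ, ∀ δ A γ Cτ : ℝ, 1 < lam → 0 < K →
      0 < η → η ≤ 1 → 0 < δ → 0 < A → 0 < γ → γ ≤ 1 → 0 < Cτ →
      IsExpConstant.{u} lam K η N δ A γ Cτ (B (lam, K, η, N, δ, A, γ, Cτ))
        (C (lam, K, η, N, δ, A, γ, Cτ)) := by
  obtain ⟨f, hf, hf1, hf2⟩ := exists_continuousOn_forall_mem
    (D := (Ioi 1 ×ˢ Ioi 0 ×ˢ Ioc 0 1 ×ˢ univ ×ˢ Ioi 0 ×ˢ Ioi 0 ×ˢ Ioc 0 1 ×ˢ Ioi 0 :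
      Set (ℝ × ℝ × ℝ × ℕ × ℝ × ℝ × ℝ × ℝ)))
    (s := fun p => {x : ℝ × ℝ | (0 < x.1 ∧ 0 < x.2) ∧ IsExpConstant.{u} p.1 p.2.1 p.2.2.1
      p.2.2.2.1 p.2.2.2.2.1 p.2.2.2.2.2.1 p.2.2.2.2.2.2.1 p.2.2.2.2.2.2.2 x.1 x.2}) (1, 1)
    (fun p _ => convex_isExpConstant _ _ _ _ _ _ _ _) (by
    rintro ⟨lam, K, η, N, δ, A, γ, Cτ⟩ ⟨h1, h2, h3, -, h5, h6, h6', h7⟩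
    simp only [mem_Ioi, mem_Ioc] at h1 h2 h3 h5 h6 h6' h7
    obtain ⟨B, C, hB0, hC0, hC⟩ := exists_isExpConstant.{u} (lam₁ := (1 + lam) / 2)
      (K₁ := K + 1) (η₁ := η / 2) (δ₁ := δ / 2) (A₁ := A / 2) (γ₁ := γ / 2) (C₁ := Cτ + 1) N
      (by linarith) (by linarith) (by linarith) (by linarith) (by linarith) (by linarith)
      (by linarith)
    refine ⟨(B, C), ?_⟩
    have e1 : ∀ᶠ x in 𝓝 lam, (1 + lam) / 2 ≤ x := eventually_ge_nhds (by linarith)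
    have e2 : ∀ᶠ x in 𝓝 K, x ≤ K + 1 := eventually_le_nhds (by linarith)
    have e3 : ∀ᶠ x in 𝓝 η, η / 2 ≤ x := eventually_ge_nhds (by linarith)
    have e4 : ∀ᶠ x in 𝓝 N, x = N := by simp
    have e5 : ∀ᶠ x in 𝓝 δ, δ / 2 ≤ x := eventually_ge_nhds (by linarith)
    have e6 : ∀ᶠ x in 𝓝 A, A / 2 ≤ x := eventually_ge_nhds (by linarith)
    have e6' : ∀ᶠ x in 𝓝 γ, γ / 2 ≤ x := eventually_ge_nhds (by linarith)
    have e7 : ∀ᶠ x in 𝓝 Cτ, x ≤ Cτ + 1 := eventually_le_nhds (by linarith)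
    simp only [nhds_prod_eq]
    filter_upwards [e1.prod_mk (e2.prod_mk (e3.prod_mk (e4.prod_mk
      (e5.prod_mk (e6.prod_mk (e6'.prod_mk e7))))))]
    rintro ⟨lam', K', η', N', δ', A', γ', Cτ'⟩ ⟨g1, g2, g3, g4, g5, g6, g6', g7⟩ hD
    simp only at g1 g2 g3 g4 g5 g6 g6' g7
    subst g4
    exact ⟨⟨hB0, hC0⟩, hC _ _ _ _ _ _ _ g1 g2 g3 g5 g6 g6' hD.2.2.2.2.2.2.1.2
      hD.2.2.2.2.2.2.2.le g7⟩)
  have hpos : ∀ p, 0 < (f p).1 ∧ 0 < (f p).2 := fun p => by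
    by_cases hp : p ∈ (Ioi 1 ×ˢ Ioi 0 ×ˢ Ioc 0 1 ×ˢ univ ×ˢ Ioi 0 ×ˢ Ioi 0 ×ˢ Ioc 0 1 ×ˢ Ioi 0 :
      Set (ℝ × ℝ × ℝ × ℕ × ℝ × ℝ × ℝ × ℝ))
    · exact (hf1 p hp).1
    · rw [hf2 p hp]; exact ⟨one_pos, one_pos⟩
  exact ⟨fun p => (f p).1, fun p => (f p).2, hf.fst, hf.snd, fun p => (hpos p).1,
    fun p => (hpos p).2, fun lam K η N δ A γ Cτ h1 h2 h3 h3' h5 h6 h6' h6'' h7 =>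
    (hf1 (lam, K, η, N, δ, A, γ, Cτ) ⟨h1, h2, ⟨h3, h3'⟩, trivial, h5, h6, ⟨h6', h6''⟩, h7⟩).2⟩

end YoungTower

/-- In the tuples of parameters below, the fourth entry is `max I`. -/
theorem mainTheorem5 :
    (∃ C : ℝ × ℝ × ℝ × ℕ × ℝ × ℝ × ℝ → ℝ,
      ContinuousOn C (Ioi 1 ×ˢ Ioi 0 ×ˢ Ioc 0 1 ×ˢ univ ×ˢ Ioi 0 ×ˢ Ioi 1 ×ˢ Ioi 0) ∧
      (∀ p, 0 < C p) ∧
      ∀ (Y : Type u) [MeasurableSpace Y] [MetricSpace Y] (m : Measure Y) [IsProbabilityMeasure m]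
        (lam K η : ℝ) (T : YoungTower m lam K η) (d : ℕ) (I : Finset ℕ) (δ : ℝ),
        T.IsNonmixing d I δ →
        ∀ β Cτ : ℝ, 1 < β → 0 < Cτ →
        (∀ n : ℕ, 0 < n → m.real {y | n ≤ T.τ y} ≤ Cτ * (n : ℝ) ^ (-β)) →
        ∀ φ : T.Space → ℝ, AEStronglyMeasurable φ T.measure → T.holderNorm φ < ∞ →
        ∫ x, φ x ∂T.measure = 0 →
        ∀ n : ℕ, 0 < n →
          T.cycleDecay d φ n ≤
            C (lam, K, η, I.sup id, δ, β, Cτ) * (T.holderNorm φ).toReal *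
              (n : ℝ) ^ (-(β - 1))) ∧
    (∃ B C : ℝ × ℝ × ℝ × ℕ × ℝ × ℝ × ℝ × ℝ → ℝ,
      ContinuousOn B
        (Ioi 1 ×ˢ Ioi 0 ×ˢ Ioc 0 1 ×ˢ univ ×ˢ Ioi 0 ×ˢ Ioi 0 ×ˢ Ioc 0 1 ×ˢ Ioi 0) ∧
      ContinuousOn C
        (Ioi 1 ×ˢ Ioi 0 ×ˢ Ioc 0 1 ×ˢ univ ×ˢ Ioi 0 ×ˢ Ioi 0 ×ˢ Ioc 0 1 ×ˢ Ioi 0) ∧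
      (∀ p, 0 < B p) ∧ (∀ p, 0 < C p) ∧
      ∀ (Y : Type u) [MeasurableSpace Y] [MetricSpace Y] (m : Measure Y) [IsProbabilityMeasure m]
        (lam K η : ℝ) (T : YoungTower m lam K η) (d : ℕ) (I : Finset ℕ) (δ : ℝ),
        T.IsNonmixing d I δ →
        ∀ A γ Cτ : ℝ, 0 < A → 0 < γ → γ ≤ 1 → 0 < Cτ →
        (∀ n : ℕ, 0 < n → m.real {y | n ≤ T.τ y} ≤ Cτ * Real.exp (-A * (n : ℝ) ^ γ)) →
        ∀ φ : T.Space → ℝ, AEStronglyMeasurable φ T.measure → T.holderNorm φ < ∞ →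
        ∫ x, φ x ∂T.measure = 0 →
        ∀ n : ℕ,
          T.cycleDecay d φ n ≤
            C (lam, K, η, I.sup id, δ, A, γ, Cτ) * (T.holderNorm φ).toReal *
              Real.exp (-B (lam, K, η, I.sup id, δ, A, γ, Cτ) * (n : ℝ) ^ γ)) := by
  obtain ⟨C, hC, hC0, hC1⟩ := YoungTower.exists_continuousOn_isPolyConstant.{u}
  obtain ⟨B, C', hB, hC', hB0, hC'0, hBC⟩ := YoungTower.exists_continuousOn_isExpConstant.{u}
  refine ⟨⟨C, hC, hC0, ?_⟩, ⟨B, C', hB, hC', hB0, hC'0, ?_⟩⟩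
  · intro Y _ _ m _ lam K η T d I δ hT β Cτ hβ hCτ hτ φ hφ hφM hφ0 n hn
    exact hC1 lam K η (I.sup id) δ β Cτ T.one_lt_lam T.K_pos T.η_pos T.η_le_one hT.δ_pos hβ hCτ
      Y m T d I hT rfl hτ φ hφ hφM hφ0 n hn
  · intro Y _ _ m _ lam K η T d I δ hT A γ Cτ hA hγ hγ1 hCτ hτ φ hφ hφM hφ0 n
    exact hBC lam K η (I.sup id) δ A γ Cτ T.one_lt_lam T.K_pos T.η_pos T.η_le_one hT.δ_pos hA hγ
      hγ1 hCτ Y m T d I hT rfl hτ φ hφ hφM hφ0 n
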